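/- Let $\mathbb{K}$ be a commutative ring containing $\mathbb{Q}$ (placed in degree $0$; for instance a field of characteristic zero), and let $V=\bigoplus_{n\ge 0}V^n$ be a non-negatively graded, unital, graded commutative $\mathbb{K}$-algebra (with zero differential) which is free as a graded module on a homogeneous basis $(x_i)$ containing the unit $1$. Write $\Sigma V^*=\operatorname{Hom}_{\mathbb{K}}(\Sigma V,\mathbb{K})$, where $(\Sigma V)^n=V^{n+1}$; it has the dual topological basis $(t_i)$, with $|t_i|=1-|x_i|$. For a profinite graded module $W$ let $\widehat{L}W$ be the pro-free graded Lie algebra on $W$ (convergent infinite linear combinations of Lie monomials inside the completed tensor algebra), and let $DR^0_{\mathrm{Lie}}(\widehat{L}W)$ be the quotient of $\widehat{L}W\hat\otimes\widehat{L}W$ by the closed submodule generated by $x\otimes y-(-1)^{|x||y|}y\otimes x$ and $[x,y]\otimes z-x\otimes[y,z]$. The multiplication of $V$ defines a continuous derivation $m$ of $\widehat{L}(\Sigma V^*)$ of degree one with $m^2=0$, namely $m(t_c)=\sum_{a,b}(-1)^{|x_a|}\mu_{ab}^c\,t_at_b$ where $x_ax_b=\sum_c\mu_{ab}^c x_c$.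 The cyclic Harrison complex $CC_{\mathrm{Harr}}(V)$ is $\Sigma DR^0_{\mathrm{Lie}}(\widehat{L}(\Sigma V^*))$ with the differential induced by $x\otimes y\mapsto m(x)\otimes y+(-1)^{|x|}x\otimes m(y)$. It is bigraded: bidegree $(i,j)$ consists of the $0$-forms of order $i$ (number of letters) and of degree $j$ in the suspension, and the differential has bidegree $(1,1)$. Let $HC^{ij}_{\mathrm{Harr}}(V)$ be its cohomology. Put $\bar V=V/\mathbb{K}$, so that $\Sigma\bar V^*\subset\Sigma V^*$ is the submodule topologically spanned by the $t_i$ other than the one dual to $1$. The normalised $0$-forms $\Sigma DR^0_{\mathrm{Lie}}(\widehat{L}(\Sigma\bar V^*))$ form a subcomplex of $CC_{\mathrm{Harr}}(V)$; denote its cohomology by $HC^{ij}_{\mathrm{Harr,norm}}(V)$, and let $\iota:HC^{ij}_{\mathrm{Harr,norm}}(V)\to HC^{ij}_{\mathrm{Harr}}(V)$ be the map induced by the inclusion. Then $\iota$ is an isomorphism for all $(i,j)\in\mathbb{Z}^2$ with $(i,j)\ne(3,2)$. In bidegree $(3,2)$ there is a short exact sequence $$0\to HC^{32}_{\mathrm{Harr,norm}}(V)\xrightarrow{\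 \iota\ }HC^{32}_{\mathrm{Harr}}(V)\xrightarrow{\ \pi\ }HC^{32}_{\mathrm{Harr}}(\mathbb{K})\to 0,$$ where $\pi$ is dual to the inclusion of the unit $\mathbb{K}\subset V$, and $HC^{32}_{\mathrm{Harr}}(\mathbb{K})\cong\mathbb{K}$. -/

import Mathlib

open scoped BigOperators

namespace CyclicHarrison

section FormalModules

variable {K : Type*} [CommRing K]

/-- For a set `X`, the module `X → K` of all (possibly infinite) formal linear combinations of the
elements of `X` is the profinite module with topological basis `X`; its inverse limit topology is
the topology of pointwise convergence, `K` being discrete.  `formalClosure M` is the closure of a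
submodule `M` in this topology. -/
def formalClosure {X : Type*} (M : Submodule K (X → K)) : Submodule K (X → K) where
  carrier := {f | ∀ s : Finset X, ∃ g ∈ M, ∀ x ∈ s, g x = f x}
  add_mem' := by
    intro f f' hf hf' s
    obtain ⟨g, hg, h⟩ := hf s
    obtain ⟨g', hg', h'⟩ := hf' s
    exact ⟨g + g', M.add_mem hg hg', fun x hx => by simp [h x hx, h' x hx]⟩
  zero_mem' := fun _ => ⟨0, M.zero_mem, fun _ _ => rfl⟩
  smul_mem' := by
    intro c f hf s
    obtain ⟨g, hg, h⟩ := hf s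
    exact ⟨c • g, M.smul_mem c hg, fun x hx => by simp [h x hx]⟩

theorem le_formalClosure {X : Type*} (M : Submodule K (X → K)) : M ≤ formalClosure M :=
  fun f hf _ => ⟨f, hf, fun _ _ => rfl⟩

/-- Continuity of a linear map between modules of formal linear combinations: each coefficient of
the value depends on finitely many coefficients of the argument. -/
def IsFormal {X Y : Type*} (T : (X → K) →ₗ[K] (Y → K)) : Prop :=
  ∀ y, ∃ s : Finset X, ∀ f, (∀ x ∈ s, f x = 0) → T f y = 0

theorem map_formalClosure {X Y : Type*} {T : (X → K) →ₗ[K] (Y → K)} (hT : IsFormal T)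
    {M : Submodule K (X → K)} {N : Submodule K (Y → K)}
    (h : ∀ f ∈ M, T f ∈ formalClosure N) : ∀ f ∈ formalClosure M, T f ∈ formalClosure N := by
  classical
  intro f hf s
  choose a ha using hT
  obtain ⟨g, hg, hgf⟩ := hf (s.biUnion a)
  obtain ⟨k, hk, hkg⟩ := h g hg s
  refine ⟨k, hk, fun y hy => ?_⟩
  rw [hkg y hy]
  have := ha y (g - f) (fun x hx => by
    simp [hgf x (Finset.mem_biUnion.2 ⟨y, hy, hx⟩)])
  rw [map_sub] at this
  exact sub_eq_zero.1 this

theorem formalClosure_mono {X : Type*} {M N : Submodule K (X → K)} (h : M ≤ N) :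
    formalClosure M ≤ formalClosure N := by
  intro f hf s
  obtain ⟨g, hg, hgf⟩ := hf s
  exact ⟨g, h hg, hgf⟩

/-- The Koszul sign `(-1) ^ n`. -/
def ksign (K : Type*) [CommRing K] (n : ℤ) : K := ((n.negOnePow : ℤ) : K)

theorem ksign_add (a b : ℤ) : ksign K (a + b) = ksign K a * ksign K b := by
  simp [ksign, Int.negOnePow_add]

theorem ksign_mul_self (a : ℤ) : ksign K a * ksign K a = 1 := by
  rw [← ksign_add, ksign, Int.negOnePow_even _ ⟨a, rfl⟩]; simp

theorem ksign_one : ksign K 1 = -1 := by simp [ksign]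

theorem ksign_zero : ksign K 0 = 1 := by simp [ksign]

theorem ksign_neg (a : ℤ) : ksign K (-a) = ksign K a := by simp [ksign]

theorem ksign_sub (a b : ℤ) : ksign K (a - b) = ksign K a * ksign K b := by
  rw [sub_eq_add_neg, ksign_add, ksign_neg]

theorem ksign_even {a : ℤ} (h : Even a) : ksign K a = 1 := by
  simp [ksign, Int.negOnePow_even _ h]

theorem ksign_odd {a : ℤ} (h : Odd a) : ksign K a = -1 := by
  simp [ksign, Int.negOnePow_odd _ h]

end FormalModules

/-! ### The pro-free Lie algebra on `W = ΣV*` and its Lie `0`-forms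

Let `V` be a free graded module with homogeneous basis `(x i)`, `i : ι`, `x i` of degree `deg i`.
Then `ΣV*` has the dual topological basis `(t i)` with `t i` of degree `1 - deg i`, and the
completed tensor algebra of `ΣV*` is the algebra `K⟨⟨t⟩⟩` of noncommutative power series, that is,
the module `List ι → K` of formal linear combinations of words in the letters `t i`. -/

section LieForms

variable {K : Type*} [CommRing K] {ι : Type*}

/-- The degree of the word `t i₁ ⋯ t iₙ`. (Its order is its length `n`.) -/
def wordDeg (deg : ι → ℕ) (w : List ι) : ℤ := (w.map fun i => 1 - (deg i : ℤ)).sum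

/-- The graded commutator `[f, g]` in `K⟨⟨t⟩⟩`: the bilinear extension of
`[f, g] = f g - (-1) ^ (|f| |g|) g f` from homogeneous series. -/
def bracket (deg : ι → ℕ) (f g : List ι → K) : List ι → K := fun w =>
  ∑ k ∈ Finset.range (w.length + 1), (f (w.take k) * g (w.drop k) -
    ksign K (wordDeg deg (w.take k) * wordDeg deg (w.drop k)) * (g (w.take k) * f (w.drop k)))

/-- Lie monomials in the submodule of `ΣV*` (topologically) spanned by the letters in `S`. -/
inductive IsLieMonomial (K : Type*) [CommRing K] (deg : ι → ℕ) (S : Set ι) : (List ι → K) → Prop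
  | of (f : List ι → K) (hf : ∀ w, f w ≠ 0 → ∃ i ∈ S, w = [i]) : IsLieMonomial K deg S f
  | bracket (f g : List ι → K) (hf : IsLieMonomial K deg S f) (hg : IsLieMonomial K deg S g) :
      IsLieMonomial K deg S (bracket deg f g)

/-- The pro-free graded Lie algebra on the letters `t i`, `i ∈ S`: all convergent infinite linear
combinations of Lie monomials, inside `K⟨⟨t⟩⟩`. -/
def freeLie (K : Type*) [CommRing K] (deg : ι → ℕ) (S : Set ι) : Submodule K (List ι → K) :=
  formalClosure (Submodule.span K {f | IsLieMonomial K deg S f})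

/-- The element `f ⊗ g` of the completed tensor square of `K⟨⟨t⟩⟩`, which is the module of formal
linear combinations of pairs of words. -/
def tens (f g : List ι → K) : List ι × List ι → K := fun p => f p.1 * g p.2

/-- The symmetry `x ⊗ y ↦ (-1) ^ (|x| |y|) y ⊗ x` of the completed tensor square. -/
def swapTensor (deg : ι → ℕ) (F : List ι × List ι → K) : List ι × List ι → K := fun p =>
  ksign K (wordDeg deg p.1 * wordDeg deg p.2) * F (p.2, p.1)

/-- The completed tensor square of the pro-free Lie algebra `freeLie K deg S`. -/
def lieTensor (K : Type*) [CommRing K] (deg : ι → ℕ) (S : Set ι) :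
    Submodule K (List ι × List ι → K) :=
  formalClosure (Submodule.span K
    {F | ∃ x ∈ freeLie K deg S, ∃ y ∈ freeLie K deg S, F = tens x y})

/-- The closed submodule generated by the relations `x ⊗ y = (-1) ^ (|x| |y|) y ⊗ x` and
`[x, y] ⊗ z = x ⊗ [y, z]` for `x, y, z` in the pro-free Lie algebra. -/
def lieRelations (K : Type*) [CommRing K] (deg : ι → ℕ) (S : Set ι) :
    Submodule K (List ι × List ι → K) :=
  formalClosure (Submodule.span K
    ({F | ∃ x ∈ freeLie K deg S, ∃ y ∈ freeLie K deg S, F = tens x y - swapTensor deg (tens x y)} ∪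
     {F | ∃ x ∈ freeLie K deg S, ∃ y ∈ freeLie K deg S, ∃ z ∈ freeLie K deg S,
        F = tens (bracket deg x y) z - tens x (bracket deg y z)}))

/-- The module `DR⁰_Lie` of Lie `0`-forms on the pro-free Lie algebra on the letters in `S`. -/
abbrev ZeroForms (K : Type*) [CommRing K] (deg : ι → ℕ) (S : Set ι) : Type _ :=
  (lieTensor K deg S) ⧸ (lieRelations K deg S).comap (lieTensor K deg S).subtype

/-- The formal combinations of pairs of words whose total order is `i` and whose total degree is
`j + 1`, that is, whose degree after suspension is `j`. -/
def homogeneousPart (K : Type*) [CommRing K] (deg : ι → ℕ) (i j : ℤ) :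
    Submodule K (List ι × List ι → K) where
  carrier := {F | ∀ p, F p ≠ 0 →
    ((p.1.length + p.2.length : ℕ) : ℤ) = i ∧ wordDeg deg p.1 + wordDeg deg p.2 = j + 1}
  add_mem' := by
    intro F G hF hG p hp
    by_cases h : F p = 0
    · exact hG p (fun h' => hp (by simp [h, h']))
    · exact hF p h
  zero_mem' := fun p hp => absurd rfl hp
  smul_mem' := fun c F hF p hp => hF p (fun h => hp (by simp [h]))

/-- The Lie `0`-forms of bidegree `(i, j)`: of order `i`, and of degree `j` in the suspension
`Σ DR⁰_Lie`. -/
def zeroFormsBideg (K : Type*) [CommRing K] (deg : ι → ℕ) (S : Set ι) (i j : ℤ) :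
    Submodule K (ZeroForms K deg S) :=
  ((homogeneousPart K deg i j).comap (lieTensor K deg S).subtype).map
    ((lieRelations K deg S).comap (lieTensor K deg S).subtype).mkQ

theorem IsLieMonomial.mono {deg : ι → ℕ} {S T : Set ι} (h : S ⊆ T) {f : List ι → K}
    (hf : IsLieMonomial K deg S f) : IsLieMonomial K deg T f := by
  induction hf with
  | of f hf => exact .of f fun w hw => let ⟨i, hi, e⟩ := hf w hw; ⟨i, h hi, e⟩
  | bracket f g _ _ hf hg => exact .bracket f g hf hg

theorem freeLie_mono (deg : ι → ℕ) {S T : Set ι} (h : S ⊆ T) :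
    freeLie K deg S ≤ freeLie K deg T :=
  formalClosure_mono (Submodule.span_mono fun _ hf => IsLieMonomial.mono h hf)

theorem lieTensor_mono (deg : ι → ℕ) {S T : Set ι} (h : S ⊆ T) :
    lieTensor K deg S ≤ lieTensor K deg T := by
  refine formalClosure_mono (Submodule.span_mono ?_)
  rintro _ ⟨x, hx, y, hy, rfl⟩
  exact ⟨x, freeLie_mono deg h hx, y, freeLie_mono deg h hy, rfl⟩

theorem lieRelations_mono (deg : ι → ℕ) {S T : Set ι} (h : S ⊆ T) :
    lieRelations K deg S ≤ lieRelations K deg T := by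
  refine formalClosure_mono (Submodule.span_mono (Set.union_subset_union ?_ ?_))
  · rintro _ ⟨x, hx, y, hy, rfl⟩
    exact ⟨x, freeLie_mono deg h hx, y, freeLie_mono deg h hy, rfl⟩
  · rintro _ ⟨x, hx, y, hy, z, hz, rfl⟩
    exact ⟨x, freeLie_mono deg h hx, y, freeLie_mono deg h hy, z, freeLie_mono deg h hz, rfl⟩

/-- The map of `0`-forms induced by the inclusion of the pro-free Lie algebra on the letters in `S`
into the pro-free Lie algebra on all letters. -/
def zeroFormsIncl (K : Type*) [CommRing K] (deg : ι → ℕ) (S : Set ι) :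
    ZeroForms K deg S →ₗ[K] ZeroForms K deg Set.univ :=
  Submodule.mapQ _ _ (Submodule.inclusion (lieTensor_mono deg (Set.subset_univ S)))
    (fun _ hF => lieRelations_mono deg (Set.subset_univ S) hF)

theorem zeroFormsIncl_bideg_le (deg : ι → ℕ) (S : Set ι) (i j : ℤ) :
    (zeroFormsBideg K deg S i j).map (zeroFormsIncl K deg S) ≤
      zeroFormsBideg K deg Set.univ i j := by
  unfold zeroFormsBideg zeroFormsIncl
  rw [← Submodule.map_comp, Submodule.mapQ_mkQ, Submodule.map_comp]
  refine Submodule.map_mono ?_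
  rw [Submodule.map_le_iff_le_comap]
  exact fun _ hF => hF

end LieForms

/-! ### The differential -/

section Differential

variable {K : Type*} [CommRing K] {ι : Type*}

/-- The vector field `m` of degree one on `K⟨⟨t⟩⟩` dual to a multiplication with structure constants
`x i * x j = ∑ c, μ i j c • x c`: the continuous derivation with
`m (t c) = ∑ i j, (-1) ^ (deg i) μ i j c • t i t j` (see `vectorField_mul` for the derivation
property). Written through coefficients: `vectorFieldCoeff μ deg w f` is the coefficient of the
word `w` in `m f`. -/
def vectorFieldCoeff (μ : ι → ι → ι →₀ K) (deg : ι → ℕ) : List ι → (List ι → K) → K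
  | [], _ => 0
  | [_], _ => 0
  | i :: j :: w, f =>
      ksign K (deg i) * ((μ i j).sum fun c r => r * f (c :: w)) +
        ksign K (1 - deg i) * vectorFieldCoeff μ deg (j :: w) (fun v => f (i :: v))

theorem vectorFieldCoeff_add (μ : ι → ι → ι →₀ K) (deg : ι → ℕ) (w : List ι) :
    ∀ f g : List ι → K, vectorFieldCoeff μ deg w (f + g) =
      vectorFieldCoeff μ deg w f + vectorFieldCoeff μ deg w g := by
  induction w with
  | nil => simp [vectorFieldCoeff]
  | cons i w ih =>
    cases w with
    | nil => simp [vectorFieldCoeff]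
    | cons j w =>
      intro f g
      have := ih (fun v => f (i :: v)) (fun v => g (i :: v))
      simp only [vectorFieldCoeff, Pi.add_apply, mul_add, Finsupp.sum_add]
      rw [show (fun v => f (i :: v) + g (i :: v)) =
        (fun v => f (i :: v)) + (fun v => g (i :: v)) from rfl, this]
      ring

theorem vectorFieldCoeff_smul (μ : ι → ι → ι →₀ K) (deg : ι → ℕ) (w : List ι) :
    ∀ (a : K) (f : List ι → K), vectorFieldCoeff μ deg w (a • f) =
      a * vectorFieldCoeff μ deg w f := by
  induction w with
  | nil => simp [vectorFieldCoeff]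
  | cons i w ih =>
    cases w with
    | nil => simp [vectorFieldCoeff]
    | cons j w =>
      intro a f
      have := ih a (fun v => f (i :: v))
      simp only [vectorFieldCoeff, Pi.smul_apply, smul_eq_mul]
      rw [show (fun v => a * f (i :: v)) = a • (fun v => f (i :: v)) from rfl, this]
      simp only [Finsupp.sum, Finset.mul_sum, mul_add]
      congr 1
      · refine Finset.sum_congr rfl fun c _ => by ring
      · ring

/-- The vector field `m` as a linear map. -/
def vectorField (μ : ι → ι → ι →₀ K) (deg : ι → ℕ) : (List ι → K) →ₗ[K] (List ι → K) where
  toFun f w := vectorFieldCoeff μ deg w f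
  map_add' f g := funext fun w => vectorFieldCoeff_add μ deg w f g
  map_smul' a f := funext fun w => vectorFieldCoeff_smul μ deg w a f

/-- The Lie operator `L_m (x ⊗ y) = m x ⊗ y + (-1) ^ |x| x ⊗ m y`. -/
def lieOperator (μ : ι → ι → ι →₀ K) (deg : ι → ℕ) :
    (List ι × List ι → K) →ₗ[K] (List ι × List ι → K) where
  toFun F p := vectorField μ deg (fun u => F (u, p.2)) p.1 +
    ksign K (wordDeg deg p.1) * vectorField μ deg (fun v => F (p.1, v)) p.2
  map_add' F G := funext fun p => by
    have h1 : (fun u => (F + G) (u, p.2)) = (fun u => F (u, p.2)) + fun u => G (u, p.2) := rfl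
    have h2 : (fun v => (F + G) (p.1, v)) = (fun v => F (p.1, v)) + fun v => G (p.1, v) := rfl
    rw [h1, h2, map_add, map_add]; simp only [Pi.add_apply]; ring
  map_smul' a F := funext fun p => by
    have h1 : (fun u => (a • F) (u, p.2)) = a • (fun u => F (u, p.2)) := rfl
    have h2 : (fun v => (a • F) (p.1, v)) = a • (fun v => F (p.1, v)) := rfl
    rw [h1, h2, map_smul, map_smul]
    simp only [Pi.smul_apply, smul_eq_mul, RingHom.id_apply]; ring

end Differential

/-! ### The differential respects Lie `0`-forms -/

section WellDefined

variable {K : Type*} [CommRing K] {ι : Type*}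

/-- The structure constants of a graded commutative multiplication. -/
structure IsGradedCommStructure (μ : ι → ι → ι →₀ K) (deg : ι → ℕ) : Prop where
  deg_eq : ∀ i j c, μ i j c ≠ 0 → deg c = deg i + deg j
  comm : ∀ i j c, μ i j c = ksign K ((deg i : ℤ) * deg j) * μ j i c

theorem wordDeg_cons (deg : ι → ℕ) (i : ι) (w : List ι) :
    wordDeg deg (i :: w) = (1 - (deg i : ℤ)) + wordDeg deg w := by simp [wordDeg]

theorem wordDeg_append (deg : ι → ℕ) (u w : List ι) :
    wordDeg deg (u ++ w) = wordDeg deg u + wordDeg deg w := by simp [wordDeg]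

/-- The product of `K⟨⟨t⟩⟩`. -/
def seriesMul (f g : List ι → K) : List ι → K := fun w =>
  ∑ k ∈ Finset.range (w.length + 1), f (w.take k) * g (w.drop k)

theorem seriesMul_nil (f g : List ι → K) : seriesMul f g [] = f [] * g [] := by
  simp [seriesMul]

theorem seriesMul_cons (f g : List ι → K) (i : ι) (w : List ι) :
    seriesMul f g (i :: w) = f [] * g (i :: w) + seriesMul (fun v => f (i :: v)) g w := by
  rw [seriesMul, List.length_cons, Finset.sum_range_succ']
  simp [seriesMul, add_comm]

theorem seriesMul_add_left (f f' g : List ι → K) :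
    seriesMul (f + f') g = seriesMul f g + seriesMul f' g := by
  funext w; simp [seriesMul, add_mul, Finset.sum_add_distrib]

theorem seriesMul_add_right (f g g' : List ι → K) :
    seriesMul f (g + g') = seriesMul f g + seriesMul f g' := by
  funext w; simp [seriesMul, mul_add, Finset.sum_add_distrib]

theorem seriesMul_smul_left (a : K) (f g : List ι → K) :
    seriesMul (a • f) g = a • seriesMul f g := by
  funext w; simp [seriesMul, Finset.mul_sum, mul_assoc]

theorem seriesMul_smul_right (a : K) (f g : List ι → K) :
    seriesMul f (a • g) = a • seriesMul f g := by
  funext w; simp [seriesMul, Finset.mul_sum, mul_left_comm]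

theorem seriesMul_neg_left (f g : List ι → K) : seriesMul (-f) g = -seriesMul f g := by
  have := seriesMul_smul_left (-1) f g
  simpa using this

/-- The series obtained by multiplying the coefficient of each word by a function of its degree. -/
def weight (deg : ι → ℕ) (χ : ℤ → K) (f : List ι → K) : List ι → K :=
  fun w => χ (wordDeg deg w) * f w

/-- The part of `vectorField` in which the two first letters are multiplied. -/
def headMerge (μ : ι → ι → ι →₀ K) (deg : ι → ℕ) (i : ι) (f : List ι → K) : List ι → K
  | [] => 0
  | j :: w => ksign K (deg i) * ((μ i j).sum fun c r => r * f (c :: w))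

theorem vectorField_nil (μ : ι → ι → ι →₀ K) (deg : ι → ℕ) (f : List ι → K) :
    vectorField μ deg f [] = 0 := rfl

theorem vectorField_cons (μ : ι → ι → ι →₀ K) (deg : ι → ℕ) (f : List ι → K) (i : ι)
    (w : List ι) : vectorField μ deg f (i :: w) =
      headMerge μ deg i f w + ksign K (1 - deg i) * vectorField μ deg (fun v => f (i :: v)) w := by
  cases w with
  | nil => simp [vectorField, vectorFieldCoeff, headMerge]
  | cons j w => rfl

theorem headMerge_mul (μ : ι → ι → ι →₀ K) (deg : ι → ℕ) (i : ι) (f g : List ι → K)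
    (w : List ι) : headMerge μ deg i (seriesMul f g) w =
      f [] * headMerge μ deg i g w + seriesMul (headMerge μ deg i f) g w := by
  cases w with
  | nil => simp [headMerge, seriesMul_nil]
  | cons j w =>
    simp only [headMerge, seriesMul_cons, zero_mul, zero_add, mul_add, Finsupp.sum]
    rw [Finset.sum_add_distrib, mul_add]
    congr 1
    · simp only [Finset.mul_sum]
      exact Finset.sum_congr rfl fun c _ => by ring
    · simp only [seriesMul, Finset.mul_sum, Finset.sum_mul]
      rw [Finset.sum_comm]
      exact Finset.sum_congr rfl fun c _ => Finset.sum_congr rfl fun k _ => by ring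

/-- `m (f g) = m f g + (-1) ^ |f| f m g`. -/
theorem vectorField_mul (μ : ι → ι → ι →₀ K) (deg : ι → ℕ) (g : List ι → K) (w : List ι) :
    ∀ f, vectorField μ deg (seriesMul f g) w =
      seriesMul (vectorField μ deg f) g w +
        seriesMul (weight deg (ksign K) f) (vectorField μ deg g) w := by
  induction w with
  | nil => intro f; simp [vectorField_nil, seriesMul_nil]
  | cons i w ih =>
    intro f
    have e1 : (fun v => seriesMul f g (i :: v)) =
        f [] • (fun v => g (i :: v)) + seriesMul (fun v => f (i :: v)) g := by
      funext v; simp [seriesMul_cons]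
    have e2 : (fun v => vectorField μ deg f (i :: v)) =
        headMerge μ deg i f + ksign K (1 - deg i) • vectorField μ deg (fun v => f (i :: v)) := by
      funext v; simp [vectorField_cons]
    have e3 : (fun v => weight deg (ksign K) f (i :: v)) =
        ksign K (1 - deg i) • weight deg (ksign K) (fun v => f (i :: v)) := by
      funext v; simp [weight, wordDeg_cons, ksign_add, mul_assoc]
    have e4 : weight deg (ksign K) f [] = f [] := by simp [weight, wordDeg, ksign_zero]
    rw [vectorField_cons, headMerge_mul, e1, map_add, map_smul, seriesMul_cons, e2, seriesMul_cons,
      e3, e4, seriesMul_add_left, seriesMul_smul_left, seriesMul_smul_left, vectorField_nil,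
      vectorField_cons]
    simp only [Pi.add_apply, Pi.smul_apply, smul_eq_mul, ih]
    ring

/-- `m` has degree one. -/
theorem vectorField_weight {μ : ι → ι → ι →₀ K} {deg : ι → ℕ} (hμ : IsGradedCommStructure μ deg)
    (w : List ι) : ∀ (χ : ℤ → K) (f : List ι → K), vectorField μ deg (weight deg χ f) w =
      χ (wordDeg deg w - 1) * vectorField μ deg f w := by
  induction w with
  | nil => intro χ f; simp [vectorField_nil]
  | cons i w ih =>
    intro χ f
    have e : (fun v => weight deg χ f (i :: v)) =
        weight deg (fun n => χ ((1 - (deg i : ℤ)) + n)) (fun v => f (i :: v)) := by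
      funext v; simp [weight, wordDeg_cons]
    have h : headMerge μ deg i (weight deg χ f) w =
        χ (wordDeg deg (i :: w) - 1) * headMerge μ deg i f w := by
      cases w with
      | nil => simp [headMerge]
      | cons j w =>
        simp only [headMerge, Finsupp.sum, Finset.mul_sum]
        refine Finset.sum_congr rfl fun c hc => ?_
        have := hμ.deg_eq i j c (Finsupp.mem_support_iff.1 hc)
        have e : wordDeg deg (c :: w) = wordDeg deg (i :: j :: w) - 1 := by
          simp only [wordDeg_cons, this]; push_cast; ring
        simp only [weight, e]; ring
    rw [vectorField_cons, vectorField_cons, e, ih, h, wordDeg_cons, add_sub_assoc]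
    ring

theorem isFormal_vectorField (μ : ι → ι → ι →₀ K) (deg : ι → ℕ) :
    IsFormal (vectorField μ deg) := by
  classical
  intro w
  induction w with
  | nil => exact ⟨∅, fun _ _ => rfl⟩
  | cons i w ih =>
    obtain ⟨s, hs⟩ := ih
    cases w with
    | nil => exact ⟨∅, fun _ _ => rfl⟩
    | cons j w =>
      refine ⟨s.image (List.cons i) ∪ (μ i j).support.image (fun c => c :: w), fun f hf => ?_⟩
      rw [vectorField_cons, hs _ fun x hx => hf _ (Finset.mem_union_left _
        (Finset.mem_image_of_mem _ hx))]
      simp only [headMerge, Finsupp.sum, mul_zero, add_zero]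
      rw [Finset.sum_eq_zero, mul_zero]
      intro c hc
      rw [hf _ (Finset.mem_union_right _ (Finset.mem_image_of_mem _ hc)), mul_zero]

open Classical in
theorem bracket_eq (deg : ι → ℕ) (f g : List ι → K) :
    bracket deg f g = seriesMul f g -
      (seriesMul g (weight deg (fun n => if Even n then 1 else 0) f) +
        seriesMul (weight deg (ksign K) g) (weight deg (fun n => if Even n then 0 else 1) f)) := by
  funext w
  simp only [bracket, seriesMul, Pi.sub_apply, Pi.add_apply, ← Finset.sum_add_distrib,
    ← Finset.sum_sub_distrib, weight]
  refine Finset.sum_congr rfl fun k _ => ?_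
  by_cases h : Even (wordDeg deg (w.drop k))
  · simp [h, ksign_even (h.mul_left _)]
  · have h' := Int.not_even_iff_odd.1 h
    have : ksign K (wordDeg deg (w.take k) * wordDeg deg (w.drop k)) =
        ksign K (wordDeg deg (w.take k)) := by
      rcases Int.even_or_odd (wordDeg deg (w.take k)) with h2 | h2
      · rw [ksign_even h2, ksign_even (h2.mul_right _)]
      · rw [ksign_odd h2, ksign_odd (h2.mul h')]
    simp [h, this, mul_assoc]

/-- `m [f, g] = [m f, g] + (-1) ^ |f| [f, m g]`. -/
theorem vectorField_bracket {μ : ι → ι → ι →₀ K} {deg : ι → ℕ}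
    (hμ : IsGradedCommStructure μ deg) (f g : List ι → K) :
    vectorField μ deg (bracket deg f g) = bracket deg (vectorField μ deg f) g +
      bracket deg (weight deg (ksign K) f) (vectorField μ deg g) := by
  classical
  have D : ∀ a b, vectorField μ deg (seriesMul a b) = seriesMul (vectorField μ deg a) b +
      seriesMul (weight deg (ksign K) a) (vectorField μ deg b) :=
    fun a b => funext fun w => vectorField_mul μ deg b w a
  have W : ∀ (χ : ℤ → K) (a), vectorField μ deg (weight deg χ a) =
      weight deg (fun n => χ (n - 1)) (vectorField μ deg a) :=
    fun χ a => funext fun w => vectorField_weight hμ w χ a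
  have E1 : (fun n : ℤ => ksign K (n - 1)) = fun n => - ksign K n := by
    funext n; simp [ksign_sub, ksign_one]
  have E2 : (fun n : ℤ => (if Even (n - 1) then 1 else 0 : K)) =
      fun n => if Even n then 0 else 1 := by
    funext n; by_cases h : Even n <;> simp [h, Int.even_sub_one]
  have E3 : (fun n : ℤ => (if Even (n - 1) then 0 else 1 : K)) =
      fun n => if Even n then 1 else 0 := by
    funext n; by_cases h : Even n <;> simp [h, Int.even_sub_one]
  have E4 : ∀ a : List ι → K, weight deg (fun n => - ksign K n) a =
      - weight deg (ksign K) a := by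
    intro a; funext w; simp [weight]
  have E5 : ∀ a : List ι → K, weight deg (ksign K) (weight deg (ksign K) a) = a := by
    intro a; funext w; simp only [weight]; rw [← mul_assoc, ksign_mul_self, one_mul]
  have E6 : ∀ a : List ι → K,
      weight deg (fun n => if Even n then 1 else 0) (weight deg (ksign K) a) =
      weight deg (fun n => if Even n then 1 else 0) a := by
    intro a; funext w; simp only [weight]
    by_cases h : Even (wordDeg deg w) <;> simp [h, ksign_even]
  have E7 : ∀ a : List ι → K,
      weight deg (fun n => if Even n then 0 else 1) (weight deg (ksign K) a) =
      - weight deg (fun n => if Even n then 0 else 1) a := by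
    intro a; funext w; simp only [weight, Pi.neg_apply]
    by_cases h : Even (wordDeg deg w)
    · simp [h]
    · simp [h, ksign_odd (Int.not_even_iff_odd.1 h)]
  have N : ∀ a b : List ι → K, seriesMul a (-b) = -seriesMul a b := by
    intro a b; simpa using seriesMul_smul_right (-1) a b
  simp only [bracket_eq, map_sub, map_add, D, W, E1, E2, E3, E4, E5, E6, E7, N,
    seriesMul_neg_left]
  abel

theorem weight_bracket (deg : ι → ℕ) (f g : List ι → K) :
    weight deg (ksign K) (bracket deg f g) =
      bracket deg (weight deg (ksign K) f) (weight deg (ksign K) g) := by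
  funext w
  simp only [weight, bracket, Finset.mul_sum]
  refine Finset.sum_congr rfl fun k _ => ?_
  have : ksign K (wordDeg deg w) =
      ksign K (wordDeg deg (w.take k)) * ksign K (wordDeg deg (w.drop k)) := by
    rw [← ksign_add, ← wordDeg_append, List.take_append_drop]
  rw [this]; ring

/-- Bracketing with a fixed series, as a linear map. -/
def bracketLeft (deg : ι → ℕ) (g : List ι → K) : (List ι → K) →ₗ[K] (List ι → K) where
  toFun f := bracket deg f g
  map_add' f f' := funext fun w => by
    simp only [bracket, Pi.add_apply, ← Finset.sum_add_distrib]
    exact Finset.sum_congr rfl fun k _ => by ring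
  map_smul' a f := funext fun w => by
    simp only [bracket, Pi.smul_apply, smul_eq_mul, Finset.mul_sum, RingHom.id_apply]
    exact Finset.sum_congr rfl fun k _ => by ring

/-- Bracketing with a fixed series, as a linear map. -/
def bracketRight (deg : ι → ℕ) (f : List ι → K) : (List ι → K) →ₗ[K] (List ι → K) where
  toFun g := bracket deg f g
  map_add' g g' := funext fun w => by
    simp only [bracket, Pi.add_apply, ← Finset.sum_add_distrib]
    exact Finset.sum_congr rfl fun k _ => by ring
  map_smul' a g := funext fun w => by
    simp only [bracket, Pi.smul_apply, smul_eq_mul, Finset.mul_sum, RingHom.id_apply]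
    exact Finset.sum_congr rfl fun k _ => by ring

theorem isFormal_of_parts {Y : Type*} {T : (List ι → K) →ₗ[K] (Y → K)} (p : Y → Finset (List ι))
    (h : ∀ y f, (∀ x ∈ p y, f x = 0) → T f y = 0) : IsFormal T := fun y => ⟨p y, h y⟩

theorem isFormal_bracketLeft (deg : ι → ℕ) (g : List ι → K) : IsFormal (bracketLeft deg g) := by
  classical
  refine isFormal_of_parts (fun w => (Finset.range (w.length + 1)).image (fun k => w.take k) ∪
    (Finset.range (w.length + 1)).image (fun k => w.drop k)) fun w f hf => ?_
  change ∑ k ∈ Finset.range (w.length + 1), _ = (0 : K)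
  refine Finset.sum_eq_zero fun k hk => ?_
  rw [hf _ (Finset.mem_union_left _ (Finset.mem_image_of_mem _ hk)),
    hf _ (Finset.mem_union_right _ (Finset.mem_image_of_mem _ hk))]
  simp

theorem isFormal_bracketRight (deg : ι → ℕ) (g : List ι → K) : IsFormal (bracketRight deg g) := by
  classical
  refine isFormal_of_parts (fun w => (Finset.range (w.length + 1)).image (fun k => w.take k) ∪
    (Finset.range (w.length + 1)).image (fun k => w.drop k)) fun w f hf => ?_
  change ∑ k ∈ Finset.range (w.length + 1), _ = (0 : K)
  refine Finset.sum_eq_zero fun k hk => ?_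
  rw [hf _ (Finset.mem_union_left _ (Finset.mem_image_of_mem _ hk)),
    hf _ (Finset.mem_union_right _ (Finset.mem_image_of_mem _ hk))]
  simp

theorem span_linear {M N : Type*} [AddCommGroup M] [Module K M] [AddCommGroup N] [Module K N]
    (T : M →ₗ[K] N) {s : Set M} {P : Submodule K N} (h : ∀ x ∈ s, T x ∈ P) :
    ∀ x ∈ Submodule.span K s, T x ∈ P := fun _ hx =>
  (Submodule.span_le (p := P.comap T)).2 h hx

theorem formalClosure_idem {X : Type*} (M : Submodule K (X → K)) {f : X → K}
    (hf : f ∈ formalClosure (formalClosure M)) : f ∈ formalClosure M :=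
  map_formalClosure (T := LinearMap.id) (fun y => ⟨{y}, fun _ h => h y (by simp)⟩)
    (fun _ h => h) f hf

theorem monomial_mem {deg : ι → ℕ} {S : Set ι} {f : List ι → K} (h : IsLieMonomial K deg S f) :
    f ∈ freeLie K deg S := le_formalClosure _ (Submodule.subset_span h)

theorem bracket_mem {deg : ι → ℕ} {S : Set ι} {f g : List ι → K} (hf : f ∈ freeLie K deg S)
    (hg : g ∈ freeLie K deg S) : bracket deg f g ∈ freeLie K deg S := by
  refine map_formalClosure (T := bracketLeft deg g) (isFormal_bracketLeft deg g)
    (span_linear _ fun x hx => ?_) f hf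
  refine map_formalClosure (T := bracketRight deg x) (isFormal_bracketRight deg x)
    (span_linear _ fun y hy => ?_) g hg
  exact monomial_mem (.bracket x y hx hy)

theorem weight_mem {deg : ι → ℕ} {S : Set ι} {f : List ι → K} (hf : f ∈ freeLie K deg S) :
    weight deg (ksign K) f ∈ freeLie K deg S := by
  let T : (List ι → K) →ₗ[K] (List ι → K) :=
    { toFun := weight deg (ksign K)
      map_add' := fun f g => funext fun w => by simp [weight, mul_add]
      map_smul' := fun a f => funext fun w => by simp [weight, mul_left_comm] }
  refine map_formalClosure (T := T) (fun y => ⟨{y}, fun f h => ?_⟩)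
    (span_linear _ fun x hx => ?_) f hf
  · change ksign K _ * f y = 0
    rw [h y (by simp), mul_zero]
  · refine monomial_mem (?_ : IsLieMonomial K deg S (weight deg (ksign K) x))
    induction hx with
    | of f hf => exact .of _ fun w hw => hf w fun h => hw (by simp [weight, h])
    | bracket f g _ _ hf hg => rw [weight_bracket]; exact .bracket _ _ hf hg

open Classical in
/-- The series consisting of the single letter `t i`. -/
noncomputable def letter (K : Type*) [CommRing K] (i : ι) : List ι → K := fun w => if w = [i] then 1 else 0

open Classical in
theorem seriesMul_letter (i j : ι) (w : List ι) :
    seriesMul (letter K i) (letter K j) w = if w = [i, j] then 1 else 0 := by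
  rcases w with _ | ⟨a, _ | ⟨b, _ | ⟨c, w⟩⟩⟩
  · simp [seriesMul_nil, letter]
  · simp [seriesMul_cons, seriesMul_nil, letter]
  · simp only [seriesMul_cons, seriesMul_nil, letter]
    by_cases h1 : a = i <;> by_cases h2 : b = j <;> simp [h1, h2]
  · have : seriesMul (fun v => letter K i (a :: b :: c :: v)) (letter K j) w = 0 :=
      Finset.sum_eq_zero fun k _ => by simp [letter]
    rw [seriesMul_cons, seriesMul_cons, seriesMul_cons, this]
    simp [letter]

open Classical in
theorem bracket_letter (deg : ι → ℕ) (i j : ι) (w : List ι) :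
    bracket deg (letter K i) (letter K j) w = (if w = [i, j] then 1 else 0) -
      ksign K ((1 - (deg i : ℤ)) * (1 - deg j)) * if w = [j, i] then 1 else 0 := by
  rw [← seriesMul_letter (K := K) i j, ← seriesMul_letter (K := K) j i]
  simp only [bracket, seriesMul, Finset.mul_sum, ← Finset.sum_sub_distrib]
  refine Finset.sum_congr rfl fun k _ => ?_
  congr 1
  by_cases h1 : w.take k = [j]
  · by_cases h2 : w.drop k = [i]
    · rw [h1, h2]
      simp [letter, wordDeg, mul_comm]
    · simp [letter, h2]
  · simp [letter, h1]

/-- `m` maps `ΣV*` into Lie series: this is graded commutativity. -/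
theorem vectorField_of_mem [Algebra ℚ K] {μ : ι → ι → ι →₀ K} {deg : ι → ℕ}
    (hμ : IsGradedCommStructure μ deg) (f : List ι → K) (hf : ∀ w, f w ≠ 0 → ∃ i, w = [i]) :
    vectorField μ deg f ∈ freeLie K deg Set.univ := by
  classical
  intro s
  let half : K := algebraMap ℚ K (1 / 2)
  have hhalf : half + half = 1 := by
    rw [← map_add]; norm_num
  let J : Finset ι := s.biUnion fun w => w.toFinset
  let co : ι → ι → K := fun i j => ksign K (deg i) * (μ i j).sum fun c r => r * f [c]
  have hco : ∀ i j, co j i = - (ksign K ((1 - (deg i : ℤ)) * (1 - deg j)) * co i j) := by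
    intro i j
    have hs : (μ j i).sum (fun c r => r * f [c]) =
        ksign K ((deg i : ℤ) * deg j) * (μ i j).sum (fun c r => r * f [c]) := by
      have hsub : μ j i = ksign K ((deg i : ℤ) * deg j) • μ i j := by
        ext c; rw [hμ.comm j i c, mul_comm (deg j : ℤ)]; rfl
      rw [hsub, Finsupp.sum_smul_index (by simp), Finsupp.mul_sum]
      simp only [mul_assoc]
    simp only [co, hs]
    have : ksign K ((1 - (deg i : ℤ)) * (1 - deg j)) =
        - (ksign K (deg i) * ksign K (deg j) * ksign K ((deg i : ℤ) * deg j)) := by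
      rw [show (1 - (deg i : ℤ)) * (1 - deg j) = 1 - deg i - deg j + deg i * deg j by ring,
        ksign_add, ksign_sub, ksign_sub, ksign_one]
      ring
    rw [this]
    have h2 := ksign_mul_self (K := K) (deg i)
    linear_combination (-ksign K (deg j) * ksign K ((deg i : ℤ) * deg j) *
      (μ i j).sum fun c r => r * f [c]) * h2
  refine ⟨∑ i ∈ J, ∑ j ∈ J, (half * co i j) • bracket deg (letter K i) (letter K j), ?_, ?_⟩
  · refine Submodule.sum_mem _ fun i _ => Submodule.sum_mem _ fun j _ =>
      Submodule.smul_mem _ _ (Submodule.subset_span (.bracket _ _ (.of _ ?_) (.of _ ?_)))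
    all_goals
      intro w hw
      simp only [letter, ne_eq, ite_eq_right_iff, Classical.not_imp] at hw
      exact ⟨_, Set.mem_univ _, hw.1⟩
  · intro w hw
    simp only [Finset.sum_apply, Pi.smul_apply, smul_eq_mul, bracket_letter]
    have hlong : ∀ (w : List ι) (a b c : ι), f (a :: b :: w) = 0 := by
      intro w a b _
      by_contra h
      obtain ⟨i, hi⟩ := hf _ h
      simp at hi
    rcases w with _ | ⟨a, _ | ⟨b, _ | ⟨c, w⟩⟩⟩
    · simp [vectorField_nil]
    · simp [vectorField, vectorFieldCoeff]
    · have ha : a ∈ J := Finset.mem_biUnion.2 ⟨_, hw, by simp⟩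
      have hb : b ∈ J := Finset.mem_biUnion.2 ⟨_, hw, by simp⟩
      have e : vectorField μ deg f [a, b] = co a b := by
        simp [vectorField, vectorFieldCoeff, co]
      rw [e]
      have key : ∀ i j : ι, half * co i j * ((if [a, b] = [i, j] then 1 else 0) -
          ksign K ((1 - (deg i : ℤ)) * (1 - deg j)) * if [a, b] = [j, i] then 1 else 0) =
          (if a = i then if b = j then half * co i j else 0 else 0) +
          (if b = i then if a = j then half * co j i else 0 else 0) := by
        intro i j
        rw [hco i j]
        by_cases h1 : a = i <;> by_cases h2 : b = j <;> by_cases h3 : a = j <;>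
          by_cases h4 : b = i <;> simp [h1, h2, h3, h4] <;> grind
      simp only [key, Finset.sum_add_distrib]
      simp only [Finset.sum_ite_eq, ha, hb, if_true, Finset.sum_ite_irrel, Finset.sum_const_zero]
      rw [← add_mul, hhalf, one_mul]
    · have z : ∀ u : List ι, vectorField μ deg (fun v => f (a :: b :: v)) u = 0 := by
        intro u
        rw [show (fun v => f (a :: b :: v)) = 0 from funext fun v => hlong v a b a, map_zero]; rfl
      rw [vectorField_cons, vectorField_cons, z]
      simp [headMerge, hlong _ _ _ a]

theorem vectorField_mem [Algebra ℚ K] {μ : ι → ι → ι →₀ K} {deg : ι → ℕ}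
    (hμ : IsGradedCommStructure μ deg) {f : List ι → K} (hf : f ∈ freeLie K deg Set.univ) :
    vectorField μ deg f ∈ freeLie K deg Set.univ := by
  refine map_formalClosure (isFormal_vectorField μ deg) (span_linear _ fun x hx => ?_) f hf
  change vectorField μ deg x ∈ freeLie K deg Set.univ
  induction hx with
  | of f hf =>
    exact vectorField_of_mem hμ f fun w hw => let ⟨i, _, h⟩ := hf w hw; ⟨i, h⟩
  | bracket f g hf hg ihf ihg =>
    rw [vectorField_bracket hμ]
    exact Submodule.add_mem _ (bracket_mem ihf (monomial_mem hg))
      (bracket_mem (weight_mem (monomial_mem hf)) ihg)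

theorem lieOperator_tens (μ : ι → ι → ι →₀ K) (deg : ι → ℕ) (x y : List ι → K) :
    lieOperator μ deg (tens x y) = tens (vectorField μ deg x) y +
      tens (weight deg (ksign K) x) (vectorField μ deg y) := by
  funext p
  have h1 : (fun u => tens x y (u, p.2)) = y p.2 • x := by
    funext u; simp [tens, mul_comm]
  have h2 : (fun v => tens x y (p.1, v)) = x p.1 • y := by
    funext u; simp [tens]
  change vectorField μ deg (fun u => tens x y (u, p.2)) p.1 +
    ksign K (wordDeg deg p.1) * vectorField μ deg (fun v => tens x y (p.1, v)) p.2 = _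
  rw [h1, h2, map_smul, map_smul]
  simp only [Pi.smul_apply, smul_eq_mul, tens, Pi.add_apply, weight]
  ring

theorem isFormal_lieOperator (μ : ι → ι → ι →₀ K) (deg : ι → ℕ) :
    IsFormal (lieOperator μ deg) := by
  classical
  rintro ⟨u, v⟩
  obtain ⟨s, hs⟩ := isFormal_vectorField μ deg u
  obtain ⟨s', hs'⟩ := isFormal_vectorField μ deg v
  refine ⟨s ×ˢ {v} ∪ {u} ×ˢ s', fun F hF => ?_⟩
  change vectorField μ deg (fun a => F (a, v)) u +
    ksign K (wordDeg deg u) * vectorField μ deg (fun b => F (u, b)) v = 0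
  rw [hs _ fun x hx => hF _ (by simp [hx]), hs' _ fun x hx => hF _ (by simp [hx])]
  simp

theorem lieOperator_swapTensor {μ : ι → ι → ι →₀ K} {deg : ι → ℕ}
    (hμ : IsGradedCommStructure μ deg) (F : List ι × List ι → K) :
    lieOperator μ deg (swapTensor deg F) = swapTensor deg (lieOperator μ deg F) := by
  funext ⟨u, v⟩
  change vectorField μ deg (fun a => swapTensor deg F (a, v)) u +
    ksign K (wordDeg deg u) * vectorField μ deg (fun b => swapTensor deg F (u, b)) v =
    ksign K (wordDeg deg u * wordDeg deg v) *
      (vectorField μ deg (fun a => F (a, u)) v +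
        ksign K (wordDeg deg v) * vectorField μ deg (fun b => F (v, b)) u)
  have h1 : (fun a => swapTensor deg F (a, v)) =
      weight deg (fun n => ksign K (n * wordDeg deg v)) (fun a => F (v, a)) := rfl
  have h2 : (fun b => swapTensor deg F (u, b)) =
      weight deg (fun n => ksign K (wordDeg deg u * n)) (fun a => F (a, u)) := rfl
  rw [h1, h2, vectorField_weight hμ, vectorField_weight hμ]
  simp only [sub_mul, mul_sub, ksign_sub, one_mul, mul_one]
  have h3 := ksign_mul_self (K := K) (wordDeg deg u)
  linear_combination (ksign K (wordDeg deg u * wordDeg deg v) *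
    vectorField μ deg (fun a => F (a, u)) v) * h3

theorem tens_mem {deg : ι → ℕ} {S : Set ι} {x y : List ι → K} (hx : x ∈ freeLie K deg S)
    (hy : y ∈ freeLie K deg S) : tens x y ∈ lieTensor K deg S :=
  le_formalClosure _ (Submodule.subset_span ⟨x, hx, y, hy, rfl⟩)

theorem lieOperator_mem [Algebra ℚ K] {μ : ι → ι → ι →₀ K} {deg : ι → ℕ}
    (hμ : IsGradedCommStructure μ deg) :
    ∀ F ∈ lieTensor K deg Set.univ, lieOperator μ deg F ∈ lieTensor K deg Set.univ := by
  refine map_formalClosure (isFormal_lieOperator μ deg) (span_linear _ ?_)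
  rintro _ ⟨x, hx, y, hy, rfl⟩
  rw [lieOperator_tens]
  exact Submodule.add_mem _ (tens_mem (vectorField_mem hμ hx) hy)
    (tens_mem (weight_mem hx) (vectorField_mem hμ hy))

theorem swap_rel_mem {deg : ι → ℕ} {S : Set ι} {x y : List ι → K} (hx : x ∈ freeLie K deg S)
    (hy : y ∈ freeLie K deg S) :
    tens x y - swapTensor deg (tens x y) ∈ lieRelations K deg S :=
  le_formalClosure _ (Submodule.subset_span (Or.inl ⟨x, hx, y, hy, rfl⟩))

theorem bracket_rel_mem {deg : ι → ℕ} {S : Set ι} {x y z : List ι → K}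
    (hx : x ∈ freeLie K deg S) (hy : y ∈ freeLie K deg S) (hz : z ∈ freeLie K deg S) :
    tens (bracket deg x y) z - tens x (bracket deg y z) ∈ lieRelations K deg S :=
  le_formalClosure _ (Submodule.subset_span (Or.inr ⟨x, hx, y, hy, z, hz, rfl⟩))

theorem lieOperator_rel_mem [Algebra ℚ K] {μ : ι → ι → ι →₀ K} {deg : ι → ℕ}
    (hμ : IsGradedCommStructure μ deg) :
    ∀ F ∈ lieRelations K deg Set.univ, lieOperator μ deg F ∈ lieRelations K deg Set.univ := by
  refine map_formalClosure (isFormal_lieOperator μ deg) (span_linear _ ?_)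
  change ∀ F ∈ _, lieOperator μ deg F ∈ lieRelations K deg Set.univ
  have add : ∀ F G : List ι × List ι → K,
      swapTensor deg (F + G) = swapTensor deg F + swapTensor deg G := by
    intro F G; funext p; simp [swapTensor, mul_add]
  rintro _ (⟨x, hx, y, hy, rfl⟩ | ⟨x, hx, y, hy, z, hz, rfl⟩)
  · rw [map_sub, lieOperator_swapTensor hμ, lieOperator_tens, add, add_sub_add_comm]
    exact Submodule.add_mem _ (swap_rel_mem (vectorField_mem hμ hx) hy)
      (swap_rel_mem (weight_mem hx) (vectorField_mem hμ hy))
  · have h1 := bracket_rel_mem (vectorField_mem hμ hx) hy hz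
    have h2 := bracket_rel_mem (weight_mem hx) (vectorField_mem hμ hy) hz
    have h3 := bracket_rel_mem (weight_mem hx) (weight_mem hy) (vectorField_mem hμ hz)
    have e : lieOperator μ deg (tens (bracket deg x y) z - tens x (bracket deg y z)) =
        (tens (bracket deg (vectorField μ deg x) y) z -
          tens (vectorField μ deg x) (bracket deg y z)) +
        (tens (bracket deg (weight deg (ksign K) x) (vectorField μ deg y)) z -
          tens (weight deg (ksign K) x) (bracket deg (vectorField μ deg y) z)) +
        (tens (bracket deg (weight deg (ksign K) x) (weight deg (ksign K) y))
            (vectorField μ deg z) -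
          tens (weight deg (ksign K) x)
            (bracket deg (weight deg (ksign K) y) (vectorField μ deg z))) := by
      rw [map_sub, lieOperator_tens, lieOperator_tens, vectorField_bracket hμ,
        vectorField_bracket hμ, weight_bracket]
      funext p
      simp only [tens, Pi.add_apply, Pi.sub_apply]
      ring
    rw [e]
    exact Submodule.add_mem _ (Submodule.add_mem _ h1 h2) h3

end WellDefined

/-! ### Functoriality in the letters -/

section Pullback

variable {K : Type*} [CommRing K] {ι κ : Type*}

/-- A map of letters `φ : κ → ι` induces, dually, the map of series which keeps the coefficients of
the words in the letters `φ k`. -/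
def pullback (K : Type*) [CommRing K] (φ : κ → ι) : (List ι → K) →ₗ[K] (List κ → K) where
  toFun f w := f (w.map φ)
  map_add' _ _ := rfl
  map_smul' _ _ := rfl

/-- The same on pairs of words, i.e. on the completed tensor squares. -/
def pullbackTensor (K : Type*) [CommRing K] (φ : κ → ι) :
    (List ι × List ι → K) →ₗ[K] (List κ × List κ → K) where
  toFun F p := F (p.1.map φ, p.2.map φ)
  map_add' _ _ := rfl
  map_smul' _ _ := rfl

theorem wordDeg_map {deg : ι → ℕ} {deg' : κ → ℕ} {φ : κ → ι} (h : ∀ k, deg (φ k) = deg' k)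
    (w : List κ) : wordDeg deg (w.map φ) = wordDeg deg' w := by
  induction w with
  | nil => rfl
  | cons i w ih => rw [List.map_cons, wordDeg_cons, wordDeg_cons, ih, h]

theorem pullback_bracket {deg : ι → ℕ} {deg' : κ → ℕ} {φ : κ → ι} (h : ∀ k, deg (φ k) = deg' k)
    (f g : List ι → K) :
    pullback K φ (bracket deg f g) = bracket deg' (pullback K φ f) (pullback K φ g) := by
  funext w
  change bracket deg f g (w.map φ) = _
  simp only [bracket, List.length_map, ← List.map_take, ← List.map_drop, wordDeg_map h]
  rfl

theorem pullback_mem {deg : ι → ℕ} {deg' : κ → ℕ} {φ : κ → ι} (h : ∀ k, deg (φ k) = deg' k)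
    {f : List ι → K} (hf : f ∈ freeLie K deg Set.univ) :
    pullback K φ f ∈ freeLie K deg' Set.univ := by
  refine map_formalClosure (T := pullback K φ) (fun y => ⟨{y.map φ}, fun _ hf => hf _ (by simp)⟩)
    (span_linear _ fun x hx => ?_) f hf
  refine monomial_mem ?_
  induction hx with
  | of f hf =>
    refine .of _ fun w hw => ?_
    obtain ⟨i, -, hi⟩ := hf _ hw
    rcases w with _ | ⟨a, _ | ⟨b, w⟩⟩
    · simp at hi
    · exact ⟨a, Set.mem_univ _, rfl⟩
    · simp at hi
  | bracket f g _ _ hf hg => rw [pullback_bracket h]; exact .bracket _ _ hf hg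

theorem isFormal_pullbackTensor (φ : κ → ι) : IsFormal (pullbackTensor K φ) :=
  fun y => ⟨{(y.1.map φ, y.2.map φ)}, fun _ hF => hF _ (by simp)⟩

theorem pullbackTensor_mem {deg : ι → ℕ} {deg' : κ → ℕ} {φ : κ → ι}
    (h : ∀ k, deg (φ k) = deg' k) :
    ∀ F ∈ lieTensor K deg Set.univ, pullbackTensor K φ F ∈ lieTensor K deg' Set.univ := by
  refine map_formalClosure (isFormal_pullbackTensor φ) (span_linear _ ?_)
  rintro _ ⟨x, hx, y, hy, rfl⟩
  exact tens_mem (pullback_mem h hx) (pullback_mem h hy)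

theorem pullbackTensor_rel_mem {deg : ι → ℕ} {deg' : κ → ℕ} {φ : κ → ι}
    (h : ∀ k, deg (φ k) = deg' k) :
    ∀ F ∈ lieRelations K deg Set.univ,
      pullbackTensor K φ F ∈ lieRelations K deg' Set.univ := by
  refine map_formalClosure (isFormal_pullbackTensor φ) (span_linear _ ?_)
  have e : ∀ F : List ι × List ι → K, pullbackTensor K φ (swapTensor deg F) =
      swapTensor deg' (pullbackTensor K φ F) := by
    intro F; funext p
    change swapTensor deg F (p.1.map φ, p.2.map φ) = _
    simp only [swapTensor, wordDeg_map h]; rfl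
  have t : ∀ x y : List ι → K, pullbackTensor K φ (tens x y) =
      tens (pullback K φ x) (pullback K φ y) := fun _ _ => rfl
  rintro _ (⟨x, hx, y, hy, rfl⟩ | ⟨x, hx, y, hy, z, hz, rfl⟩)
  · rw [map_sub, e, t]
    exact swap_rel_mem (pullback_mem h hx) (pullback_mem h hy)
  · rw [map_sub, t, t, pullback_bracket h, pullback_bracket h]
    exact bracket_rel_mem (pullback_mem h hx) (pullback_mem h hy) (pullback_mem h hz)

theorem pullback_vectorField {μ : ι → ι → ι →₀ K} {μ' : κ → κ → κ →₀ K} {deg : ι → ℕ}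
    {deg' : κ → ℕ} {φ : κ → ι} (h : ∀ k, deg (φ k) = deg' k)
    (hμ : ∀ k l, μ (φ k) (φ l) = (μ' k l).mapDomain φ) (w : List κ) :
    ∀ f : List ι → K, vectorField μ deg f (w.map φ) =
      vectorField μ' deg' (pullback K φ f) w := by
  induction w with
  | nil => intro f; rfl
  | cons i w ih =>
    intro f
    rw [List.map_cons, vectorField_cons, vectorField_cons, ih, h]
    congr 1
    cases w with
    | nil => rfl
    | cons j w =>
      simp only [List.map_cons, headMerge, h, hμ]
      rw [Finsupp.sum_mapDomain_index (by simp) (by intros; ring)]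
      rfl

theorem pullbackTensor_lieOperator {μ : ι → ι → ι →₀ K} {μ' : κ → κ → κ →₀ K} {deg : ι → ℕ}
    {deg' : κ → ℕ} {φ : κ → ι} (h : ∀ k, deg (φ k) = deg' k)
    (hμ : ∀ k l, μ (φ k) (φ l) = (μ' k l).mapDomain φ) (F : List ι × List ι → K) :
    pullbackTensor K φ (lieOperator μ deg F) = lieOperator μ' deg' (pullbackTensor K φ F) := by
  funext p
  change vectorField μ deg _ (p.1.map φ) + ksign K (wordDeg deg (p.1.map φ)) *
    vectorField μ deg _ (p.2.map φ) = _
  rw [pullback_vectorField h hμ, pullback_vectorField h hμ, wordDeg_map h]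
  rfl

end Pullback

/-! ### Cohomology of a bigraded complex inside a module with an endomorphism -/

section Cohomology

variable {K : Type*} [CommRing K] {M M' : Type*} [AddCommGroup M] [Module K M]
  [AddCommGroup M'] [Module K M']

/-- The cohomology at `X` of `Y → X → ⋯` with differential `d`: cocycles in `X` modulo the
coboundaries `d Y` (they are cocycles in `X` whenever `Y → X → ⋯` is a complex). -/
abbrev Cohomology (d : M →ₗ[K] M) (Y X : Submodule K M) : Type _ :=
  ↥(X ⊓ LinearMap.ker d) ⧸ (Y.map d).comap (X ⊓ LinearMap.ker d).subtype

/-- The map on cohomology induced by a map commuting with the differentials. -/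
def Cohomology.map {d : M →ₗ[K] M} {d' : M' →ₗ[K] M'} {Y X : Submodule K M}
    {Y' X' : Submodule K M'} (φ : M →ₗ[K] M') (hd : ∀ x, φ (d x) = d' (φ x))
    (hY : ∀ x ∈ Y, φ x ∈ Y') (hX : ∀ x ∈ X, φ x ∈ X') :
    Cohomology d Y X →ₗ[K] Cohomology d' Y' X' :=
  Submodule.mapQ _ _
    (φ.restrict (p := X ⊓ LinearMap.ker d) (q := X' ⊓ LinearMap.ker d') fun x hx =>
      ⟨hX x hx.1, by
        have h : d x = 0 := hx.2
        change d' (φ x) = 0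
        rw [← hd, h, map_zero]⟩)
    (by
      rintro x ⟨y, hy, hyx⟩
      exact ⟨φ y, hY y hy, by rw [← hd, hyx]; rfl⟩)

end Cohomology

/-! ### Graded commutative algebras and cyclic Harrison cohomology -/

section Algebra

variable {K A ι : Type*} [CommRing K] [Ring A] [Algebra K A]

/-- Graded commutativity: `a b = (-1) ^ (|a| |b|) b a`. -/
class IsGradedCommutative (𝒜 : ℕ → Submodule K A) : Prop where
  mul_comm' : ∀ {i j : ℕ} {a b : A}, a ∈ 𝒜 i → b ∈ 𝒜 j → a * b = (-1) ^ (i * j) * (b * a)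

/-- A homogeneous basis of a free graded algebra, extending the unit. -/
structure UnitalBasis (𝒜 : ℕ → Submodule K A) (ι : Type*) where
  /-- the basis -/
  basis : Module.Basis ι K A
  /-- the degrees of the basis elements -/
  deg : ι → ℕ
  basis_mem : ∀ i, basis i ∈ 𝒜 (deg i)
  /-- the index of the unit -/
  unit : ι
  basis_unit : basis unit = 1
  deg_unit : deg unit = 0

variable {𝒜 : ℕ → Submodule K A}

/-- The structure constants of the multiplication. -/
noncomputable def UnitalBasis.structConst (β : UnitalBasis 𝒜 ι) (i j : ι) : ι →₀ K :=
  β.basis.repr (β.basis i * β.basis j)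

theorem UnitalBasis.deg_eq_of_mem [GradedAlgebra 𝒜] (β : UnitalBasis 𝒜 ι) {n : ℕ} {x : A}
    (hx : x ∈ 𝒜 n) {c : ι} (hc : β.basis.repr x c ≠ 0) : β.deg c = n := by
  classical
  by_contra hne
  have h1 : GradedAlgebra.proj 𝒜 n x = x := by
    rw [GradedAlgebra.proj_apply, DirectSum.decompose_of_mem_same _ hx]
  let L : A →ₗ[K] K := β.basis.coord c ∘ₗ GradedAlgebra.proj 𝒜 n
  let R : A →ₗ[K] K := 0
  have key : ∀ b, L (β.basis b) = if β.deg b = n then β.basis.coord c (β.basis b) else 0 := by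
    intro b
    change β.basis.coord c (GradedAlgebra.proj 𝒜 n (β.basis b)) = _
    rw [GradedAlgebra.proj_apply]
    split_ifs with h
    · rw [DirectSum.decompose_of_mem_same _ (h ▸ β.basis_mem b)]
    · rw [DirectSum.decompose_of_mem_ne _ (β.basis_mem b) h, map_zero]
  have hL : L = R := β.basis.ext fun b => by
    rw [key]
    split_ifs with h
    · have : b ≠ c := fun e => hne (e ▸ h)
      simp [R, this]
    · simp [R]
  have h2 := LinearMap.congr_fun hL x
  change β.basis.repr (GradedAlgebra.proj 𝒜 n x) c = 0 at h2
  rw [h1] at h2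
  exact hc h2

theorem UnitalBasis.isGradedCommStructure [GradedAlgebra 𝒜] [IsGradedCommutative 𝒜]
    (β : UnitalBasis 𝒜 ι) : IsGradedCommStructure β.structConst β.deg where
  deg_eq i j _ hc :=
    β.deg_eq_of_mem (SetLike.mul_mem_graded (β.basis_mem i) (β.basis_mem j)) hc
  comm i j c := by
    have h := IsGradedCommutative.mul_comm' (β.basis_mem i) (β.basis_mem j)
    have e : ((-1 : A)) ^ (β.deg i * β.deg j) * (β.basis j * β.basis i) =
        (ksign K ((β.deg i : ℤ) * β.deg j)) • (β.basis j * β.basis i) := by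
      rcases Nat.even_or_odd (β.deg i * β.deg j) with h2 | h2
      · rw [h2.neg_one_pow, ksign_even (by exact_mod_cast h2), one_mul, one_smul]
      · rw [h2.neg_one_pow, ksign_odd (by exact_mod_cast h2), neg_one_mul, neg_one_smul]
    rw [UnitalBasis.structConst, h, e, map_smul]
    rfl

/-- The `0`-forms `DR⁰_Lie` of the pro-free Lie algebra on `ΣV*`; their suspension is the
underlying module of the cyclic Harrison complex of `V`. -/
abbrev UnitalBasis.Forms (β : UnitalBasis 𝒜 ι) : Type _ := ZeroForms K β.deg Set.univ

/-- The differential of the cyclic Harrison complex, induced by the Lie operator `L_m`. -/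
noncomputable def UnitalBasis.d [Algebra ℚ K] [GradedAlgebra 𝒜] [IsGradedCommutative 𝒜]
    (β : UnitalBasis 𝒜 ι) : β.Forms →ₗ[K] β.Forms :=
  Submodule.mapQ _ _
    ((lieOperator β.structConst β.deg).restrict (lieOperator_mem β.isGradedCommStructure))
    (fun _ hF => lieOperator_rel_mem β.isGradedCommStructure _ hF)

/-- The component of bidegree `(i, j)` of the cyclic Harrison complex. -/
def UnitalBasis.cyclicHarr (β : UnitalBasis 𝒜 ι) (i j : ℤ) : Submodule K β.Forms :=
  zeroFormsBideg K β.deg Set.univ i j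

/-- The component of bidegree `(i, j)` of the subcomplex of normalised Lie `0`-forms: the `0`-forms
of the pro-free Lie algebra on `Σ(V/K)*`, which has the topological basis of the letters other than
the one dual to the unit, inside those of the pro-free Lie algebra on `ΣV*`. -/
def UnitalBasis.normCyclicHarr (β : UnitalBasis 𝒜 ι) (i j : ℤ) : Submodule K β.Forms :=
  (zeroFormsBideg K β.deg {a | a ≠ β.unit} i j).map (zeroFormsIncl K β.deg {a | a ≠ β.unit})

theorem UnitalBasis.normCyclicHarr_le (β : UnitalBasis 𝒜 ι) (i j : ℤ) :
    β.normCyclicHarr i j ≤ β.cyclicHarr i j := by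
  unfold UnitalBasis.normCyclicHarr UnitalBasis.cyclicHarr
  exact zeroFormsIncl_bideg_le _ _ i j

/-- The cyclic Harrison cohomology in bidegree `(i, j)`; the differential has bidegree `(1, 1)`. -/
abbrev UnitalBasis.HCHarr [Algebra ℚ K] [GradedAlgebra 𝒜] [IsGradedCommutative 𝒜]
    (β : UnitalBasis 𝒜 ι) (i j : ℤ) : Type _ :=
  Cohomology β.d (β.cyclicHarr (i - 1) (j - 1)) (β.cyclicHarr i j)

/-- The normalised cyclic Harrison cohomology in bidegree `(i, j)`. -/
abbrev UnitalBasis.HCHarrNorm [Algebra ℚ K] [GradedAlgebra 𝒜] [IsGradedCommutative 𝒜]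
    (β : UnitalBasis 𝒜 ι) (i j : ℤ) : Type _ :=
  Cohomology β.d (β.normCyclicHarr (i - 1) (j - 1)) (β.normCyclicHarr i j)

/-- The map from normalised to unnormalised cyclic Harrison cohomology induced by inclusion. -/
noncomputable def UnitalBasis.normInclusion [Algebra ℚ K] [GradedAlgebra 𝒜] [IsGradedCommutative 𝒜]
    (β : UnitalBasis 𝒜 ι) (i j : ℤ) : β.HCHarrNorm i j →ₗ[K] β.HCHarr i j :=
  Cohomology.map LinearMap.id (fun _ => rfl) (fun _ h => β.normCyclicHarr_le _ _ h)
    (fun _ h => β.normCyclicHarr_le _ _ h)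

end Algebra

/-! ### The ground ring, as a graded algebra concentrated in degree zero -/

section Ground

variable (K : Type*) [CommRing K]

/-- The grading of `K` concentrated in degree zero. -/
def groundGrading : ℕ → Submodule K K := fun n => if n = 0 then ⊤ else ⊥

instance groundGradedAlgebra : GradedAlgebra (groundGrading K) where
  one_mem := by simp [groundGrading]
  mul_mem := by
    intro i j a b ha hb
    by_cases hi : i = 0
    · by_cases hj : j = 0
      · simp [groundGrading, hi, hj]
      · have : b = 0 := by simpa [groundGrading, hj] using hb
        simp [this]
    · have : a = 0 := by simpa [groundGrading, hi] using ha
      simp [this]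
  toDecomposition := DirectSum.Decomposition.ofAddHom _
    ((DirectSum.of (fun n => groundGrading K n) 0).comp
      (AddMonoidHom.mk' (fun x : K => (⟨x, by simp [groundGrading]⟩ : groundGrading K 0))
        (fun _ _ => rfl)))
    (by ext; simp)
    (by
      ext i x : 2
      by_cases hi : i = 0
      · subst hi; simp
      · have : x = 0 := by
          ext; simpa [groundGrading, hi] using x.2
        subst this
        simp only [map_zero])

instance groundIsGradedCommutative : IsGradedCommutative (groundGrading K) where
  mul_comm' := by
    intro i j a b ha hb
    by_cases hi : i = 0
    · simp [hi, mul_comm]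
    · have : a = 0 := by simpa [groundGrading, hi] using ha
      simp [this]

/-- The basis of `K` consisting of the unit. -/
noncomputable def groundBasis : UnitalBasis (groundGrading K) Unit where
  basis := Module.Basis.singleton Unit K
  deg _ := 0
  basis_mem _ := by simp [groundGrading]
  unit := ()
  basis_unit := by simp
  deg_unit := rfl

variable {K} {A ι : Type*} [Ring A] [Algebra K A] {𝒜 : ℕ → Submodule K A}

/-- The map of Lie `0`-forms dual to the inclusion `K → V` of the unit. -/
noncomputable def UnitalBasis.formsToGround (β : UnitalBasis 𝒜 ι) :
    β.Forms →ₗ[K] (groundBasis K).Forms :=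
  Submodule.mapQ _ _
    ((pullbackTensor K fun _ : Unit => β.unit).restrict
      (pullbackTensor_mem (deg' := (groundBasis K).deg) fun _ => β.deg_unit))
    (fun _ hF => pullbackTensor_rel_mem (deg' := (groundBasis K).deg)
      (fun _ => β.deg_unit) _ hF)

theorem UnitalBasis.formsToGround_d [Algebra ℚ K] [GradedAlgebra 𝒜] [IsGradedCommutative 𝒜]
    (β : UnitalBasis 𝒜 ι) (x : β.Forms) :
    β.formsToGround (β.d x) = (groundBasis K).d (β.formsToGround x) := by
  obtain ⟨F, rfl⟩ := Submodule.mkQ_surjective _ x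
  have h := pullbackTensor_lieOperator (μ := β.structConst) (μ' := (groundBasis K).structConst)
    (deg := β.deg) (deg' := (groundBasis K).deg) (φ := fun _ : Unit => β.unit)
    (fun _ => β.deg_unit) (fun k l => by
      have h1 : β.structConst β.unit β.unit = Finsupp.single β.unit 1 := by
        rw [UnitalBasis.structConst, β.basis_unit, one_mul, ← β.basis_unit,
          Module.Basis.repr_self]
      have h2 : (groundBasis K).structConst k l = Finsupp.single () 1 := by
        change (groundBasis K).structConst (groundBasis K).unit (groundBasis K).unit = _
        rw [UnitalBasis.structConst, (groundBasis K).basis_unit, one_mul,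
          show (groundBasis K).basis.repr (1 : K) = (groundBasis K).basis.repr
            ((groundBasis K).basis (groundBasis K).unit) by rw [(groundBasis K).basis_unit],
          Module.Basis.repr_self]
      rw [h1, h2, Finsupp.mapDomain_single]) F.1
  exact congrArg (Submodule.Quotient.mk) (Subtype.ext h)

theorem UnitalBasis.formsToGround_mem (β : UnitalBasis 𝒜 ι) (i j : ℤ) :
    ∀ x ∈ β.cyclicHarr i j, β.formsToGround x ∈ (groundBasis K).cyclicHarr i j := by
  rintro _ ⟨F, hF, rfl⟩
  refine ⟨⟨pullbackTensor K (fun _ : Unit => β.unit) F.1, pullbackTensor_mem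
    (deg' := (groundBasis K).deg) (fun _ => β.deg_unit) _ F.2⟩, ?_, rfl⟩
  intro p hp
  have := hF _ hp
  simp only [List.length_map] at this
  rwa [wordDeg_map (deg' := (groundBasis K).deg) (fun _ => β.deg_unit),
    wordDeg_map (deg' := (groundBasis K).deg) (fun _ => β.deg_unit)] at this

/-- The map from the cyclic Harrison cohomology of `V` to that of the ground ring dual to the
inclusion `K → V` of the unit. -/
noncomputable def UnitalBasis.toGround [Algebra ℚ K] [GradedAlgebra 𝒜] [IsGradedCommutative 𝒜]
    (β : UnitalBasis 𝒜 ι) (i j : ℤ) : β.HCHarr i j →ₗ[K] (groundBasis K).HCHarr i j :=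
  Cohomology.map β.formsToGround β.formsToGround_d (β.formsToGround_mem _ _)
    (β.formsToGround_mem _ _)

end Ground

end CyclicHarrison

/-!
Write `u` for the index of the unit, `t u` for the dual letter, which has degree one, and `R` for
the relations `lieRelations`. A Lie `0`-form containing `t u` is removed by a coboundary, as follows.

*Leading part.* Unitality of the multiplication gives `m = [t u, ·] + m₀ + m₁`
(`vectorField_eq_split`), where `m₀` sends `t u` to `- t u * t u` and all other letters to zero, and
`m₁` comes from the products of basis elements different from the unit. The inner derivation
`[t u, ·]` acts trivially on Lie `0`-forms (`lieOperator_sub_mem`). The field `m₀` preserves the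
number `q` of letters different from `t u`, while `m₁` increases it. Thus it suffices to prove that
`m₀` is exact on the forms of given `q` containing `t u`, and to argue by induction on `q`
(`exists_normalised`); the order is fixed, so the induction ends.

*Cyclic words.* The cyclic form of `x ⊗ y` is the sum of the rotations of the word `x y`. It
vanishes on `R`, and rotating a marked letter to the front inverts it up to a factor: for letters
`a` of weight `c a`, and `F` of total weight `q` with cyclic form `∑ a g_a`, one has
`∑ c a • a ⊗ g_a = q • F` modulo `R` (`markFirst_cyclicForm_of_weight`). Similarly the weighted
Dynkin operator `P` maps every series to a Lie series and multiplies a Lie series by its weight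
(`dynkin_of_mem`). Give `t u` weight zero and all other letters weight one. Then both
constructions commute with `m₀`, and `∑ c a • a ⊗ P g_a = q (q - 1) • F` modulo `R`. For `q ≥ 2`
this makes the complex of Lie `0`-forms a retract of one of tensor words, where `m₀` contracts by
`blockHomotopy` (`exists_primitive_of_two_le`). The cases `q = 1` and `q = 0` are direct, because a
Lie series in the single odd letter `t u` has order at most two: the only form that survives is
`t u ⊗ [t u, t u]`, of bidegree `(3, 2)`.

*The exceptional class.* That form extends to a cocycle for every `V`: if `ε` is the coordinate of
the unit, then `∑ ± ε (x a * x b * x c) • t a ⊗ t b * t c` is a Lie `0`-form (`unitForm`), and its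
differential has as cyclic form the alternating sum of the rotations of the cyclically symmetric
`ε (x a * x b * x c * x d)`, which is zero. The coefficient of `t u * t u * t u` in its cyclic form is
`3`. Hence the restriction to the ground ring is surjective in bidegree `(3, 2)`, and subtracting a
multiple of this cocycle gives injectivity of the comparison in bidegree `(4, 3)`.
-/

namespace CyclicHarrison

/-! ### Continuous linear maps and sums over factorisations of a word -/

section Formal

variable {K : Type*} [CommRing K] {X Y Z : Type*}

/-- A `K`-valued function of formal combinations which vanishes as soon as finitely many
coefficients of its argument vanish. -/
def FormalAt (φ : (X → K) → K) : Prop :=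
  ∃ s : Finset X, ∀ f, (∀ x ∈ s, f x = 0) → φ f = 0

theorem FormalAt.eval (x : X) : FormalAt (fun f : X → K => f x) := ⟨{x}, fun _ h => h x (by simp)⟩

theorem FormalAt.zero : FormalAt (fun _ : X → K => 0) := ⟨∅, fun _ _ => rfl⟩

theorem FormalAt.add {φ ψ : (X → K) → K} (hφ : FormalAt φ) (hψ : FormalAt ψ) :
    FormalAt (fun f => φ f + ψ f) := by
  classical
  obtain ⟨s, hs⟩ := hφ
  obtain ⟨t, ht⟩ := hψ
  refine ⟨s ∪ t, fun f hf => ?_⟩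
  simp only [hs f fun x hx => hf x (Finset.mem_union_left _ hx),
    ht f fun x hx => hf x (Finset.mem_union_right _ hx), add_zero]

theorem FormalAt.mul_left (a : K) {φ : (X → K) → K} (hφ : FormalAt φ) :
    FormalAt (fun f => a * φ f) := by
  obtain ⟨s, hs⟩ := hφ
  exact ⟨s, fun f hf => by simp only [hs f hf, mul_zero]⟩

theorem FormalAt.mul_right (a : K) {φ : (X → K) → K} (hφ : FormalAt φ) :
    FormalAt (fun f => φ f * a) := by
  obtain ⟨s, hs⟩ := hφ
  exact ⟨s, fun f hf => by simp only [hs f hf, zero_mul]⟩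

theorem FormalAt.sum {J : Type*} (t : Finset J) {φ : J → (X → K) → K}
    (h : ∀ j ∈ t, FormalAt (φ j)) : FormalAt (fun f => ∑ j ∈ t, φ j f) := by
  classical
  induction t using Finset.induction_on with
  | empty => simpa using FormalAt.zero
  | insert a t ha ih =>
    simp only [Finset.sum_insert ha]
    exact (h a (Finset.mem_insert_self _ _)).add
      (ih fun j hj => h j (Finset.mem_insert_of_mem hj))

theorem IsFormal.comp {U : (Y → K) →ₗ[K] (Z → K)} {T : (X → K) →ₗ[K] (Y → K)}
    (hU : IsFormal U) (hT : IsFormal T) : IsFormal (U ∘ₗ T) := by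
  classical
  intro z
  obtain ⟨s, hs⟩ := hU z
  choose a ha using hT
  exact ⟨s.biUnion a, fun f hf => hs _ fun y hy =>
    ha y f fun x hx => hf x (Finset.mem_biUnion.2 ⟨y, hy, hx⟩)⟩

theorem IsFormal.add {T T' : (X → K) →ₗ[K] (Y → K)} (h : IsFormal T) (h' : IsFormal T') :
    IsFormal (T + T') := fun y => FormalAt.add (h y) (h' y)

theorem IsFormal.smul (a : K) {T : (X → K) →ₗ[K] (Y → K)} (h : IsFormal T) :
    IsFormal (a • T) := fun y => FormalAt.mul_left a (h y)

theorem IsFormal.sub {T T' : (X → K) →ₗ[K] (Y → K)} (h : IsFormal T) (h' : IsFormal T') :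
    IsFormal (T - T') := by
  have : T - T' = T + (-1 : K) • T' := by ext; simp [sub_eq_add_neg]
  rw [this]
  exact h.add (h'.smul _)

/-- Continuous linear maps are determined by their values on the topological basis. -/
theorem IsFormal.ext [DecidableEq X] {T T' : (X → K) →ₗ[K] (Y → K)} (hT : IsFormal T)
    (hT' : IsFormal T') (h : ∀ x, T (Pi.single x 1) = T' (Pi.single x 1)) : T = T' := by
  ext f y
  obtain ⟨s, hs⟩ := (hT.sub hT') y
  have hz : ∀ x, (T - T') (Pi.single x 1) = 0 := fun x => by simp [h x]
  have key := hs (f - ∑ x ∈ s, f x • Pi.single x 1) fun x hx => by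
    simp only [Pi.sub_apply, Finset.sum_apply, Pi.smul_apply, smul_eq_mul, Pi.single_apply]
    simp [hx]
  rw [map_sub, map_sum] at key
  simp only [map_smul, hz, smul_zero, Finset.sum_const_zero, sub_zero] at key
  exact sub_eq_zero.1 key

theorem eq_zero_of_mem_formalClosure_bot {f : X → K}
    (h : f ∈ formalClosure (⊥ : Submodule K (X → K))) : f = 0 := by
  funext x
  obtain ⟨g, hg, hgf⟩ := h {x}
  rw [← hgf x (by simp), (Submodule.mem_bot K).1 hg]

end Formal

section Split

variable {K : Type*} [CommRing K] {ι : Type*}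

/-- The sum of `G u v` over all factorisations `w = u v`. -/
def splitSum (w : List ι) (G : List ι → List ι → K) : K :=
  ∑ k ∈ Finset.range (w.length + 1), G (w.take k) (w.drop k)

theorem splitSum_nil (G : List ι → List ι → K) : splitSum [] G = G [] [] := by simp [splitSum]

theorem splitSum_cons (i : ι) (w : List ι) (G : List ι → List ι → K) :
    splitSum (i :: w) G = G [] (i :: w) + splitSum w (fun u v => G (i :: u) v) := by
  rw [splitSum, List.length_cons, Finset.sum_range_succ']
  simp [splitSum, add_comm]

theorem splitSum_congr {w : List ι} {G G' : List ι → List ι → K}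
    (h : ∀ u v, u ++ v = w → G u v = G' u v) : splitSum w G = splitSum w G' :=
  Finset.sum_congr rfl fun _ _ => h _ _ (List.take_append_drop _ _)

theorem splitSum_eq_zero {w : List ι} {G : List ι → List ι → K}
    (h : ∀ u v, u ++ v = w → G u v = 0) : splitSum w G = 0 :=
  Finset.sum_eq_zero fun _ _ => h _ _ (List.take_append_drop _ _)

theorem splitSum_add (w : List ι) (G G' : List ι → List ι → K) :
    splitSum w (fun u v => G u v + G' u v) = splitSum w G + splitSum w G' :=
  Finset.sum_add_distrib

theorem mul_splitSum (a : K) (w : List ι) (G : List ι → List ι → K) :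
    a * splitSum w G = splitSum w (fun u v => a * G u v) := Finset.mul_sum _ _ _

theorem splitSum_mul (a : K) (w : List ι) (G : List ι → List ι → K) :
    splitSum w G * a = splitSum w (fun u v => G u v * a) := Finset.sum_mul _ _ _

/-- A factorisation into three words may be made from the left or from the right. -/
theorem splitSum_assoc (w : List ι) : ∀ G : List ι → List ι → List ι → K,
    splitSum w (fun u t => splitSum t (fun v s => G u v s)) =
      splitSum w (fun t s => splitSum t (fun u v => G u v s)) := by
  induction w with
  | nil => intro G; simp [splitSum_nil]
  | cons i w ih =>
    intro G
    rw [splitSum_cons, ih, splitSum_cons, splitSum_cons, splitSum_nil, add_assoc, ← splitSum_add]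
    congr 2
    funext u v
    rw [splitSum_cons]

theorem splitSum_left_nil {w : List ι} {G : List ι → List ι → K}
    (h : ∀ i u v, G (i :: u) v = 0) : splitSum w G = G [] w := by
  cases w with
  | nil => exact splitSum_nil G
  | cons i w => rw [splitSum_cons, splitSum_eq_zero fun u v _ => h i u v, add_zero]

theorem splitSum_right_nil {w : List ι} : ∀ {G : List ι → List ι → K}
    (_ : ∀ i u v, G u (i :: v) = 0), splitSum w G = G w [] := by
  induction w with
  | nil => intro G _; exact splitSum_nil G
  | cons i w ih => intro G h; rw [splitSum_cons, h, zero_add, ih fun j u v => h j _ v]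

theorem FormalAt.splitSum {X : Type*} (w : List ι) {G : (X → K) → List ι → List ι → K}
    (h : ∀ u v, u ++ v = w → FormalAt (fun f => G f u v)) :
    FormalAt (fun f => splitSum w (G f)) :=
  FormalAt.sum _ fun _ _ => h _ _ (List.take_append_drop _ _)

theorem seriesMul_eq_splitSum (f g : List ι → K) (w : List ι) :
    seriesMul f g w = splitSum w (fun u v => f u * g v) := rfl

theorem bracket_eq_splitSum (deg : ι → ℕ) (f g : List ι → K) (w : List ι) :
    bracket deg f g w = splitSum w (fun u v => f u * g v -
      ksign K (wordDeg deg u * wordDeg deg v) * (g u * f v)) := rfl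

theorem seriesMul_assoc (f g h : List ι → K) :
    seriesMul (seriesMul f g) h = seriesMul f (seriesMul g h) := by
  funext w
  simp only [seriesMul_eq_splitSum, splitSum_mul, mul_splitSum]
  rw [splitSum_assoc w fun u v s => f u * (g v * h s)]
  simp only [mul_assoc]

theorem seriesMul_neg_right (f g : List ι → K) : seriesMul f (-g) = -seriesMul f g := by
  simpa using seriesMul_smul_right (-1) f g

theorem seriesMul_sub_left (f f' g : List ι → K) :
    seriesMul (f - f') g = seriesMul f g - seriesMul f' g := by
  rw [sub_eq_add_neg, seriesMul_add_left, seriesMul_neg_left, sub_eq_add_neg]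

theorem seriesMul_sub_right (f g g' : List ι → K) :
    seriesMul f (g - g') = seriesMul f g - seriesMul f g' := by
  rw [sub_eq_add_neg, seriesMul_add_right, seriesMul_neg_right, sub_eq_add_neg]

/-- Left shift of a product past a word. -/
theorem seriesMul_append (f g : List ι → K) (u v : List ι) (a : ι) :
    seriesMul f g (u ++ a :: v) = seriesMul (fun v => f (u ++ a :: v)) g v +
      splitSum u (fun u₁ u₂ => f u₁ * g (u₂ ++ a :: v)) := by
  induction u generalizing f with
  | nil => rw [List.nil_append, seriesMul_cons, splitSum_nil, add_comm]; rfl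
  | cons i u ih =>
    rw [List.cons_append, seriesMul_cons, ih, splitSum_cons]
    simp only [List.cons_append]
    ring

/-- Multiplication by a fixed series, as a linear map. -/
def mulLeft (f : List ι → K) : (List ι → K) →ₗ[K] (List ι → K) where
  toFun g := seriesMul f g
  map_add' := seriesMul_add_right f
  map_smul' a g := seriesMul_smul_right a f g

theorem isFormal_mulLeft (f : List ι → K) : IsFormal (mulLeft f) := fun w =>
  FormalAt.splitSum (G := fun g u v => f u * g v) w fun _ v _ => (FormalAt.eval v).mul_left _

end Split

/-! ### Homogeneous series -/

section Homogeneous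

variable {K : Type*} [CommRing K] {ι : Type*} {deg : ι → ℕ}

/-- The series is a combination of words of degree `p`. -/
def HasDeg (deg : ι → ℕ) (p : ℤ) (f : List ι → K) : Prop := ∀ w, f w ≠ 0 → wordDeg deg w = p

theorem seriesMul_support {f g : List ι → K} {w : List ι} (h : seriesMul f g w ≠ 0) :
    ∃ u v, u ++ v = w ∧ f u ≠ 0 ∧ g v ≠ 0 := by
  by_contra hc
  push Not at hc
  refine h ((seriesMul_eq_splitSum f g w).trans (splitSum_eq_zero fun u v e => ?_))
  by_cases hu : f u = 0
  · rw [hu, zero_mul]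
  · rw [hc u v e hu, mul_zero]

theorem hasDeg_seriesMul {p q : ℤ} {f g : List ι → K} (hf : HasDeg deg p f) (hg : HasDeg deg q g) :
    HasDeg deg (p + q) (seriesMul f g) := by
  intro w hw
  obtain ⟨u, v, rfl, hu, hv⟩ := seriesMul_support hw
  rw [wordDeg_append, hf u hu, hg v hv]

theorem hasDeg_smul {p : ℤ} {f : List ι → K} (hf : HasDeg deg p f) (a : K) :
    HasDeg deg p (a • f) := fun w hw => hf w fun h => hw (by simp [h])

theorem hasDeg_sub {p : ℤ} {f g : List ι → K} (hf : HasDeg deg p f) (hg : HasDeg deg p g) :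
    HasDeg deg p (f - g) := by
  intro w hw
  by_cases h : f w = 0
  · exact hg w fun h' => hw (by simp [h, h'])
  · exact hf w h

theorem bracket_of_hasDeg {p q : ℤ} {f g : List ι → K} (hf : HasDeg deg p f)
    (hg : HasDeg deg q g) :
    bracket deg f g = seriesMul f g - ksign K (p * q) • seriesMul g f := by
  funext w
  simp only [Pi.sub_apply, Pi.smul_apply, smul_eq_mul]
  rw [bracket_eq_splitSum, seriesMul_eq_splitSum, seriesMul_eq_splitSum, mul_splitSum,
    sub_eq_add_neg, ← neg_one_mul, mul_splitSum, ← splitSum_add]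
  refine splitSum_congr fun u v _ => ?_
  by_cases hu : g u = 0
  · simp [hu]
  by_cases hv : f v = 0
  · simp [hv]
  rw [hg u hu, hf v hv, mul_comm q p]
  ring

theorem hasDeg_bracket {p q : ℤ} {f g : List ι → K} (hf : HasDeg deg p f) (hg : HasDeg deg q g) :
    HasDeg deg (p + q) (bracket deg f g) := by
  rw [bracket_of_hasDeg hf hg]
  exact hasDeg_sub (hasDeg_seriesMul hf hg)
    (hasDeg_smul (by rw [add_comm]; exact hasDeg_seriesMul hg hf) _)

theorem weight_of_hasDeg {p : ℤ} {f : List ι → K} (hf : HasDeg deg p f) :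
    weight deg (ksign K) f = ksign K p • f := by
  funext w
  by_cases h : f w = 0
  · simp [weight, h]
  · simp [weight, hf w h]

theorem hasDeg_vectorField {μ : ι → ι → ι →₀ K} (hμ : IsGradedCommStructure μ deg) {p : ℤ}
    {f : List ι → K} (hf : HasDeg deg p f) : HasDeg deg (p + 1) (vectorField μ deg f) := by
  classical
  intro w hw
  have h := vectorField_weight hμ w (fun n => if n = p then 1 else 0) f
  have e : weight deg (fun n => if n = p then 1 else 0) f = f := by
    funext v
    by_cases hv : f v = 0
    · simp [weight, hv]
    · simp [weight, hf v hv]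
  rw [e] at h
  by_contra hne
  rw [if_neg (fun h' => hne (by omega)), zero_mul] at h
  exact hw h

/-- The graded Jacobi identity. -/
theorem bracket_jacobi {p q r : ℤ} {x y z : List ι → K} (hx : HasDeg deg p x) (hy : HasDeg deg q y)
    (hz : HasDeg deg r z) : bracket deg (bracket deg x y) z =
      bracket deg x (bracket deg y z) -
        ksign K (p * q) • bracket deg y (bracket deg x z) := by
  rw [bracket_of_hasDeg (hasDeg_bracket hx hy) hz, bracket_of_hasDeg hx (hasDeg_bracket hy hz),
    bracket_of_hasDeg hy (hasDeg_bracket hx hz), bracket_of_hasDeg hx hy, bracket_of_hasDeg hy hz,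
    bracket_of_hasDeg hx hz]
  simp only [seriesMul_sub_left, seriesMul_sub_right, seriesMul_smul_left, seriesMul_smul_right,
    seriesMul_assoc, add_mul, mul_add, ksign_add, mul_comm q p]
  have hk := ksign_mul_self (K := K) (p * q)
  funext w
  simp only [Pi.sub_apply, Pi.smul_apply, smul_eq_mul]
  generalize seriesMul z (seriesMul y x) w = A
  generalize seriesMul x (seriesMul z y) w = B
  generalize seriesMul y (seriesMul z x) w = C
  generalize seriesMul z (seriesMul x y) w = D
  linear_combination (ksign K (q * r) * ksign K (p * r) * D - ksign K (q * r) * B) * hk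

open Classical in
theorem hasDeg_single (u : List ι) : HasDeg deg (wordDeg deg u) (Pi.single u (1 : K)) := by
  intro w hw
  by_cases h : w = u
  · rw [h]
  · simp [h] at hw

open Classical in
theorem letter_eq_single (i : ι) : letter K i = Pi.single [i] 1 := by
  funext w; simp [letter, Pi.single_apply]

open Classical in
theorem letter_mul_single (a : ι) (u : List ι) :
    seriesMul (letter K a) (Pi.single u 1) = Pi.single (a :: u) 1 := by
  funext w
  cases w with
  | nil => simp [seriesMul_nil, letter]
  | cons b w =>
    rw [seriesMul_cons, seriesMul_eq_splitSum, splitSum_left_nil fun i u v => by simp [letter]]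
    by_cases h : b = a <;> by_cases h' : w = u <;> simp [letter, Pi.single_apply, h, h']

theorem hasDeg_letter (i : ι) : HasDeg deg (1 - deg i) (letter K i) := by
  classical
  have := hasDeg_single (K := K) (deg := deg) [i]
  rw [← letter_eq_single] at this
  simpa [wordDeg] using this

end Homogeneous

/-! ### Lie monomials in the letters -/

section LetterMonomial

variable {K : Type*} [CommRing K] {ι : Type*} {deg : ι → ℕ} {S : Set ι}

/-- Iterated brackets of single letters from `S`, together with the multiset of the letters that
occur. Every word with a nonzero coefficient in such a monomial is an arrangement of it. -/
inductive IsLetterMonomial (K : Type*) [CommRing K] (deg : ι → ℕ) (S : Set ι) :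
    Multiset ι → (List ι → K) → Prop
  | letter (i : ι) (hi : i ∈ S) : IsLetterMonomial K deg S {i} (letter K i)
  | bracket {s t : Multiset ι} {f g : List ι → K} (hf : IsLetterMonomial K deg S s f)
      (hg : IsLetterMonomial K deg S t g) : IsLetterMonomial K deg S (s + t) (bracket deg f g)

/-- The degree of the words with a given multiset of letters. -/
def contentDeg (deg : ι → ℕ) (s : Multiset ι) : ℤ := (s.map fun i => 1 - (deg i : ℤ)).sum

theorem contentDeg_coe (w : List ι) : contentDeg deg (w : Multiset ι) = wordDeg deg w := by
  simp [contentDeg, wordDeg]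

theorem contentDeg_add (s t : Multiset ι) :
    contentDeg deg (s + t) = contentDeg deg s + contentDeg deg t := by simp [contentDeg]

theorem IsLetterMonomial.support {s : Multiset ι} {f : List ι → K}
    (h : IsLetterMonomial K deg S s f) : ∀ w, f w ≠ 0 → (w : Multiset ι) = s := by
  induction h with
  | letter i _ =>
    intro w hw
    simp only [CyclicHarrison.letter, ne_eq, ite_eq_right_iff, Classical.not_imp] at hw
    simp [hw.1]
  | @bracket s t f g hf hg ihf ihg =>
    intro w hw
    rw [bracket_eq_splitSum] at hw
    by_contra hne
    refine hw (splitSum_eq_zero fun u v e => ?_)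
    have h1 : f u * g v = 0 := by
      by_contra h
      exact hne (by rw [← e, ← Multiset.coe_add, ihf u (left_ne_zero_of_mul h),
        ihg v (right_ne_zero_of_mul h)])
    have h2 : g u * f v = 0 := by
      by_contra h
      exact hne (by rw [← e, ← Multiset.coe_add, ihg u (left_ne_zero_of_mul h),
        ihf v (right_ne_zero_of_mul h), add_comm])
    rw [h1, h2, mul_zero, sub_zero]

theorem IsLetterMonomial.hasDeg {s : Multiset ι} {f : List ι → K}
    (h : IsLetterMonomial K deg S s f) : HasDeg deg (contentDeg deg s) f := fun w hw => by
  rw [← h.support w hw, contentDeg_coe]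

theorem IsLetterMonomial.ne_zero {s : Multiset ι} {f : List ι → K}
    (h : IsLetterMonomial K deg S s f) : s ≠ 0 := by
  induction h with
  | letter i _ => simp
  | bracket hf hg ihf ihg => simp [ihf]

theorem IsLetterMonomial.apply_nil {s : Multiset ι} {f : List ι → K}
    (h : IsLetterMonomial K deg S s f) : f [] = 0 := by
  by_contra hne
  exact h.ne_zero (h.support _ hne).symm

theorem IsLetterMonomial.restrict {S' : Set ι} {s : Multiset ι} {f : List ι → K}
    (h : IsLetterMonomial K deg S s f) (hs : ∀ i ∈ s, i ∈ S') : IsLetterMonomial K deg S' s f := by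
  induction h with
  | letter i _ => exact .letter i (hs i (by simp))
  | bracket hf hg ihf ihg =>
    exact .bracket (ihf fun i hi => hs i (Multiset.mem_add.2 (Or.inl hi)))
      (ihg fun i hi => hs i (Multiset.mem_add.2 (Or.inr hi)))

theorem IsLetterMonomial.letter_mem {s : Multiset ι} {f : List ι → K}
    (h : IsLetterMonomial K deg S s f) : ∀ i ∈ s, i ∈ S := by
  induction h with
  | letter i hi => simpa using hi
  | bracket _ _ ih ih' => exact fun i hi => (Multiset.mem_add.1 hi).elim (ih i) (ih' i)

theorem IsLetterMonomial.isLieMonomial {s : Multiset ι} {f : List ι → K}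
    (h : IsLetterMonomial K deg S s f) : IsLieMonomial K deg S f := by
  induction h with
  | letter i hi =>
    refine .of _ fun w hw => ⟨i, hi, ?_⟩
    simp only [CyclicHarrison.letter, ne_eq, ite_eq_right_iff, Classical.not_imp] at hw
    exact hw.1
  | bracket _ _ ihf ihg => exact .bracket _ _ ihf ihg

theorem IsLetterMonomial.mem {s : Multiset ι} {f : List ι → K}
    (h : IsLetterMonomial K deg S s f) : f ∈ freeLie K deg S := monomial_mem h.isLieMonomial

/-- The letters of a Lie monomial may be infinite combinations of the `t i`; expanding them gives
iterated brackets of the `t i` themselves. -/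
theorem IsLieMonomial.mem_closure_letterMonomial {f : List ι → K} (hf : IsLieMonomial K deg S f) :
    f ∈ formalClosure (Submodule.span K {f | ∃ s, IsLetterMonomial K deg S s f}) := by
  classical
  induction hf with
  | of f hf =>
    intro s
    refine ⟨∑ w ∈ s, f w • Pi.single w 1, Submodule.sum_mem _ fun w _ => ?_, fun x hx => ?_⟩
    · by_cases h : f w = 0
      · rw [h, zero_smul]; exact Submodule.zero_mem _
      · obtain ⟨i, hi, rfl⟩ := hf w h
        rw [← letter_eq_single]
        exact Submodule.smul_mem _ _ (Submodule.subset_span ⟨_, .letter i hi⟩)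
    · simp only [Finset.sum_apply, Pi.smul_apply, smul_eq_mul, Pi.single_apply]
      simp [hx]
  | bracket f g _ _ hf hg =>
    refine map_formalClosure (T := bracketLeft deg g) (isFormal_bracketLeft deg g)
      (span_linear _ ?_) f hf
    rintro x ⟨s, hx⟩
    refine map_formalClosure (T := bracketRight deg x) (isFormal_bracketRight deg x)
      (span_linear _ ?_) g hg
    rintro y ⟨t, hy⟩
    exact le_formalClosure _ (Submodule.subset_span ⟨_, .bracket hx hy⟩)

/-- A continuous linear map takes Lie series into a closed submodule if it does so for the iterated
brackets of letters. -/
theorem freeLie_induction {Y : Type*} {T : (List ι → K) →ₗ[K] (Y → K)} (hT : IsFormal T)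
    {N : Submodule K (Y → K)}
    (h : ∀ s f, IsLetterMonomial K deg S s f → T f ∈ formalClosure N) :
    ∀ f ∈ freeLie K deg S, T f ∈ formalClosure N := by
  refine map_formalClosure hT (span_linear _ fun x hx => ?_)
  refine map_formalClosure hT (span_linear _ ?_) x (IsLieMonomial.mem_closure_letterMonomial hx)
  rintro y ⟨s, hy⟩
  exact h s y hy

/-- `x ↦ x ⊗ y` as a linear map. -/
def tensLeft (y : List ι → K) : (List ι → K) →ₗ[K] (List ι × List ι → K) where
  toFun x := tens x y
  map_add' _ _ := funext fun _ => by simp [tens, add_mul]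
  map_smul' _ _ := funext fun _ => by simp [tens, mul_assoc]

/-- `y ↦ x ⊗ y` as a linear map. -/
def tensRight (x : List ι → K) : (List ι → K) →ₗ[K] (List ι × List ι → K) where
  toFun y := tens x y
  map_add' _ _ := funext fun _ => by simp [tens, mul_add]
  map_smul' _ _ := funext fun _ => by simp [tens, mul_left_comm]

theorem isFormal_tensLeft (y : List ι → K) : IsFormal (tensLeft y) := fun p =>
  (FormalAt.eval p.1).mul_right _

theorem isFormal_tensRight (x : List ι → K) : IsFormal (tensRight x) := fun p =>
  (FormalAt.eval p.2).mul_left _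

/-- The symmetry of the completed tensor square, as a linear map. -/
def swapLinear (K : Type*) [CommRing K] (deg : ι → ℕ) :
    (List ι × List ι → K) →ₗ[K] (List ι × List ι → K) where
  toFun := swapTensor deg
  map_add' _ _ := funext fun _ => by simp [swapTensor, mul_add]
  map_smul' _ _ := funext fun _ => by simp [swapTensor, mul_left_comm]

theorem isFormal_swapLinear (deg : ι → ℕ) : IsFormal (swapLinear K deg) := fun p =>
  (FormalAt.eval (p.2, p.1)).mul_left _

theorem isFormal_id {X : Type*} : IsFormal (LinearMap.id : (X → K) →ₗ[K] (X → K)) :=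
  fun y => FormalAt.eval y

theorem lieTensor_induction {Y : Type*} {T : (List ι × List ι → K) →ₗ[K] (Y → K)}
    (hT : IsFormal T) {N : Submodule K (Y → K)}
    (h : ∀ s x t y, IsLetterMonomial K deg S s x → IsLetterMonomial K deg S t y →
      T (tens x y) ∈ formalClosure N) :
    ∀ F ∈ lieTensor K deg S, T F ∈ formalClosure N := by
  refine map_formalClosure hT (span_linear _ ?_)
  rintro _ ⟨x, hx, y, hy, rfl⟩
  refine freeLie_induction (T := T ∘ₗ tensLeft y) (hT.comp (isFormal_tensLeft y)) ?_ x hx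
  intro s x hx
  refine freeLie_induction (T := T ∘ₗ tensRight x) (hT.comp (isFormal_tensRight x)) ?_ y hy
  intro t y hy
  exact h s x t y hx hy

/-- The relations between iterated brackets of letters generate all relations. -/
theorem lieRelations_induction {Y : Type*} {T : (List ι × List ι → K) →ₗ[K] (Y → K)}
    (hT : IsFormal T) {N : Submodule K (Y → K)}
    (h1 : ∀ s x t y, IsLetterMonomial K deg S s x → IsLetterMonomial K deg S t y →
      T (tens x y - swapTensor deg (tens x y)) ∈ formalClosure N)
    (h2 : ∀ s x t y r z, IsLetterMonomial K deg S s x → IsLetterMonomial K deg S t y →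
      IsLetterMonomial K deg S r z →
      T (tens (bracket deg x y) z - tens x (bracket deg y z)) ∈ formalClosure N) :
    ∀ F ∈ lieRelations K deg S, T F ∈ formalClosure N := by
  refine map_formalClosure hT (span_linear _ ?_)
  rintro _ (⟨x, hx, y, hy, rfl⟩ | ⟨x, hx, y, hy, z, hz, rfl⟩)
  · refine freeLie_induction (T := T ∘ₗ (LinearMap.id - swapLinear K deg) ∘ₗ tensLeft y)
      (hT.comp ((isFormal_id.sub (isFormal_swapLinear deg)).comp (isFormal_tensLeft y))) ?_ x hx
    intro s x hx
    refine freeLie_induction (T := T ∘ₗ (LinearMap.id - swapLinear K deg) ∘ₗ tensRight x)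
      (hT.comp ((isFormal_id.sub (isFormal_swapLinear deg)).comp (isFormal_tensRight x))) ?_ y hy
    intro t y hy
    exact h1 s x t y hx hy
  · refine freeLie_induction
      (T := T ∘ₗ (tensLeft z ∘ₗ bracketLeft deg y - tensLeft (bracket deg y z)))
      (hT.comp (((isFormal_tensLeft z).comp (isFormal_bracketLeft deg y)).sub
        (isFormal_tensLeft _))) ?_ x hx
    intro s x hx
    refine freeLie_induction
      (T := T ∘ₗ (tensLeft z ∘ₗ bracketRight deg x - tensRight x ∘ₗ bracketLeft deg z))
      (hT.comp (((isFormal_tensLeft z).comp (isFormal_bracketRight deg x)).sub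
        ((isFormal_tensRight x).comp (isFormal_bracketLeft deg z)))) ?_ y hy
    intro t y hy
    refine freeLie_induction
      (T := T ∘ₗ (tensRight (bracket deg x y) - tensRight x ∘ₗ bracketRight deg y))
      (hT.comp ((isFormal_tensRight _).sub
        ((isFormal_tensRight x).comp (isFormal_bracketRight deg y)))) ?_ z hz
    intro r z hz
    exact h2 s x t y r z hx hy hz

theorem swapTensor_tens {p q : ℤ} {x y : List ι → K} (hx : HasDeg deg p x) (hy : HasDeg deg q y) :
    swapTensor deg (tens x y) = ksign K (p * q) • tens y x := by
  funext w
  simp only [swapTensor, tens, Pi.smul_apply, smul_eq_mul]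
  by_cases h1 : x w.2 = 0
  · simp [h1]
  by_cases h2 : y w.1 = 0
  · simp [h2]
  rw [hx _ h1, hy _ h2, mul_comm q p]
  ring

open Classical in
/-- The part of a combination of pairs of words in which the multiset of all letters satisfies a
given condition. Order, degree and the number of occurrences of a letter are such conditions. -/
noncomputable def restrictContent (K : Type*) [CommRing K] (A : Multiset ι → Prop) :
    (List ι × List ι → K) →ₗ[K] (List ι × List ι → K) where
  toFun F p := if A (p.1 + p.2 : Multiset ι) then F p else 0
  map_add' F G := funext fun p => by dsimp only [Pi.add_apply]; split_ifs <;> simp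
  map_smul' a F := funext fun p => by dsimp only [Pi.smul_apply]; split_ifs <;> simp

open Classical in
theorem restrictContent_apply (A : Multiset ι → Prop) (F : List ι × List ι → K)
    (p : List ι × List ι) : restrictContent K A F p =
      if A (p.1 + p.2 : Multiset ι) then F p else 0 := rfl

open Classical in
theorem restrictContent_of_support (A : Multiset ι → Prop) {s : Multiset ι}
    {F : List ι × List ι → K} (h : ∀ p, F p ≠ 0 → (p.1 + p.2 : Multiset ι) = s) :
    restrictContent K A F = if A s then F else 0 := by
  funext p
  rw [restrictContent_apply]
  by_cases hp : F p = 0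
  · simp only [hp, ite_self]; split_ifs <;> simp [hp]
  · rw [h p hp]; split_ifs <;> rfl

theorem isFormal_restrictContent (A : Multiset ι → Prop) : IsFormal (restrictContent K A) :=
  fun p => ⟨{p}, fun F hF => by rw [restrictContent_apply, hF p (by simp), ite_self]⟩

theorem tens_support {s t : Multiset ι} {x y : List ι → K} (hx : IsLetterMonomial K deg S s x)
    (hy : IsLetterMonomial K deg S t y) (p : List ι × List ι) (h : tens x y p ≠ 0) :
    (p.1 + p.2 : Multiset ι) = s + t := by
  rw [hx.support _ (left_ne_zero_of_mul h), hy.support _ (right_ne_zero_of_mul h)]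

/-- The part of a Lie `0`-form selected by a condition on its letters is again a Lie `0`-form, with
letters in `S'` if the condition forces this. -/
theorem restrictContent_mem_lieTensor {S' : Set ι} {A : Multiset ι → Prop}
    (hA : ∀ s, A s → (∀ i ∈ s, i ∈ S) → ∀ i ∈ s, i ∈ S') {F : List ι × List ι → K}
    (hF : F ∈ lieTensor K deg S) : restrictContent K A F ∈ lieTensor K deg S' := by
  refine lieTensor_induction (isFormal_restrictContent A) ?_ F hF
  intro s x t y hx hy
  rw [restrictContent_of_support A (tens_support hx hy)]
  split_ifs with h
  · have h' := hA _ h fun i hi => (Multiset.mem_add.1 hi).elim (hx.letter_mem i)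
      (hy.letter_mem i)
    exact tens_mem (hx.restrict fun i hi => h' i (Multiset.mem_add.2 (Or.inl hi))).mem
      (hy.restrict fun i hi => h' i (Multiset.mem_add.2 (Or.inr hi))).mem
  · exact Submodule.zero_mem _

theorem restrictContent_mem_lieRelations (A : Multiset ι → Prop) {F : List ι × List ι → K}
    (hF : F ∈ lieRelations K deg S) : restrictContent K A F ∈ lieRelations K deg S := by
  refine lieRelations_induction (isFormal_restrictContent A) ?_ ?_ F hF
  · intro s x t y hx hy
    rw [restrictContent_of_support (s := s + t) A fun p hp => ?_]
    · split_ifs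
      · exact swap_rel_mem hx.mem hy.mem
      · exact Submodule.zero_mem _
    · by_cases h : tens x y p = 0
      · have h' : tens x y (p.2, p.1) ≠ 0 := fun h' => hp (by simp [swapTensor, h, h'])
        rw [← tens_support hx hy _ h', add_comm]
      · exact tens_support hx hy p h
  · intro s x t y r z hx hy hz
    rw [restrictContent_of_support (s := s + t + r) A fun p hp => ?_]
    · split_ifs
      · exact bracket_rel_mem hx.mem hy.mem hz.mem
      · exact Submodule.zero_mem _
    · by_cases h : tens (bracket deg x y) z p = 0
      · rw [add_assoc]
        exact tens_support hx (.bracket hy hz) p fun h' => hp (by simp [h, h'])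
      · exact tens_support (.bracket hx hy) hz p h

end LetterMonomial

/-! ### Cyclic words -/

section Cyclic

variable {K : Type*} [CommRing K] {ι : Type*} {deg : ι → ℕ}

/-- Cyclic rotation to a letter of the first tensor factor: the bilinear extension of
`x ⊗ y ↦ ∑ ± a v y u`, the sum over all occurrences `x = u a v` of letters in `x`, with the Koszul
sign of moving `u` past `a v y`. -/
def rotateFirst (K : Type*) [CommRing K] (deg : ι → ℕ) :
    (List ι × List ι → K) →ₗ[K] (List ι → K) where
  toFun F w := match w with
    | [] => 0
    | a :: r => splitSum r fun q u => ksign K (wordDeg deg (a :: q) * wordDeg deg u) *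
        splitSum q fun v s => F (u ++ a :: v, s)
  map_add' F G := funext fun w => by
    cases w with
    | nil => simp
    | cons a r => simp only [Pi.add_apply, splitSum_add, mul_add]
  map_smul' b F := funext fun w => by
    cases w with
    | nil => simp
    | cons a r =>
      simp only [Pi.smul_apply, smul_eq_mul, ← mul_splitSum, RingHom.id_apply]
      rw [mul_splitSum]
      exact splitSum_congr fun _ _ _ => by ring

theorem rotateFirst_nil (F : List ι × List ι → K) : rotateFirst K deg F [] = 0 := rfl

theorem rotateFirst_cons (F : List ι × List ι → K) (a : ι) (r : List ι) :
    rotateFirst K deg F (a :: r) = splitSum r fun q u =>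
      ksign K (wordDeg deg (a :: q) * wordDeg deg u) *
        splitSum q fun v s => F (u ++ a :: v, s) := rfl

theorem isFormal_rotateFirst (deg : ι → ℕ) : IsFormal (rotateFirst K deg) := by
  intro w
  cases w with
  | nil => exact FormalAt.zero
  | cons a r =>
    refine FormalAt.splitSum (G := fun F q u => ksign K (wordDeg deg (a :: q) * wordDeg deg u) *
        splitSum q fun v s => F (u ++ a :: v, s)) r fun q u _ => FormalAt.mul_left _ ?_
    exact FormalAt.splitSum (G := fun F v s => F (u ++ a :: v, s)) q fun v s _ => FormalAt.eval _

theorem rotateFirst_eq_zero {F : List ι × List ι → K} {w : List ι}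
    (h : ∀ p : List ι × List ι, (p.1 + p.2 : Multiset ι) = w → F p = 0) :
    rotateFirst K deg F w = 0 := by
  cases w with
  | nil => rfl
  | cons a r =>
    rw [rotateFirst_cons]
    refine splitSum_eq_zero fun q u e => ?_
    rw [splitSum_eq_zero fun v s e' => h _ ?_, mul_zero]
    rw [← e, ← e', Multiset.coe_add, Multiset.coe_eq_coe]
    classical
    rw [List.perm_iff_count]
    intro b
    simp only [List.count_append, List.count_cons]
    omega

theorem rotateFirst_tens_cons (x y : List ι → K) (a : ι) (r : List ι) :
    rotateFirst K deg (tens x y) (a :: r) = splitSum r fun q u =>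
      ksign K (wordDeg deg (a :: q) * wordDeg deg u) *
        seriesMul (fun v => x (u ++ a :: v)) y q := rfl

theorem rotateFirst_letter (b a : ι) (y : List ι → K) (r : List ι) :
    rotateFirst K deg (tens (letter K b) y) (a :: r) = letter K b [a] * y r := by
  classical
  rw [rotateFirst_tens_cons, splitSum_right_nil]
  · rw [seriesMul_eq_splitSum, splitSum_left_nil]
    · simp [wordDeg, ksign_zero]
    · intro i u v; simp [letter]
  · intro i q u
    rw [seriesMul_eq_splitSum, splitSum_eq_zero, mul_zero]
    intro v s _
    simp [letter]

/-- A marked letter of `x x'` lies in `x` or in `x'`. -/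
theorem rotateFirst_mul {p : ℤ} {x : List ι → K} (hx : HasDeg deg p x) (x' y : List ι → K)
    (w : List ι) : rotateFirst K deg (tens (seriesMul x x') y) w =
      rotateFirst K deg (tens x (seriesMul x' y)) w +
        ksign K (p * (wordDeg deg w - p)) * rotateFirst K deg (tens x' (seriesMul y x)) w := by
  cases w with
  | nil => simp [rotateFirst_nil]
  | cons a r =>
    have h1 : ∀ q u, seriesMul (fun v => seriesMul x x' (u ++ a :: v)) y q =
        seriesMul (fun v => x (u ++ a :: v)) (seriesMul x' y) q +
          splitSum u fun u₁ u₂ => x u₁ * seriesMul (fun v => x' (u₂ ++ a :: v)) y q := by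
      intro q u
      have e : (fun v => seriesMul x x' (u ++ a :: v)) =
          seriesMul (fun v => x (u ++ a :: v)) x' +
            ∑ k ∈ Finset.range (u.length + 1),
              x (u.take k) • fun v => x' (u.drop k ++ a :: v) := by
        funext v
        rw [seriesMul_append, Pi.add_apply, Finset.sum_apply]
        rfl
      rw [e, seriesMul_add_left, seriesMul_assoc, Pi.add_apply]
      congr 1
      simp only [seriesMul, splitSum, Finset.sum_apply, Finset.sum_mul, Finset.mul_sum,
        Pi.smul_apply, smul_eq_mul]
      rw [Finset.sum_comm]
      exact Finset.sum_congr rfl fun _ _ => Finset.sum_congr rfl fun _ _ => by ring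
    simp only [rotateFirst_tens_cons, h1, mul_add, splitSum_add]
    congr 1
    simp only [← seriesMul_assoc, mul_splitSum]
    have h2 : ∀ q u, q ++ u = r → (splitSum u fun u₁ u₂ =>
        ksign K (wordDeg deg (a :: q) * wordDeg deg u) *
          (x u₁ * seriesMul (fun v => x' (u₂ ++ a :: v)) y q)) =
        splitSum u fun u₁ u₂ => ksign K (wordDeg deg (a :: q) * wordDeg deg (u₁ ++ u₂)) *
          (x u₁ * seriesMul (fun v => x' (u₂ ++ a :: v)) y q) := fun q u _ =>
      splitSum_congr fun u₁ u₂ e => by rw [e]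
    rw [splitSum_congr h2, splitSum_assoc r fun q u₁ u₂ =>
      ksign K (wordDeg deg (a :: q) * wordDeg deg (u₁ ++ u₂)) *
        (x u₁ * seriesMul (fun v => x' (u₂ ++ a :: v)) y q)]
    refine splitSum_congr fun t u₂ e => ?_
    rw [seriesMul_eq_splitSum, mul_splitSum, mul_splitSum]
    refine splitSum_congr fun q u₁ e' => ?_
    by_cases hu : x u₁ = 0
    · simp [hu]
    have hd := hx u₁ hu
    rw [← e, ← e', wordDeg_cons, wordDeg_cons, wordDeg_cons, wordDeg_append, wordDeg_append,
      wordDeg_append, hd]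
    generalize 1 - (deg a : ℤ) = α
    generalize wordDeg deg q = β
    generalize wordDeg deg u₂ = γ
    -- The two exponents differ by the even number `2 p γ`.
    have hs : ksign K ((α + β) * (p + γ)) =
        ksign K (p * (α + (β + p + γ) - p)) * ksign K ((α + (β + p)) * γ) := by
      rw [← ksign_add, show p * (α + (β + p + γ) - p) + (α + (β + p)) * γ =
        (α + β) * (p + γ) + (p * γ + p * γ) by ring, ksign_add _ (p * γ + p * γ),
        ksign_even (⟨p * γ, rfl⟩ : Even (p * γ + p * γ)), mul_one]
    rw [hs]
    ring

theorem hasDeg_rotateFirst {p q : ℤ} {x y : List ι → K} (hx : HasDeg deg p x)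
    (hy : HasDeg deg q y) : HasDeg deg (p + q) (rotateFirst K deg (tens x y)) := by
  intro w hw
  by_contra hne
  refine hw (rotateFirst_eq_zero fun u hu => ?_)
  by_contra h
  rw [← contentDeg_coe, ← hu, contentDeg_add, contentDeg_coe, contentDeg_coe,
    hx _ (left_ne_zero_of_mul h), hy _ (right_ne_zero_of_mul h)] at hne
  exact hne rfl

theorem rotateFirst_mul_of_hasDeg {p p' q : ℤ} {x x' y : List ι → K} (hx : HasDeg deg p x)
    (hx' : HasDeg deg p' x') (hy : HasDeg deg q y) :
    rotateFirst K deg (tens (seriesMul x x') y) =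
      rotateFirst K deg (tens x (seriesMul x' y)) +
        ksign K (p * (p' + q)) • rotateFirst K deg (tens x' (seriesMul y x)) := by
  funext w
  rw [rotateFirst_mul hx, Pi.add_apply, Pi.smul_apply, smul_eq_mul]
  congr 1
  by_cases h : rotateFirst K deg (tens x' (seriesMul y x)) w = 0
  · simp [h]
  · rw [hasDeg_rotateFirst hx' (hasDeg_seriesMul hy hx) w h]
    congr 2
    ring

/-- A marked letter of `[x, x']` lies in `x` or in `x'`. -/
theorem rotateFirst_bracket {p p' q : ℤ} {x x' y : List ι → K} (hx : HasDeg deg p x)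
    (hx' : HasDeg deg p' x') (hy : HasDeg deg q y) :
    rotateFirst K deg (tens (bracket deg x x') y) =
      rotateFirst K deg (tens x (bracket deg x' y)) +
        ksign K (p * (p' + q)) • rotateFirst K deg (tens x' (bracket deg y x)) := by
  have t1 : ∀ (a b : List ι → K) (k : K) (c : List ι → K),
      rotateFirst K deg (tens (a - k • b) c) =
        rotateFirst K deg (tens a c) - k • rotateFirst K deg (tens b c) := fun a b k c => by
    rw [← map_smul, ← map_sub]
    exact congrArg _ ((tensLeft c).map_sub a (k • b) |>.trans (by rw [map_smul]; rfl))
  have t2 : ∀ (a b : List ι → K) (k : K) (c : List ι → K),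
      rotateFirst K deg (tens c (a - k • b)) =
        rotateFirst K deg (tens c a) - k • rotateFirst K deg (tens c b) := fun a b k c => by
    rw [← map_smul, ← map_sub]
    exact congrArg _ ((tensRight c).map_sub a (k • b) |>.trans (by rw [map_smul]; rfl))
  rw [bracket_of_hasDeg hx hx', bracket_of_hasDeg hx' hy, bracket_of_hasDeg hy hx, t1, t2, t2,
    rotateFirst_mul_of_hasDeg hx hx' hy, rotateFirst_mul_of_hasDeg hx' hx hy]
  have h := ksign_mul_self (K := K) (p * p')
  funext w
  simp only [Pi.add_apply, Pi.sub_apply, Pi.smul_apply, smul_eq_mul, mul_add, ksign_add,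
    mul_comm p' p, mul_comm q p]
  have h2 := ksign_mul_self (K := K) (p * q)
  linear_combination (ksign K (p * p') * rotateFirst K deg (tens x' (seriesMul x y)) w) * h2 -
    (ksign K (p' * q) * rotateFirst K deg (tens x (seriesMul y x')) w) * h

end Cyclic

section CyclicForm

variable {K : Type*} [CommRing K] {ι : Type*} {deg : ι → ℕ}

/-- The map `x ⊗ y ↦ ∑ rotations of x y`, from the completed tensor square to cyclically invariant
series. -/
def cyclicForm (K : Type*) [CommRing K] (deg : ι → ℕ) :
    (List ι × List ι → K) →ₗ[K] (List ι → K) :=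
  rotateFirst K deg + rotateFirst K deg ∘ₗ swapLinear K deg

theorem isFormal_cyclicForm (deg : ι → ℕ) : IsFormal (cyclicForm K deg) :=
  (isFormal_rotateFirst deg).add ((isFormal_rotateFirst deg).comp (isFormal_swapLinear deg))

theorem cyclicForm_apply (F : List ι × List ι → K) :
    cyclicForm K deg F = rotateFirst K deg F + rotateFirst K deg (swapTensor deg F) := rfl

theorem swapTensor_swapTensor (F : List ι × List ι → K) :
    swapTensor deg (swapTensor deg F) = F := by
  funext p
  simp only [swapTensor]
  rw [← mul_assoc, mul_comm (wordDeg deg p.2), ksign_mul_self, one_mul]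

theorem cyclicForm_swapTensor (F : List ι × List ι → K) :
    cyclicForm K deg (swapTensor deg F) = cyclicForm K deg F := by
  rw [cyclicForm_apply, cyclicForm_apply, swapTensor_swapTensor, add_comm]

theorem cyclicForm_tens {p q : ℤ} {x y : List ι → K} (hx : HasDeg deg p x) (hy : HasDeg deg q y) :
    cyclicForm K deg (tens x y) =
      rotateFirst K deg (tens x y) + ksign K (p * q) • rotateFirst K deg (tens y x) := by
  rw [cyclicForm_apply, swapTensor_tens hx hy, map_smul]

/-- The cyclic form is defined on Lie `0`-forms: it vanishes on the relations. -/
theorem cyclicForm_eq_zero {S : Set ι} {F : List ι × List ι → K} (hF : F ∈ lieRelations K deg S) :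
    cyclicForm K deg F = 0 := by
  refine eq_zero_of_mem_formalClosure_bot
    (lieRelations_induction (isFormal_cyclicForm deg) ?_ ?_ F hF)
  · intro s x t y hx hy
    rw [map_sub, cyclicForm_swapTensor, sub_self]
    exact Submodule.zero_mem _
  · intro s x t y r z hx hy hz
    suffices h : cyclicForm K deg (tens (bracket deg x y) z - tens x (bracket deg y z)) = 0 by
      rw [h]; exact Submodule.zero_mem _
    have hx := hx.hasDeg
    have hy := hy.hasDeg
    have hz := hz.hasDeg
    rw [map_sub, cyclicForm_tens (hasDeg_bracket hx hy) hz, cyclicForm_tens hx (hasDeg_bracket hy hz),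
      rotateFirst_bracket hx hy hz, rotateFirst_bracket hy hz hx]
    have h2 := ksign_mul_self (K := K) (contentDeg deg s * contentDeg deg t)
    funext w
    simp only [Pi.add_apply, Pi.sub_apply, Pi.smul_apply, smul_eq_mul, mul_add, add_mul, ksign_add,
      mul_comm (contentDeg deg t) (contentDeg deg s), Pi.zero_apply]
    linear_combination (-ksign K (contentDeg deg s * contentDeg deg r) *
      ksign K (contentDeg deg t * contentDeg deg r) *
      rotateFirst K deg (tens z (bracket deg x y)) w) * h2

theorem cyclicForm_vanish {F : List ι × List ι → K} {w : List ι}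
    (h : ∀ p : List ι × List ι, (p.1 + p.2 : Multiset ι) = w → F p = 0) :
    cyclicForm K deg F w = 0 := by
  rw [cyclicForm_apply, Pi.add_apply, rotateFirst_eq_zero h, rotateFirst_eq_zero, add_zero]
  intro p hp
  simp only [swapTensor]
  rw [h (p.2, p.1) (by rw [← hp, add_comm]), mul_zero]

/-- Every component of the cyclic form of a Lie `0`-form is a Lie series. -/
theorem cyclicForm_cons_mem {F : List ι × List ι → K} (hF : F ∈ lieTensor K deg Set.univ) (a : ι) :
    (fun r => cyclicForm K deg F (a :: r)) ∈ freeLie K deg Set.univ := by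
  let T : (List ι → K) →ₗ[K] (List ι → K) :=
    { toFun := fun g r => g (a :: r), map_add' := fun _ _ => rfl, map_smul' := fun _ _ => rfl }
  have hT : IsFormal T := fun r => FormalAt.eval (a :: r)
  have key : ∀ s x, IsLetterMonomial K deg Set.univ s x → ∀ t y,
      IsLetterMonomial K deg Set.univ t y →
      T (rotateFirst K deg (tens x y)) ∈ freeLie K deg Set.univ := by
    intro s x hx
    induction hx with
    | letter b hb =>
      intro t y hy
      have : T (rotateFirst K deg (tens (letter K b) y)) = letter K b [a] • y := by
        funext r; exact rotateFirst_letter b a y r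
      rw [this]
      exact Submodule.smul_mem _ _ hy.mem
    | bracket hf hg ihf ihg =>
      intro t y hy
      rw [rotateFirst_bracket hf.hasDeg hg.hasDeg hy.hasDeg, map_add, map_smul]
      exact Submodule.add_mem _ (ihf _ _ (.bracket hg hy))
        (Submodule.smul_mem _ _ (ihg _ _ (.bracket hy hf)))
  refine lieTensor_induction (T := T ∘ₗ cyclicForm K deg) (hT.comp (isFormal_cyclicForm deg))
    ?_ F hF
  intro s x t y hx hy
  rw [LinearMap.comp_apply, cyclicForm_tens hx.hasDeg hy.hasDeg, map_add, map_smul]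
  exact Submodule.add_mem _ (key _ _ hx _ _ hy) (Submodule.smul_mem _ _ (key _ _ hy _ _ hx))

/-- The weight of a multiset of weighted letters. -/
def contentWeight (c : ι → K) (s : Multiset ι) : K := (s.map c).sum

theorem contentWeight_add (c : ι → K) (s t : Multiset ι) :
    contentWeight c (s + t) = contentWeight c s + contentWeight c t := by simp [contentWeight]

/-- The weighted sum of the `a ⊗ g_a`, for a series `g = ∑ a g_a`. -/
def markFirst (c : ι → K) : (List ι → K) →ₗ[K] (List ι × List ι → K) where
  toFun g p := match p.1 with
    | [a] => c a * g (a :: p.2)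
    | _ => 0
  map_add' f g := funext fun ⟨u, v⟩ => by
    rcases u with _ | ⟨a, _ | ⟨b, u⟩⟩ <;> simp [mul_add]
  map_smul' r g := funext fun ⟨u, v⟩ => by
    rcases u with _ | ⟨a, _ | ⟨b, u⟩⟩ <;> simp [mul_left_comm]

theorem markFirst_singleton (c : ι → K) (g : List ι → K) (a : ι) (r : List ι) :
    markFirst c g ([a], r) = c a * g (a :: r) := rfl

theorem markFirst_nil (c : ι → K) (g : List ι → K) (r : List ι) :
    markFirst c g ([], r) = 0 := rfl

theorem markFirst_cons_cons (c : ι → K) (g : List ι → K) (a b : ι) (u r : List ι) :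
    markFirst c g (a :: b :: u, r) = 0 := rfl

theorem isFormal_markFirst (c : ι → K) : IsFormal (markFirst c) := by
  rintro ⟨u, r⟩
  rcases u with _ | ⟨a, _ | ⟨b, u⟩⟩
  · exact FormalAt.zero
  · exact (FormalAt.eval (a :: r)).mul_left (c a)
  · exact FormalAt.zero

/-- Modulo the relations, moving all marked letters of `x` to the front multiplies `x ⊗ y` by the
weight of `x`: this is the Euler identity for cyclic Lie words. -/
theorem markFirst_rotateFirst_tens (c : ι → K) {s : Multiset ι} {x : List ι → K}
    (hx : IsLetterMonomial K deg Set.univ s x) : ∀ {t : Multiset ι} {y : List ι → K},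
    IsLetterMonomial K deg Set.univ t y →
    markFirst c (rotateFirst K deg (tens x y)) - contentWeight c s • tens x y ∈
      lieRelations K deg Set.univ := by
  induction hx with
  | letter b hb =>
    intro t y hy
    have : markFirst c (rotateFirst K deg (tens (letter K b) y)) =
        contentWeight c {b} • tens (letter K b) y := by
      funext ⟨u, r⟩
      simp only [Pi.smul_apply, smul_eq_mul, contentWeight, Multiset.map_singleton,
        Multiset.sum_singleton, tens]
      rcases u with _ | ⟨a, _ | ⟨a', u⟩⟩
      · simp [markFirst_nil, letter]
      · rw [markFirst_singleton, rotateFirst_letter]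
        by_cases h : a = b
        · rw [h]
        · simp [letter, h]
      · simp [markFirst_cons_cons, letter]
    rw [this, sub_self]
    exact Submodule.zero_mem _
  | @bracket s s' x x' hx hx' ih ih' =>
    intro t y hy
    have e1 := ih (.bracket hx' hy)
    have e2 := ih' (.bracket hy hx)
    have r1 := bracket_rel_mem hx.mem hx'.mem hy.mem
    have r2 := bracket_rel_mem hx'.mem hy.mem hx.mem
    have r3 := swap_rel_mem (IsLetterMonomial.bracket hx' hy).mem hx.mem
    have dx := hx.hasDeg
    have dx' := hx'.hasDeg
    have dy := hy.hasDeg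
    rw [swapTensor_tens (hasDeg_bracket dx' dy) dx] at r3
    rw [rotateFirst_bracket dx dx' dy, map_add, map_smul, contentWeight_add]
    set P := contentDeg deg s * (contentDeg deg s' + contentDeg deg t) with hP
    have hk := ksign_mul_self (K := K) P
    rw [mul_comm (contentDeg deg s' + contentDeg deg t) (contentDeg deg s), ← hP] at r3
    have := Submodule.add_mem _ (Submodule.add_mem _ (Submodule.sub_mem _ e1
      (Submodule.smul_mem _ (contentWeight c s + contentWeight c s') r1))
        (Submodule.smul_mem _ (ksign K P) e2))
      (Submodule.add_mem _ (Submodule.smul_mem _ (-(ksign K P * contentWeight c s')) r2)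
        (Submodule.smul_mem _ (ksign K P * contentWeight c s') r3))
    convert this using 1
    funext p
    simp only [Pi.add_apply, Pi.sub_apply, Pi.smul_apply, smul_eq_mul]
    linear_combination (contentWeight c s' * tens x (bracket deg x' y) p) * hk

/-- Multiplication of the coefficient of each pair of words by its weight. -/
def scaleContent (c : ι → K) : (List ι × List ι → K) →ₗ[K] (List ι × List ι → K) where
  toFun F p := contentWeight c (p.1 + p.2 : Multiset ι) * F p
  map_add' _ _ := funext fun _ => mul_add _ _ _
  map_smul' _ _ := funext fun _ => mul_left_comm _ _ _

theorem scaleContent_apply (c : ι → K) (F : List ι × List ι → K) (p : List ι × List ι) :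
    scaleContent c F p = contentWeight c (p.1 + p.2 : Multiset ι) * F p := rfl

theorem markFirst_cyclicForm (c : ι → K) {F : List ι × List ι → K}
    (hF : F ∈ lieTensor K deg Set.univ) :
    markFirst c (cyclicForm K deg F) - scaleContent c F ∈ lieRelations K deg Set.univ := by
  refine lieTensor_induction (T := markFirst c ∘ₗ cyclicForm K deg - scaleContent c)
    (((isFormal_markFirst c).comp (isFormal_cyclicForm deg)).sub
      fun p => (FormalAt.eval p).mul_left _) ?_ F hF
  intro s x t y hx hy
  have e1 := markFirst_rotateFirst_tens c hx hy
  have e2 := markFirst_rotateFirst_tens c hy hx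
  have r := swap_rel_mem hx.mem hy.mem
  rw [swapTensor_tens hx.hasDeg hy.hasDeg] at r
  have hs : scaleContent c (tens x y) = (contentWeight c s + contentWeight c t) • tens x y := by
    funext p
    rw [scaleContent_apply, Pi.smul_apply, smul_eq_mul]
    by_cases h : tens x y p = 0
    · rw [h, mul_zero, mul_zero]
    · rw [tens_support hx hy p h, contentWeight_add]
  change (markFirst c ∘ₗ cyclicForm K deg - scaleContent c) (tens x y) ∈ lieRelations K deg Set.univ
  rw [LinearMap.sub_apply, LinearMap.comp_apply, cyclicForm_tens hx.hasDeg hy.hasDeg, map_add,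
    map_smul, hs]
  have := Submodule.add_mem _ (Submodule.add_mem _ e1 (Submodule.smul_mem _
    (ksign K (contentDeg deg s * contentDeg deg t)) e2)) (Submodule.smul_mem _
      (-contentWeight c t) r)
  convert this using 1
  funext p
  simp only [Pi.add_apply, Pi.sub_apply, Pi.smul_apply, smul_eq_mul]
  ring

/-- A Lie `0`-form whose words all have the same weight is determined by its cyclic form, up to
that weight. -/
theorem markFirst_cyclicForm_of_weight {c : ι → K} {q : K} {F : List ι × List ι → K}
    (hF : F ∈ lieTensor K deg Set.univ)
    (hq : ∀ p, F p ≠ 0 → contentWeight c (p.1 + p.2 : Multiset ι) = q) :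
    markFirst c (cyclicForm K deg F) - q • F ∈ lieRelations K deg Set.univ := by
  have : scaleContent c F = q • F := by
    funext p
    by_cases h : F p = 0
    · simp [scaleContent_apply, h]
    · rw [scaleContent_apply, hq p h]; rfl
  rw [← this]
  exact markFirst_cyclicForm c hF

theorem mem_of_smul_mem [Algebra ℚ K] {n : ℕ} (hn : n ≠ 0) {X : Type*}
    {M : Submodule K (X → K)} {F : X → K} (h : (n : K) • F ∈ M) : F ∈ M := by
  have h2 := M.smul_mem (algebraMap ℚ K (1 / n)) h
  rw [smul_smul, ← map_natCast (algebraMap ℚ K) n, ← map_mul,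
    one_div_mul_cancel (Nat.cast_ne_zero.2 hn), map_one, one_smul] at h2
  exact h2

end CyclicForm

/-! ### The weighted Dynkin operator -/

section Dynkin

variable {K : Type*} [CommRing K] {ι : Type*} {deg : ι → ℕ}

/-- The right-normed bracket `[a₁, [a₂, …, [aₙ₋₁, aₙ]]]` of the letters of a word, multiplied by
the weight of the last letter. -/
noncomputable def rightNormed (deg : ι → ℕ) (c : ι → K) : List ι → List ι → K
  | [] => 0
  | [b] => c b • letter K b
  | a :: b :: w => bracket deg (letter K a) (rightNormed deg c (b :: w))

theorem rightNormed_cons (c : ι → K) (a : ι) {w : List ι} (hw : w ≠ []) :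
    rightNormed deg c (a :: w) = bracket deg (letter K a) (rightNormed deg c w) := by
  cases w with
  | nil => exact absurd rfl hw
  | cons b w => rfl

theorem rightNormed_mem (c : ι → K) (u : List ι) :
    rightNormed deg c u ∈ freeLie K deg Set.univ := by
  induction u with
  | nil => exact Submodule.zero_mem _
  | cons a u ih =>
    have ha := (IsLetterMonomial.letter (K := K) (deg := deg) a (Set.mem_univ a)).mem
    cases u with
    | nil => exact Submodule.smul_mem _ _ ha
    | cons b u => exact bracket_mem ha ih

theorem rightNormed_support (c : ι → K) (u : List ι) :
    ∀ v, rightNormed deg c u v ≠ 0 → v.Perm u := by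
  induction u with
  | nil => intro v hv; exact absurd rfl hv
  | cons a u ih =>
    cases u with
    | nil =>
      intro v hv
      have : letter K a v ≠ 0 := fun h => hv (by simp [rightNormed, h])
      simp only [letter, ne_eq, ite_eq_right_iff, Classical.not_imp] at this
      rw [this.1]
    | cons b u =>
      intro v hv
      rw [rightNormed_cons c a (List.cons_ne_nil b u), bracket_eq_splitSum] at hv
      have hl : ∀ w, letter K a w ≠ 0 → w = [a] := by
        intro w hw
        simp only [letter, ne_eq, ite_eq_right_iff, Classical.not_imp] at hw
        exact hw.1
      by_contra hne
      refine hv (splitSum_eq_zero fun w s e => ?_)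
      have h1 : letter K a w * rightNormed deg c (b :: u) s = 0 := by
        by_contra h
        refine hne ?_
        rw [← e, hl w (left_ne_zero_of_mul h)]
        exact (ih s (right_ne_zero_of_mul h)).cons a
      have h2 : rightNormed deg c (b :: u) w * letter K a s = 0 := by
        by_contra h
        refine hne ?_
        rw [← e, hl s (right_ne_zero_of_mul h)]
        exact (List.perm_append_singleton a w).trans ((ih w (left_ne_zero_of_mul h)).cons a)
      rw [h1, h2, mul_zero, sub_zero]

theorem wordDeg_perm {u v : List ι} (h : u.Perm v) : wordDeg deg u = wordDeg deg v := by
  rw [← contentDeg_coe, ← contentDeg_coe, Multiset.coe_eq_coe.2 h]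

open Classical in
/-- The continuous linear extension of `u ↦ rightNormed deg c u`. -/
noncomputable def dynkin (deg : ι → ℕ) (c : ι → K) : (List ι → K) →ₗ[K] (List ι → K) where
  toFun f v := ∑ u ∈ v.permutations.toFinset, f u * rightNormed deg c u v
  map_add' f g := funext fun v => by simp [add_mul, Finset.sum_add_distrib]
  map_smul' a f := funext fun v => by simp [Finset.mul_sum, mul_assoc]

open Classical in
theorem dynkin_apply (c : ι → K) (f : List ι → K) (v : List ι) :
    dynkin deg c f v = ∑ u ∈ v.permutations.toFinset, f u * rightNormed deg c u v := rfl

theorem isFormal_dynkin (deg : ι → ℕ) (c : ι → K) : IsFormal (dynkin deg c) := by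
  classical
  exact fun v => FormalAt.sum (φ := fun u f => f u * rightNormed deg c u v)
    v.permutations.toFinset fun u _ => (FormalAt.eval u).mul_right _

open Classical in
theorem dynkin_single (c : ι → K) (u : List ι) :
    dynkin deg c (Pi.single u 1) = rightNormed deg c u := by
  funext v
  rw [dynkin_apply]
  simp only [Pi.single_apply, ite_mul, one_mul, zero_mul, Finset.sum_ite_eq', List.mem_toFinset,
    List.mem_permutations]
  split_ifs with h
  · rfl
  · by_contra h'
    exact h ((rightNormed_support c u v (Ne.symm h')).symm)

theorem dynkin_mem (c : ι → K) (f : List ι → K) : dynkin deg c f ∈ freeLie K deg Set.univ := by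
  classical
  refine formalClosure_idem _ fun s => ⟨∑ u ∈ s.biUnion fun v => v.permutations.toFinset,
    f u • rightNormed deg c u, Submodule.sum_mem _ fun u _ =>
      Submodule.smul_mem _ _ (rightNormed_mem c u), fun v hv => ?_⟩
  rw [dynkin_apply, Finset.sum_apply]
  refine (Finset.sum_subset (Finset.subset_biUnion_of_mem
    (fun v : List ι => v.permutations.toFinset) hv) fun u _ hu => ?_).symm
  by_contra h
  refine hu (List.mem_toFinset.2 (List.mem_permutations.2
    (rightNormed_support (deg := deg) c u v fun h' => h ?_).symm))
  change f u * rightNormed deg c u v = 0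
  rw [h', mul_zero]

theorem hasDeg_dynkin (c : ι → K) {q : ℤ} {f : List ι → K} (hf : HasDeg deg q f) :
    HasDeg deg q (dynkin deg c f) := by
  classical
  intro v hv
  rw [dynkin_apply] at hv
  obtain ⟨u, hu, h⟩ := Finset.exists_ne_zero_of_sum_ne_zero hv
  rw [← hf u (left_ne_zero_of_mul h),
    wordDeg_perm (rightNormed_support c u v (right_ne_zero_of_mul h))]

theorem dynkin_letter_mul (c : ι → K) (a : ι) (f : List ι → K) :
    dynkin deg c (seriesMul (letter K a) f) =
      bracket deg (letter K a) (dynkin deg c f) + (c a * f []) • letter K a := by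
  classical
  let E : (List ι → K) →ₗ[K] (List ι → K) :=
    { toFun := fun f => (c a * f []) • letter K a
      map_add' := fun f g => by simp [mul_add, add_smul]
      map_smul' := fun r f => by simp [smul_smul, mul_left_comm] }
  have hE : IsFormal E := fun v => ((FormalAt.eval []).mul_left (c a)).mul_right (letter K a v)
  refine LinearMap.congr_fun (IsFormal.ext (T := dynkin deg c ∘ₗ mulLeft (letter K a))
    (T' := bracketRight deg (letter K a) ∘ₗ dynkin deg c + E)
    ((isFormal_dynkin deg c).comp (isFormal_mulLeft _))
    (((isFormal_bracketRight deg _).comp (isFormal_dynkin deg c)).add hE) fun u => ?_) f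
  change dynkin deg c (seriesMul (letter K a) (Pi.single u 1)) =
    bracket deg (letter K a) (dynkin deg c (Pi.single u 1)) +
      (c a * (Pi.single u 1 : List ι → K) []) • letter K a
  rw [letter_mul_single, dynkin_single, dynkin_single]
  cases u with
  | nil =>
    have : bracket deg (letter K a) (rightNormed deg c []) = 0 :=
      (bracketRight deg (letter K a)).map_zero
    rw [this, zero_add, Pi.single_eq_same, mul_one]
    rfl
  | cons b u => simp [rightNormed]

/-- Left multiplication by a Lie series corresponds to the adjoint action, as for letters; for
brackets this is the Jacobi identity. -/
theorem dynkin_lie_mul (c : ι → K) {s : Multiset ι} {x : List ι → K}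
    (hx : IsLetterMonomial K deg Set.univ s x) : ∀ {q : ℤ} {f : List ι → K}, HasDeg deg q f →
    f [] = 0 → dynkin deg c (seriesMul x f) = bracket deg x (dynkin deg c f) := by
  induction hx with
  | letter a _ =>
    intro q f _ h0
    rw [dynkin_letter_mul, h0, mul_zero, zero_smul, add_zero]
  | @bracket s t x y hx hy ihx ihy =>
    intro q f hf h0
    have h1 : seriesMul x f [] = 0 := by rw [seriesMul_nil, h0, mul_zero]
    have h2 : seriesMul y f [] = 0 := by rw [seriesMul_nil, h0, mul_zero]
    rw [bracket_jacobi hx.hasDeg hy.hasDeg (hasDeg_dynkin c hf), bracket_of_hasDeg hx.hasDeg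
      hy.hasDeg, seriesMul_sub_left, seriesMul_smul_left, seriesMul_assoc, seriesMul_assoc, map_sub,
      map_smul, ihx (hasDeg_seriesMul hy.hasDeg hf) h2, ihy (hasDeg_seriesMul hx.hasDeg hf) h1,
      ihx hf h0, ihy hf h0]

/-- The Dynkin–Specht–Wever theorem, for weighted letters. -/
theorem dynkin_letterMonomial (c : ι → K) {s : Multiset ι} {x : List ι → K}
    (hx : IsLetterMonomial K deg Set.univ s x) : dynkin deg c x = contentWeight c s • x := by
  classical
  induction hx with
  | letter a _ =>
    rw [letter_eq_single, dynkin_single, ← letter_eq_single]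
    simp [rightNormed, contentWeight]
  | @bracket s t x y hx hy ihx ihy =>
    have dx := hx.hasDeg
    have dy := hy.hasDeg
    rw [bracket_of_hasDeg dx dy, map_sub, map_smul, dynkin_lie_mul c hx dy hy.apply_nil,
      dynkin_lie_mul c hy dx hx.apply_nil, ihx, ihy, contentWeight_add]
    rw [show bracket deg x (contentWeight c t • y) = contentWeight c t • bracket deg x y from
      (bracketRight deg x).map_smul _ _, show bracket deg y (contentWeight c s • x) =
      contentWeight c s • bracket deg y x from (bracketRight deg y).map_smul _ _,
      bracket_of_hasDeg dx dy, bracket_of_hasDeg dy dx]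
    have hk := ksign_mul_self (K := K) (contentDeg deg s * contentDeg deg t)
    funext w
    simp only [Pi.sub_apply, Pi.smul_apply, smul_eq_mul,
      mul_comm (contentDeg deg t) (contentDeg deg s)]
    linear_combination (contentWeight c s * seriesMul x y w) * hk

/-- The Dynkin operator is multiplication by the weight on all Lie series. -/
theorem dynkin_of_mem (c : ι → K) {x : List ι → K} (hx : x ∈ freeLie K deg Set.univ)
    (v : List ι) : dynkin deg c x v = contentWeight c v * x v := by
  let E : (List ι → K) →ₗ[K] (List ι → K) :=
    { toFun := fun f v => contentWeight c v * f v
      map_add' := fun f g => funext fun v => mul_add _ _ _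
      map_smul' := fun r f => funext fun v => mul_left_comm _ _ _ }
  have hE : IsFormal E := fun v => (FormalAt.eval v).mul_left _
  have := eq_zero_of_mem_formalClosure_bot (freeLie_induction (T := dynkin deg c - E)
    ((isFormal_dynkin deg c).sub hE) (N := ⊥) (fun s f hf => ?_) x hx)
  · exact sub_eq_zero.1 (congrFun this v)
  · have : (dynkin deg c - E) f = 0 := by
      funext v
      change dynkin deg c f v - contentWeight c v * f v = 0
      rw [dynkin_letterMonomial c hf, Pi.smul_apply, smul_eq_mul]
      by_cases h : f v = 0
      · simp [h]
      · rw [hf.support v h, sub_self]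
    rw [this]
    exact Submodule.zero_mem _

/-- There are no Lie series of order greater than two in a single letter of odd degree. -/
theorem apply_replicate_eq_zero [Algebra ℚ K] {u : ι} (hu : deg u = 0) {x : List ι → K}
    (hx : x ∈ freeLie K deg Set.univ) (n : ℕ) : x (List.replicate (n + 3) u) = 0 := by
  classical
  have dl : HasDeg deg 1 (letter K u) := by simpa [hu] using hasDeg_letter (K := K) (deg := deg) u
  have h3 : ∀ n, rightNormed deg (fun _ => (1 : K)) (List.replicate (n + 3) u) = 0 := by
    intro n
    induction n with
    | zero =>
      change bracket deg (letter K u) (bracket deg (letter K u) ((1 : K) • letter K u)) = 0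
      rw [one_smul, bracket_of_hasDeg dl (hasDeg_bracket dl dl), bracket_of_hasDeg dl dl]
      simp only [mul_one, one_mul, ksign_one, seriesMul_sub_left, seriesMul_sub_right,
        seriesMul_smul_left, seriesMul_smul_right, seriesMul_assoc,
        show ksign K (1 + 1) = 1 from ksign_even ⟨1, rfl⟩]
      simp
    | succ n ih =>
      rw [List.replicate_succ, rightNormed_cons _ _ (by simp [List.replicate_succ]), ih]
      exact (bracketRight deg (letter K u)).map_zero
  have h := dynkin_of_mem (fun _ => (1 : K)) hx (List.replicate (n + 3) u)
  rw [dynkin_apply, Finset.sum_eq_zero] at h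
  · have hw : contentWeight (fun _ => (1 : K)) (List.replicate (n + 3) u : Multiset ι) =
        ((n + 3 : ℕ) : K) := by
      rw [contentWeight, Multiset.map_const', Multiset.sum_replicate]; simp
    rw [hw] at h
    have := mem_of_smul_mem (K := K) (X := Unit) (M := ⊥) (n := n + 3) (by omega)
      (F := fun _ => x (List.replicate (n + 3) u)) (by
        rw [Submodule.mem_bot]; funext _; exact h.symm)
    exact congrFun ((Submodule.mem_bot K).1 this) ()
  · intro v hv
    rw [List.mem_toFinset, List.mem_permutations, List.perm_replicate] at hv
    rw [hv, h3]
    simp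

end Dynkin

/-! ### The square of the letter dual to the unit -/

section UnitField

variable {K : Type*} [CommRing K] {ι : Type*} {deg : ι → ℕ} {u : ι}

open Classical in
/-- The structure constants of the multiplication whose only nonzero product of basis elements is
`x u * x u = - x u`. The corresponding vector field `t u ↦ - t u * t u` is the leading part of
`m - [t u, ·]`. -/
noncomputable def unitConst (K : Type*) [CommRing K] (u : ι) (i j : ι) : ι →₀ K :=
  if i = u ∧ j = u then -Finsupp.single u 1 else 0

theorem unitConst_self : unitConst K u u u = -Finsupp.single u 1 := by simp [unitConst]

theorem unitConst_left {i : ι} (h : i ≠ u) (j : ι) : unitConst K u i j = 0 := by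
  simp [unitConst, h]

theorem unitConst_right {j : ι} (h : j ≠ u) (i : ι) : unitConst K u i j = 0 := by
  simp [unitConst, h]

theorem isGradedCommStructure_unitConst (hu : deg u = 0) :
    IsGradedCommStructure (unitConst K u) deg where
  deg_eq i j c h := by
    by_cases hi : i = u
    · by_cases hj : j = u
      · rw [hi, hj, unitConst_self] at h
        have : c = u := by
          by_contra hc
          exact h (by simp [Ne.symm hc])
        rw [this, hi, hj, hu]
      · exact absurd (by rw [unitConst_right hj]; rfl) h
    · exact absurd (by rw [unitConst_left hi]; rfl) h
  comm i j c := by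
    by_cases hi : i = u
    · by_cases hj : j = u
      · subst hi; subst hj; simp [hu, ksign_zero]
      · simp [unitConst_right hj, unitConst_left hj]
    · simp [unitConst_right hi, unitConst_left hi]

theorem vectorField_unitConst_cons_of_ne {b : ι} (hb : b ≠ u) (f : List ι → K) (w : List ι) :
    vectorField (unitConst K u) deg f (b :: w) =
      ksign K (1 - deg b) * vectorField (unitConst K u) deg (fun v => f (b :: v)) w := by
  rw [vectorField_cons]
  cases w with
  | nil => simp [headMerge]
  | cons j w => simp [headMerge, unitConst_left hb]

theorem vectorField_unitConst_cons_cons_of_ne (hu : deg u = 0) {b : ι} (hb : b ≠ u)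
    (f : List ι → K) (w : List ι) : vectorField (unitConst K u) deg f (u :: b :: w) =
      -vectorField (unitConst K u) deg (fun v => f (u :: v)) (b :: w) := by
  rw [vectorField_cons]
  simp [headMerge, unitConst_right hb, hu, ksign_one]

theorem vectorField_unitConst_cons_cons (hu : deg u = 0) (f : List ι → K) (w : List ι) :
    vectorField (unitConst K u) deg f (u :: u :: w) = -f (u :: w) -
      vectorField (unitConst K u) deg (fun v => f (u :: v)) (u :: w) := by
  rw [vectorField_cons]
  simp only [headMerge, unitConst_self, ← Finsupp.single_neg]
  rw [Finsupp.sum_single_index (by simp)]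
  simp [hu, ksign_one, ksign_zero, sub_eq_add_neg]

theorem vectorField_singleton (μ : ι → ι → ι →₀ K) (f : List ι → K) (b : ι) :
    vectorField μ deg f [b] = 0 := rfl

/-- The field annihilates series in the other letters. -/
theorem vectorField_unitConst_eq_zero : ∀ (w : List ι) (f : List ι → K),
    (∀ w, u ∈ w → f w = 0) → vectorField (unitConst K u) deg f w = 0 := by
  intro w
  induction w with
  | nil => intro f _; rfl
  | cons b w ih =>
    intro f hf
    rw [vectorField_cons, ih _ fun v hv => hf _ (List.mem_cons_of_mem b hv), mul_zero, add_zero]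
    cases w with
    | nil => rfl
    | cons j w =>
      by_cases h : b = u
      · by_cases h' : j = u
        · subst h; subst h'
          simp only [headMerge, unitConst_self, ← Finsupp.single_neg]
          rw [Finsupp.sum_single_index (by simp), hf _ List.mem_cons_self, mul_zero, mul_zero]
        · simp [headMerge, unitConst_right h']
      · simp [headMerge, unitConst_left h]

theorem vectorField_unitConst_letter (hu : deg u = 0) :
    vectorField (unitConst K u) deg (letter K u) = -seriesMul (letter K u) (letter K u) := by
  classical
  funext w
  rw [Pi.neg_apply, seriesMul_letter]
  rcases w with _ | ⟨a, _ | ⟨b, w⟩⟩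
  · simp [vectorField_nil]
  · simp [vectorField_singleton]
  · by_cases ha : a = u
    · subst ha
      have hz : ∀ w, vectorField (unitConst K a) deg (fun v => letter K a (a :: v)) w = 0 := by
        intro w
        refine vectorField_unitConst_eq_zero w _ fun v hv => ?_
        cases v with
        | nil => simp at hv
        | cons c v => simp [letter]
      by_cases hb : b = a
      · subst hb
        rw [vectorField_unitConst_cons_cons hu, hz]
        simp [letter]
      · rw [vectorField_unitConst_cons_cons_of_ne hu hb, hz]
        simp [hb]
    · rw [vectorField_unitConst_cons_of_ne ha, vectorField_unitConst_eq_zero]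
      · simp [ha]
      · intro w _; simp [letter, ha]

theorem vectorField_unitConst_letter_of_ne {b : ι} (hb : b ≠ u) :
    vectorField (unitConst K u) deg (letter K b) = 0 := by
  funext w
  refine vectorField_unitConst_eq_zero w _ fun v hv => ?_
  by_contra h
  simp only [letter, ite_eq_right_iff, Classical.not_imp] at h
  rw [h.1, List.mem_singleton] at hv
  exact hb hv.symm

theorem vectorField_seriesMul (μ : ι → ι → ι →₀ K) {p : ℤ} {f : List ι → K}
    (hf : HasDeg deg p f) (g : List ι → K) : vectorField μ deg (seriesMul f g) =
      seriesMul (vectorField μ deg f) g + ksign K p • seriesMul f (vectorField μ deg g) := by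
  funext w
  rw [vectorField_mul, weight_of_hasDeg hf, seriesMul_smul_left]
  rfl

/-- If the letter dual to the unit has weight zero, the Dynkin operator is compatible with the
vector field of `unitConst`: every other letter is a constant of that field. -/
theorem dynkin_vectorField_unitConst {c : ι → K} (hc : c u = 0) (hu : deg u = 0) (f : List ι → K) :
    dynkin deg c (vectorField (unitConst K u) deg f) =
      vectorField (unitConst K u) deg (dynkin deg c f) := by
  classical
  have hμ := isGradedCommStructure_unitConst (K := K) hu
  refine LinearMap.congr_fun (IsFormal.ext
    (T := dynkin deg c ∘ₗ vectorField (unitConst K u) deg)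
    (T' := vectorField (unitConst K u) deg ∘ₗ dynkin deg c)
    ((isFormal_dynkin deg c).comp (isFormal_vectorField _ deg))
    ((isFormal_vectorField _ deg).comp (isFormal_dynkin deg c)) fun w => ?_) f
  simp only [LinearMap.comp_apply]
  have dl : HasDeg deg 1 (letter K u) := by simpa [hu] using hasDeg_letter (K := K) (deg := deg) u
  induction w with
  | nil =>
    have h1 : vectorField (unitConst K u) deg (Pi.single [] 1) = 0 := funext fun w =>
      vectorField_unitConst_eq_zero w _ fun v hv => by
        rw [Pi.single_apply, if_neg (List.ne_nil_of_mem hv)]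
    rw [h1, map_zero, dynkin_single]
    exact (map_zero _).symm
  | cons a w ih =>
    cases w with
    | nil =>
      rw [← letter_eq_single]
      by_cases ha : a = u
      · subst ha
        have h1 : dynkin deg c (letter K a) = 0 := by
          rw [letter_eq_single, dynkin_single, rightNormed, hc, zero_smul]
        rw [h1, vectorField_unitConst_letter hu, map_neg, map_zero, dynkin_letter_mul, h1, hc,
          zero_mul, zero_smul, add_zero, neg_eq_zero]
        exact (bracketRight deg (letter K a)).map_zero
      · rw [vectorField_unitConst_letter_of_ne ha, map_zero, letter_eq_single, dynkin_single,
          rightNormed, map_smul, vectorField_unitConst_letter_of_ne ha, smul_zero]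
    | cons b w =>
      set y : List ι → K := Pi.single (b :: w) 1 with hy
      have dy : HasDeg deg (wordDeg deg (b :: w)) y := hasDeg_single _
      have y0 : y [] = 0 := by rw [hy, Pi.single_apply, if_neg (List.cons_ne_nil b w).symm]
      have dP := hasDeg_dynkin c dy
      have da := hasDeg_letter (K := K) (deg := deg) a
      rw [← letter_mul_single, ← hy, vectorField_seriesMul _ da, map_add, map_smul,
        dynkin_letter_mul, dynkin_letter_mul, vectorField_nil, y0, ih, mul_zero, zero_smul,
        add_zero, add_zero, vectorField_bracket hμ, weight_of_hasDeg da]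
      congr 1
      · by_cases ha : a = u
        · subst ha
          rw [vectorField_unitConst_letter hu, seriesMul_neg_left, seriesMul_assoc, map_neg,
            dynkin_letter_mul, dynkin_letter_mul, seriesMul_nil, y0, mul_zero, mul_zero, mul_zero,
            zero_smul, add_zero, add_zero]
          have e : bracket deg (-seriesMul (letter K a) (letter K a)) (dynkin deg c y) =
              -bracket deg (seriesMul (letter K a) (letter K a)) (dynkin deg c y) :=
            (bracketLeft deg (dynkin deg c y)).map_neg _
          rw [e, neg_inj, bracket_of_hasDeg dl (hasDeg_bracket dl dP), bracket_of_hasDeg dl dP,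
            bracket_of_hasDeg (hasDeg_seriesMul dl dl) dP]
          simp only [seriesMul_sub_left, seriesMul_sub_right, seriesMul_smul_left,
            seriesMul_smul_right, seriesMul_assoc, one_mul, mul_add, add_mul, ksign_add, ksign_one]
          have hk := ksign_mul_self (K := K) (wordDeg deg (b :: w))
          funext v
          simp only [Pi.sub_apply, Pi.smul_apply, smul_eq_mul]
          ring
        · rw [vectorField_unitConst_letter_of_ne ha]
          have e1 : seriesMul 0 y = 0 := by simpa using seriesMul_smul_left (0 : K) 0 y
          rw [e1, map_zero]
          exact ((bracketLeft deg (dynkin deg c y)).map_zero).symm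
      · exact ((bracketLeft deg _).map_smul (ksign K (1 - deg a)) (letter K a)).symm

/-! ### Contraction of the powers of the letter dual to the unit -/

open Classical in
/-- Whether a word starts with an odd number of letters `u`. -/
noncomputable def oddLead (u : ι) : List ι → Bool
  | [] => false
  | b :: w => if b = u then !oddLead u w else false

theorem oddLead_self (w : List ι) : oddLead u (u :: w) = !oddLead u w := by simp [oddLead]

theorem oddLead_of_ne {b : ι} (hb : b ≠ u) (w : List ι) : oddLead u (b :: w) = false := by
  simp [oddLead, hb]

open Classical in
/-- The contracting homotopy for the vector field of `unitConst`: on words, the first block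
`u ^ (2 k)`, `k > 0`, is replaced by `- u ^ (2 k - 1)`, and words whose first block has odd length
are mapped to zero. -/
noncomputable def blockHomotopy (deg : ι → ℕ) (u : ι) : List ι → (List ι → K) → K
  | [], _ => 0
  | b :: w, f => if b = u then (if oddLead u (b :: w) then -f (u :: b :: w) else 0)
      else ksign K (1 - deg b) * blockHomotopy deg u w (fun v => f (b :: v))

theorem blockHomotopy_of_ne {b : ι} (hb : b ≠ u) (w : List ι) (f : List ι → K) :
    blockHomotopy deg u (b :: w) f =
      ksign K (1 - deg b) * blockHomotopy deg u w (fun v => f (b :: v)) := by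
  rw [blockHomotopy, if_neg hb]

theorem blockHomotopy_self (w : List ι) (f : List ι → K) : blockHomotopy deg u (u :: w) f =
    if oddLead u (u :: w) then -f (u :: u :: w) else 0 := by
  rw [blockHomotopy, if_pos rfl]

theorem blockHomotopy_smul (w : List ι) : ∀ (a : K) (f : List ι → K),
    blockHomotopy deg u w (fun v => a * f v) = a * blockHomotopy deg u w f := by
  induction w with
  | nil => intro a f; simp [blockHomotopy]
  | cons b w ih =>
    intro a f
    by_cases hb : b = u
    · subst hb
      rw [blockHomotopy_self, blockHomotopy_self]
      split_ifs <;> simp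
    · rw [blockHomotopy_of_ne hb, blockHomotopy_of_ne hb, ih]
      ring

/-- An even number of merges takes place inside a leading block of odd length, with alternating
signs. -/
theorem vectorField_unitConst_of_oddLead (hu : deg u = 0) (n : ℕ) : ∀ (w : List ι) (f : List ι → K),
    w.length ≤ n → oddLead u w = true → (∀ v, oddLead u v = true → f v = 0) →
    vectorField (unitConst K u) deg f w = 0 := by
  induction n using Nat.strong_induction_on with
  | _ n ih =>
    intro w f hn hw hf
    rcases w with _ | ⟨a, w⟩
    · rfl
    by_cases ha : a = u
    swap
    · rw [oddLead_of_ne ha] at hw; cases hw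
    subst ha
    rcases w with _ | ⟨b, w⟩
    · rfl
    by_cases hb : b = a
    · subst hb
      rw [oddLead_self, oddLead_self, Bool.not_not] at hw
      rcases w with _ | ⟨c, w⟩
      · cases hw
      have hc : c = b := by
        by_contra hc
        rw [oddLead_of_ne hc] at hw; cases hw
      subst hc
      rw [vectorField_unitConst_cons_cons hu, vectorField_unitConst_cons_cons hu,
        ih (n - 2) (by simp only [List.length_cons] at hn; omega) (c :: w) _
          (by simp only [List.length_cons] at hn ⊢; omega) hw]
      · ring
      · intro v hv
        exact hf _ (by rw [oddLead_self, oddLead_self, Bool.not_not, hv])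
    · rw [vectorField_unitConst_cons_cons_of_ne hu hb, vectorField_unitConst_cons_of_ne hb]
      have : (fun v => f (a :: b :: v)) = 0 := funext fun v =>
        hf _ (by rw [oddLead_self, oddLead_of_ne hb]; rfl)
      rw [this, map_zero]
      simp

/-- An odd number of merges takes place inside a leading block of even length, with alternating
signs. -/
theorem vectorField_unitConst_of_not_oddLead (hu : deg u = 0) (n : ℕ) :
    ∀ (w : List ι) (f : List ι → K), w.length ≤ n → oddLead u (u :: w) = false →
    (∀ v, oddLead u (u :: v) = false → f (u :: v) = 0) →
    vectorField (unitConst K u) deg f (u :: w) = -f w := by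
  induction n using Nat.strong_induction_on with
  | _ n ih =>
    intro w f hn hw hf
    rcases w with _ | ⟨b, w⟩
    · simp [oddLead] at hw
    have hb : b = u := by
      by_contra hb
      rw [oddLead_self, oddLead_of_ne hb] at hw; cases hw
    subst hb
    rw [vectorField_unitConst_cons_cons hu]
    rw [oddLead_self, oddLead_self, Bool.not_not] at hw
    have hf' : ∀ v, oddLead b v = false → f (b :: b :: v) = 0 := fun v hv =>
      hf (b :: v) (by rw [oddLead_self, oddLead_self, Bool.not_not, hv])
    rcases w with _ | ⟨c, w⟩
    · rw [vectorField_singleton, sub_zero]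
    by_cases hc : c = b
    · subst hc
      rw [vectorField_unitConst_cons_cons hu,
        ih (n - 2) (by simp only [List.length_cons] at hn; omega) w _
          (by simp only [List.length_cons] at hn ⊢; omega) hw fun v hv => hf' _ hv]
      ring
    · rw [vectorField_unitConst_cons_cons_of_ne hu hc, vectorField_unitConst_cons_of_ne hc]
      have : (fun v => f (b :: b :: c :: v)) = 0 := funext fun v => hf' _ (oddLead_of_ne hc v)
      rw [this, map_zero]
      simp

/-- The vector field `m₀` of `unitConst` is contractible on words containing `u`. -/
theorem blockHomotopy_identity (hu : deg u = 0) (w : List ι) : ∀ f : List ι → K, u ∈ w →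
    vectorField (unitConst K u) deg (fun v => blockHomotopy deg u v f) w +
      blockHomotopy deg u w (vectorField (unitConst K u) deg f) = f w := by
  induction w with
  | nil => intro f h; simp at h
  | cons b w ih =>
    intro f hw
    by_cases hb : b = u
    · subst hb
      rw [blockHomotopy_self]
      by_cases ho : oddLead b (b :: w) = true
      · rw [if_pos ho, vectorField_unitConst_cons_cons hu]
        have : vectorField (unitConst K b) deg
            ((fun v => blockHomotopy deg b v f) + fun v => f (b :: v)) (b :: w) = 0 := by
          refine vectorField_unitConst_of_oddLead hu _ _ _ le_rfl ho fun v hv => ?_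
          rcases v with _ | ⟨c, v⟩
          · cases hv
          have hc : c = b := by
            by_contra hc
            rw [oddLead_of_ne hc] at hv; cases hv
          subst hc
          rw [Pi.add_apply, blockHomotopy_self, if_pos hv, neg_add_cancel]
        rw [map_add, Pi.add_apply] at this
        linear_combination this
      · rw [if_neg ho, add_zero]
        rw [Bool.not_eq_true] at ho
        have ho' : oddLead b w = true := by rw [oddLead_self] at ho; simpa using ho
        rcases w with _ | ⟨c, w⟩
        · cases ho'
        have hc : c = b := by
          by_contra hc
          rw [oddLead_of_ne hc] at ho'; cases ho'
        subst hc
        rw [vectorField_unitConst_of_not_oddLead hu _ _ _ le_rfl ho fun v hv => by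
          rw [blockHomotopy_self, hv]; rfl, blockHomotopy_self, if_pos ho', neg_neg]
    · rw [vectorField_unitConst_cons_of_ne hb, blockHomotopy_of_ne hb]
      have h1 : (fun v => blockHomotopy deg u (b :: v) f) =
          ksign K (1 - deg b) • fun v => blockHomotopy deg u v (fun v => f (b :: v)) := by
        funext v; rw [blockHomotopy_of_ne hb]; rfl
      have h2 : (fun v => vectorField (unitConst K u) deg f (b :: v)) = fun v =>
          ksign K (1 - deg b) * vectorField (unitConst K u) deg (fun v => f (b :: v)) v := by
        funext v; rw [vectorField_unitConst_cons_of_ne hb]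
      rw [h1, h2, map_smul, blockHomotopy_smul, Pi.smul_apply, smul_eq_mul, ← mul_assoc,
        ← mul_assoc, ksign_mul_self, one_mul, one_mul]
      exact ih _ ((List.mem_cons.1 hw).resolve_left fun h => hb h.symm)

end UnitField

/-! ### The leading part of the differential on cyclic words -/

section Leading

variable {K : Type*} [CommRing K] {ι : Type*} {deg : ι → ℕ} {u : ι}

theorem tens_add_left (x x' y : List ι → K) : tens (x + x') y = tens x y + tens x' y :=
  (tensLeft y).map_add x x'

theorem tens_add_right (x y y' : List ι → K) : tens x (y + y') = tens x y + tens x y' :=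
  (tensRight x).map_add y y'

theorem tens_smul_left (a : K) (x y : List ι → K) : tens (a • x) y = a • tens x y :=
  (tensLeft y).map_smul a x

theorem tens_smul_right (a : K) (x y : List ι → K) : tens x (a • y) = a • tens x y :=
  (tensRight x).map_smul a y

theorem lieOperator_tens_of_hasDeg (μ : ι → ι → ι →₀ K) {p : ℤ} {x : List ι → K}
    (hx : HasDeg deg p x) (y : List ι → K) : lieOperator μ deg (tens x y) =
      tens (vectorField μ deg x) y + ksign K p • tens x (vectorField μ deg y) := by
  rw [lieOperator_tens, weight_of_hasDeg hx, tens_smul_left]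

theorem rotateFirst_lieOperator_letter (hu : deg u = 0) {q : ℤ} {y : List ι → K}
    (hy : HasDeg deg q y) {a : ι} (ha : a ≠ u) (b : ι) (r : List ι) :
    rotateFirst K deg (lieOperator (unitConst K u) deg (tens (letter K b) y)) (a :: r) =
      vectorField (unitConst K u) deg (rotateFirst K deg (tens (letter K b) y)) (a :: r) := by
  have dl : HasDeg deg 1 (letter K u) := by simpa [hu] using hasDeg_letter (K := K) (deg := deg) u
  have h0 : rotateFirst K deg (tens (vectorField (unitConst K u) deg (letter K b)) y) (a :: r) =
      0 := by
    by_cases hb : b = u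
    · subst hb
      rw [vectorField_unitConst_letter hu, ← neg_one_smul K, tens_smul_left, map_smul,
        rotateFirst_mul_of_hasDeg dl dl hy, Pi.smul_apply, Pi.add_apply, Pi.smul_apply,
        rotateFirst_letter, rotateFirst_letter]
      simp [letter, ha]
    · rw [vectorField_unitConst_letter_of_ne hb, show tens 0 y = 0 from (tensLeft y).map_zero,
        map_zero]
      rfl
  have h1 : (fun v => rotateFirst K deg (tens (letter K b) y) (a :: v)) =
      letter K b [a] • y := funext fun v => rotateFirst_letter b a y v
  rw [lieOperator_tens_of_hasDeg _ (hasDeg_letter b), map_add, map_smul, Pi.add_apply, h0, zero_add,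
    Pi.smul_apply, rotateFirst_letter, vectorField_unitConst_cons_of_ne ha, h1, map_smul]
  simp only [Pi.smul_apply, smul_eq_mul]
  by_cases hab : a = b
  · rw [hab]
  · simp [letter, hab]

/-- Rotation to a letter different from `u`, a constant of the vector field of `unitConst`, commutes
with that field. The induction moves the letters of the first factor to the second. -/
theorem rotateFirst_lieOperator (hu : deg u = 0) {a : ι} (ha : a ≠ u)
    (F : List ι × List ι → K) (r : List ι) :
    rotateFirst K deg (lieOperator (unitConst K u) deg F) (a :: r) =
      vectorField (unitConst K u) deg (rotateFirst K deg F) (a :: r) := by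
  classical
  let T : (List ι → K) →ₗ[K] (List ι → K) :=
    { toFun := fun g r => g (a :: r), map_add' := fun _ _ => rfl, map_smul' := fun _ _ => rfl }
  have hT : IsFormal T := fun r => FormalAt.eval (a :: r)
  have key : ∀ (w : List ι) (q : ℤ) (y : List ι → K), HasDeg deg q y →
      T (rotateFirst K deg (lieOperator (unitConst K u) deg (tens (Pi.single w 1) y))) =
        T (vectorField (unitConst K u) deg (rotateFirst K deg (tens (Pi.single w 1) y))) := by
    intro w
    induction w with
    | nil =>
      intro q y _
      have h0 : ∀ z : List ι → K, rotateFirst K deg (tens (Pi.single [] 1) z) = 0 := by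
        intro z
        funext v
        cases v with
        | nil => rfl
        | cons b v =>
          rw [rotateFirst_cons]
          refine splitSum_eq_zero fun q s _ => ?_
          rw [splitSum_eq_zero, mul_zero]
          intro t s' _
          simp [tens]
      have h1 : vectorField (unitConst K u) deg (Pi.single [] 1) = 0 := funext fun w =>
        vectorField_unitConst_eq_zero w _ fun v hv => by
          rw [Pi.single_apply, if_neg (List.ne_nil_of_mem hv)]
      rw [lieOperator_tens_of_hasDeg _ (hasDeg_single _), h1,
        show tens 0 y = 0 from (tensLeft y).map_zero, zero_add, map_smul, h0, h0, map_zero, smul_zero]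
    | cons b w ih =>
      intro q y hy
      have hμ := isGradedCommStructure_unitConst (K := K) hu
      set X : List ι → K := Pi.single w 1
      have dX : HasDeg deg (wordDeg deg w) X := hasDeg_single w
      have db := hasDeg_letter (K := K) (deg := deg) b
      have e1 := ih _ _ (hasDeg_seriesMul hy db)
      have e2 : T (rotateFirst K deg (lieOperator (unitConst K u) deg
          (tens (letter K b) (seriesMul X y)))) = T (vectorField (unitConst K u) deg
          (rotateFirst K deg (tens (letter K b) (seriesMul X y)))) := funext fun r =>
        rotateFirst_lieOperator_letter hu (hasDeg_seriesMul dX hy) ha b r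
      rw [← letter_mul_single, rotateFirst_mul_of_hasDeg db dX hy, map_add, map_smul, map_add,
        map_smul, ← e1, ← e2, lieOperator_tens_of_hasDeg _ (hasDeg_seriesMul db dX),
        lieOperator_tens_of_hasDeg _ db, lieOperator_tens_of_hasDeg _ dX,
        vectorField_seriesMul _ db, vectorField_seriesMul _ dX, vectorField_seriesMul _ hy]
      simp only [tens_add_left, tens_add_right, tens_smul_left, tens_smul_right, map_add, map_smul]
      have d1 := hasDeg_vectorField hμ db
      have d2 := hasDeg_vectorField hμ dX
      have d3 := hasDeg_vectorField hμ hy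
      rw [rotateFirst_mul_of_hasDeg d1 dX hy, rotateFirst_mul_of_hasDeg db d2 hy,
        rotateFirst_mul_of_hasDeg db dX d3]
      simp only [map_add, map_smul, smul_add, smul_smul, ← ksign_add]
      generalize wordDeg deg w = n
      generalize 1 - (deg b : ℤ) = m
      have s1 : ksign K ((m + 1) * (n + q)) = ksign K (m * (n + q) + (n + q)) := by
        congr 1; ring
      have s2 : ksign K (m + m * (n + 1 + q)) = ksign K (m * (n + q)) := by
        rw [show m + m * (n + 1 + q) = m * (n + q) + (m + m) by ring, ksign_add _ (m + m),
          ksign_even ⟨m, rfl⟩, mul_one]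
      have s3 : ksign K (m + n + m * (n + (q + 1))) = ksign K (m * (n + q) + n) := by
        rw [show m + n + m * (n + (q + 1)) = m * (n + q) + n + (m + m) by ring,
          ksign_add _ (m + m), ksign_even ⟨m, rfl⟩, mul_one]
      rw [s1, s2, s3]
      abel
  have := IsFormal.ext (T := T ∘ₗ rotateFirst K deg ∘ₗ lieOperator (unitConst K u) deg)
    (T' := T ∘ₗ vectorField (unitConst K u) deg ∘ₗ rotateFirst K deg)
    (hT.comp ((isFormal_rotateFirst deg).comp (isFormal_lieOperator _ deg)))
    (hT.comp ((isFormal_vectorField _ deg).comp (isFormal_rotateFirst deg))) fun p => by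
      have e : (Pi.single p 1 : List ι × List ι → K) = tens (Pi.single p.1 1) (Pi.single p.2 1) := by
        funext p'
        by_cases h1 : p'.1 = p.1
        · by_cases h2 : p'.2 = p.2
          · rw [show p' = p from Prod.ext h1 h2]; simp [tens]
          · rw [Pi.single_eq_of_ne fun h => h2 (congrArg Prod.snd h)]; simp [tens, h2]
        · rw [Pi.single_eq_of_ne fun h => h1 (congrArg Prod.fst h)]; simp [tens, h1]
      simp only [LinearMap.comp_apply, e]
      exact key p.1 _ _ (hasDeg_single p.2)
  exact congrFun (LinearMap.congr_fun this F) r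

theorem cyclicForm_lieOperator (hu : deg u = 0) {a : ι} (ha : a ≠ u)
    (F : List ι × List ι → K) (r : List ι) :
    cyclicForm K deg (lieOperator (unitConst K u) deg F) (a :: r) =
      vectorField (unitConst K u) deg (cyclicForm K deg F) (a :: r) := by
  rw [cyclicForm_apply, cyclicForm_apply, ← lieOperator_swapTensor
    (isGradedCommStructure_unitConst hu), map_add, Pi.add_apply, Pi.add_apply,
    rotateFirst_lieOperator hu ha, rotateFirst_lieOperator hu ha]

/-- An infinite sum `∑ a ⊗ y_a` with Lie series `y_a` is a Lie `0`-form. -/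
theorem mem_lieTensor_of_singletons {F : List ι × List ι → K} (hF : ∀ p, F p ≠ 0 → ∃ a, p.1 = [a])
    (hL : ∀ a, (fun v => F ([a], v)) ∈ freeLie K deg Set.univ) :
    F ∈ lieTensor K deg Set.univ := by
  classical
  refine formalClosure_idem _ fun s => ?_
  refine ⟨∑ a ∈ s.biUnion fun p => p.1.toFinset, tens (letter K a) (fun v => F ([a], v)),
    Submodule.sum_mem _ fun a _ => tens_mem
      (IsLetterMonomial.letter (K := K) (deg := deg) a (Set.mem_univ a)).mem (hL a), ?_⟩
  rintro ⟨w, v⟩ hp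
  rw [Finset.sum_apply]
  by_cases hw : ∃ a, w = [a]
  · obtain ⟨a, rfl⟩ := hw
    rw [Finset.sum_eq_single a]
    · simp [tens, letter]
    · intro b _ hb
      simp [tens, letter, Ne.symm hb]
    · intro h
      exact absurd (Finset.mem_biUnion.2 ⟨_, hp, by simp⟩) h
  · rw [Finset.sum_eq_zero]
    · by_contra h
      exact hw (hF _ (Ne.symm h))
    · intro a _
      have : letter K a w = 0 := by
        simp only [letter, ite_eq_right_iff]
        exact fun h => absurd ⟨a, h⟩ hw
      simp [tens, this]

/-- The weighted sum of the `a ⊗ y_a`, where `y_a` is the value of the Dynkin operator on `g_a`,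
for a series `g = ∑ a g_a`. -/
noncomputable def markBoth (deg : ι → ℕ) (c : ι → K) (g : List ι → K) : List ι × List ι → K :=
  fun p => match p.1 with
    | [a] => c a * dynkin deg c (fun r => g (a :: r)) p.2
    | _ => 0

theorem markBoth_support (c : ι → K) (g : List ι → K) (p : List ι × List ι)
    (h : markBoth deg c g p ≠ 0) : ∃ a, p.1 = [a] := by
  rcases p with ⟨_ | ⟨a, _ | ⟨b, w⟩⟩, v⟩
  · exact absurd rfl h
  · exact ⟨a, rfl⟩
  · exact absurd rfl h

theorem markBoth_mem (c : ι → K) (g : List ι → K) :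
    markBoth deg c g ∈ lieTensor K deg Set.univ :=
  mem_lieTensor_of_singletons (markBoth_support c g) fun a =>
    Submodule.smul_mem _ (c a) (dynkin_mem c fun r => g (a :: r))

/-- For tensors of the form `∑ a ⊗ y_a` with all `a` different from the letter dual to the unit,
the leading part of the differential acts on the second factor only. -/
theorem lieOperator_unitConst_of_singletons {F : List ι × List ι → K}
    (hF : ∀ p, F p ≠ 0 → ∃ a, a ≠ u ∧ p.1 = [a]) (w v : List ι) :
    lieOperator (unitConst K u) deg F (w, v) =
      ksign K (wordDeg deg w) * vectorField (unitConst K u) deg (fun v => F (w, v)) v := by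
  change vectorField (unitConst K u) deg (fun t => F (t, v)) w + _ = _
  rw [vectorField_unitConst_eq_zero, zero_add]
  intro t ht
  by_contra h
  obtain ⟨a, ha, e⟩ := hF _ h
  simp only at e
  rw [e, List.mem_singleton] at ht
  exact ha ht.symm

theorem lieOperator_markBoth {c : ι → K} (hc : c u = 0) (hu : deg u = 0) (g : List ι → K) :
    lieOperator (unitConst K u) deg (markBoth deg c g) =
      markBoth deg c (vectorField (unitConst K u) deg g) := by
  funext ⟨w, v⟩
  rw [lieOperator_unitConst_of_singletons]
  · rcases w with _ | ⟨a, _ | ⟨b, w⟩⟩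
    · change _ * vectorField _ deg 0 v = 0
      rw [map_zero, Pi.zero_apply, mul_zero]
    · by_cases ha : a = u
      · subst ha
        have : (fun v => markBoth deg c g ([a], v)) = 0 := by
          funext v; simp [markBoth, hc]
        rw [this, map_zero, Pi.zero_apply, mul_zero]
        simp [markBoth, hc]
      · have e1 : (fun v => markBoth deg c g ([a], v)) =
            c a • dynkin deg c (fun r => g (a :: r)) := rfl
        have e2 : (fun r => vectorField (unitConst K u) deg g (a :: r)) =
            ksign K (1 - deg a) • vectorField (unitConst K u) deg (fun r => g (a :: r)) :=
          funext fun r => vectorField_unitConst_cons_of_ne ha g r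
        change _ = c a * dynkin deg c (fun r => vectorField (unitConst K u) deg g (a :: r)) v
        rw [e1, e2, map_smul, map_smul, dynkin_vectorField_unitConst hc hu]
        simp only [Pi.smul_apply, smul_eq_mul, wordDeg, List.map_cons, List.map_nil, List.sum_cons,
          List.sum_nil, add_zero]
        ring
    · change _ * vectorField _ deg 0 v = 0
      rw [map_zero, Pi.zero_apply, mul_zero]
  · intro p hp
    obtain ⟨a, ha⟩ := markBoth_support c g p hp
    refine ⟨a, fun h => hp ?_, ha⟩
    obtain ⟨w, v⟩ := p
    simp only at ha
    subst ha; subst h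
    simp [markBoth, hc]

end Leading

/-! ### The differential squares to zero -/

section Square

variable {K : Type*} [CommRing K] {ι : Type*} {deg : ι → ℕ}

/-- Associativity of the multiplication with the given structure constants. -/
def IsAssocStructure (μ : ι → ι → ι →₀ K) : Prop :=
  ∀ i j k c, ((μ i j).sum fun e r => r * μ e k c) = (μ j k).sum fun e r => r * μ i e c

theorem IsAssocStructure.sum_eq {μ : ι → ι → ι →₀ K} (h : IsAssocStructure μ) (i j k : ι)
    (g : ι → K) : ((μ i j).sum fun e r => r * (μ e k).sum fun c r' => r' * g c) =
      (μ j k).sum fun e r => r * (μ i e).sum fun c r' => r' * g c := by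
  have key : ∀ (a : ι →₀ K) (b : ι → ι →₀ K),
      (a.sum fun e r => r * (b e).sum fun c r' => r' * g c) =
      (a.sum fun e r => r • b e).sum fun c r' => r' * g c := by
    intro a b
    rw [Finsupp.sum_sum_index (by simp) (by intros; ring)]
    refine Finsupp.sum_congr fun e _ => ?_
    rw [Finsupp.sum_smul_index (by simp), Finsupp.mul_sum]
    simp only [mul_assoc]
  rw [key, key]
  congr 1
  ext c
  simpa [Finsupp.sum_apply, Finsupp.sum] using h i j k c

/-- `m² = 0`: overlapping merges cancel by associativity, disjoint ones by the sign rule. -/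
theorem vectorField_vectorField {μ : ι → ι → ι →₀ K} (hμ : IsGradedCommStructure μ deg)
    (ha : IsAssocStructure μ) (w : List ι) :
    ∀ f, vectorField μ deg (vectorField μ deg f) w = 0 := by
  classical
  induction w with
  | nil => intro f; rfl
  | cons i w ih =>
    intro f
    have e1 : (fun v => vectorField μ deg f (i :: v)) = headMerge μ deg i f +
        ksign K (1 - deg i) • vectorField μ deg (fun v => f (i :: v)) := funext fun v =>
      vectorField_cons μ deg f i v
    rw [vectorField_cons, e1, map_add, map_smul, Pi.add_apply, Pi.smul_apply, ih, smul_zero,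
      add_zero]
    rcases w with _ | ⟨j, w⟩
    · simp [headMerge, vectorField_nil]
    have e2 : (fun v => headMerge μ deg i f (j :: v)) =
        ∑ e ∈ (μ i j).support, (ksign K (deg i) * μ i j e) • fun v => f (e :: v) := by
      funext v
      simp only [headMerge, Finsupp.sum, Finset.mul_sum, Finset.sum_apply, Pi.smul_apply,
        smul_eq_mul, mul_assoc]
    have e3 : headMerge μ deg i (vectorField μ deg f) (j :: w) =
        ksign K (deg i) * ((μ i j).sum fun e r => r * headMerge μ deg e f w) +
        ∑ e ∈ (μ i j).support, (ksign K (deg i) * μ i j e * ksign K (1 - deg i - deg j)) *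
          vectorField μ deg (fun v => f (e :: v)) w := by
      rw [headMerge]
      simp only [vectorField_cons, mul_add, Finsupp.sum, Finset.sum_add_distrib, Finset.mul_sum]
      congr 1
      refine Finset.sum_congr rfl fun e he => ?_
      rw [hμ.deg_eq i j e (Finsupp.mem_support_iff.1 he), Nat.cast_add, ← sub_sub]
      ring
    rw [e3, vectorField_cons, e2, map_sum, Finset.sum_apply]
    simp only [map_smul, Pi.smul_apply, smul_eq_mul]
    have e4 : headMerge μ deg j (headMerge μ deg i f) w * ksign K (1 - deg i) +
        ksign K (deg i) * ((μ i j).sum fun e r => r * headMerge μ deg e f w) = 0 := by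
      rcases w with _ | ⟨k, w⟩
      · simp [headMerge]
      simp only [headMerge]
      have h1 : ((μ j k).sum fun c r => r * (ksign K (deg i) *
          (μ i c).sum fun c' r' => r' * f (c' :: w))) = ksign K (deg i) *
          (μ j k).sum fun c r => r * (μ i c).sum fun c' r' => r' * f (c' :: w) := by
        rw [Finsupp.mul_sum]
        exact Finsupp.sum_congr fun _ _ => by ring
      have h2 : ((μ i j).sum fun e r => r * (ksign K (deg e) *
          (μ e k).sum fun c r' => r' * f (c :: w))) = ksign K (deg i) * ksign K (deg j) *
          (μ i j).sum fun e r => r * (μ e k).sum fun c r' => r' * f (c :: w) := by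
        rw [Finsupp.mul_sum]
        refine Finsupp.sum_congr fun e he => ?_
        rw [hμ.deg_eq i j e (Finsupp.mem_support_iff.1 he), Nat.cast_add, ksign_add]
        ring
      rw [h1, h2, ha.sum_eq i j k, ksign_sub, ksign_one]
      have hk := ksign_mul_self (K := K) (deg i)
      ring
    have e5 : ksign K (1 - deg i) * (ksign K (1 - deg j) *
        ∑ e ∈ (μ i j).support, ksign K (deg i) * μ i j e *
          vectorField μ deg (fun v => f (e :: v)) w) +
        ∑ e ∈ (μ i j).support, (ksign K (deg i) * μ i j e * ksign K (1 - deg i - deg j)) *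
          vectorField μ deg (fun v => f (e :: v)) w = 0 := by
      rw [Finset.mul_sum, Finset.mul_sum, ← Finset.sum_add_distrib]
      refine Finset.sum_eq_zero fun e _ => ?_
      simp only [ksign_sub, ksign_one]
      ring
    linear_combination e4 + e5

theorem lieOperator_lieOperator {μ : ι → ι → ι →₀ K} (hμ : IsGradedCommStructure μ deg)
    (ha : IsAssocStructure μ) {S : Set ι} {F : List ι × List ι → K} (hF : F ∈ lieTensor K deg S) :
    lieOperator μ deg (lieOperator μ deg F) = 0 := by
  have hz : ∀ f, vectorField μ deg (vectorField μ deg f) = 0 := fun f => funext fun w =>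
    vectorField_vectorField hμ ha w f
  refine eq_zero_of_mem_formalClosure_bot (lieTensor_induction
    (T := lieOperator μ deg ∘ₗ lieOperator μ deg)
    ((isFormal_lieOperator μ deg).comp (isFormal_lieOperator μ deg)) ?_ F hF)
  intro s x t y hx hy
  have dx := hx.hasDeg
  rw [LinearMap.comp_apply, lieOperator_tens_of_hasDeg _ dx, map_add, map_smul,
    lieOperator_tens_of_hasDeg _ dx, lieOperator_tens_of_hasDeg _ (hasDeg_vectorField hμ dx), hz, hz,
    show tens 0 y = 0 from (tensLeft y).map_zero, show tens x 0 = 0 from (tensRight x).map_zero,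
    ksign_add, ksign_one]
  simp

end Square

/-! ### Splitting off the letter dual to the unit -/

section Splitting

variable {K : Type*} [CommRing K] {ι : Type*} {deg : ι → ℕ} {u : ι}

open Classical in
/-- The structure constants of the products of basis elements different from the unit. -/
noncomputable def reducedConst (u : ι) (μ : ι → ι → ι →₀ K) (i j : ι) : ι →₀ K :=
  if i ≠ u ∧ j ≠ u then μ i j else 0

theorem reducedConst_of_ne {μ : ι → ι → ι →₀ K} {i j : ι} (hi : i ≠ u) (hj : j ≠ u) :
    reducedConst u μ i j = μ i j := by simp [reducedConst, hi, hj]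

theorem reducedConst_left {μ : ι → ι → ι →₀ K} (j : ι) : reducedConst u μ u j = 0 := by
  simp [reducedConst]

theorem reducedConst_right {μ : ι → ι → ι →₀ K} (i : ι) : reducedConst u μ i u = 0 := by
  simp [reducedConst]

/-- The basis element with index `u` is a unit for the multiplication. -/
structure IsUnitIndex (μ : ι → ι → ι →₀ K) (u : ι) : Prop where
  left : ∀ j, μ u j = Finsupp.single j 1
  right : ∀ i, μ i u = Finsupp.single i 1

/-- `m = [t u, ·] + m₀ + m₁`, where `m₀` and `m₁` are the vector fields of `unitConst` and
`reducedConst`. The merges with an interior letter `t u` on its left and on its right cancel, and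
only those at the two ends of a word survive. -/
theorem vectorField_eq_split {μ : ι → ι → ι →₀ K} (hu : deg u = 0) (h : IsUnitIndex μ u)
    (w : List ι) : ∀ f : List ι → K, vectorField μ deg f w =
      bracket deg (letter K u) f w + vectorField (unitConst K u) deg f w +
        vectorField (reducedConst u μ) deg f w := by
  classical
  have hb : ∀ (w : List ι) (f : List ι → K), bracket deg (letter K u) f w =
      seriesMul (letter K u) f w -
        splitSum w fun x y => ksign K (wordDeg deg x) * (f x * letter K u y) := by
    intro w f
    rw [bracket_eq_splitSum, seriesMul_eq_splitSum, sub_eq_add_neg, ← neg_one_mul, mul_splitSum,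
      ← splitSum_add]
    refine splitSum_congr fun x y _ => ?_
    by_cases hy : y = [u]
    · subst hy
      simp [wordDeg, hu, sub_eq_add_neg]
    · simp [letter, hy]
  have hA : ∀ (b : ι) (w : List ι) (f : List ι → K), seriesMul (letter K u) f (b :: w) =
      if b = u then f w else 0 := by
    intro b w f
    rw [seriesMul_cons, seriesMul_eq_splitSum, splitSum_left_nil]
    · by_cases h : b = u <;> simp [letter, h]
    · intro i x y; simp [letter]
  simp only [hb]
  induction w with
  | nil => intro f; simp [vectorField_nil, splitSum_nil, seriesMul_nil, letter]
  | cons b w ih =>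
    intro f
    have hs : splitSum w (fun x y => ksign K (wordDeg deg (b :: x)) * (f (b :: x) * letter K u y)) =
        ksign K (1 - deg b) *
          splitSum w fun x y => ksign K (wordDeg deg x) * (f (b :: x) * letter K u y) := by
      rw [mul_splitSum]
      exact splitSum_congr fun x y _ => by rw [wordDeg_cons, ksign_add, mul_assoc]
    rw [vectorField_cons, vectorField_cons, vectorField_cons, ih, hA, splitSum_cons, hs]
    suffices h0 : headMerge μ deg b f w + ksign K (1 - deg b) *
        seriesMul (letter K u) (fun v => f (b :: v)) w =
        (if b = u then f w else 0) - f [] * letter K u (b :: w) +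
          headMerge (unitConst K u) deg b f w + headMerge (reducedConst u μ) deg b f w by
      simp only [show wordDeg deg ([] : List ι) = 0 from rfl, ksign_zero, one_mul]
      linear_combination h0
    rcases w with _ | ⟨j, w⟩
    · by_cases h : b = u <;> simp [headMerge, seriesMul_nil, letter, h]
    rw [hA]
    simp only [headMerge]
    by_cases hbu : b = u
    · subst hbu
      rw [h.left, Finsupp.sum_single_index (by simp), reducedConst_left, Finsupp.sum_zero_index]
      by_cases hj : j = b
      · subst hj
        rw [unitConst_self, ← Finsupp.single_neg, Finsupp.sum_single_index (by simp)]
        simp [letter, hu, ksign_zero, ksign_one]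
      · rw [unitConst_right hj]
        simp [letter, hu, ksign_zero, hj]
    · rw [unitConst_left hbu]
      by_cases hj : j = u
      · subst hj
        rw [h.right, Finsupp.sum_single_index (by simp), reducedConst_right, ksign_sub, ksign_one]
        simp [letter, hbu]
      · rw [reducedConst_of_ne hbu hj]
        simp [letter, hbu, hj]

/-- The inner derivation `[t u, ·]` acts trivially on Lie `0`-forms, so the differential is induced
by `m₀ + m₁`. -/
theorem lieOperator_sub_mem {μ : ι → ι → ι →₀ K} (hu : deg u = 0) (h : IsUnitIndex μ u)
    {F : List ι × List ι → K} (hF : F ∈ lieTensor K deg Set.univ) :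
    lieOperator μ deg F - (lieOperator (unitConst K u) deg F +
      lieOperator (reducedConst u μ) deg F) ∈ lieRelations K deg Set.univ := by
  refine lieTensor_induction (T := lieOperator μ deg - (lieOperator (unitConst K u) deg +
    lieOperator (reducedConst u μ) deg)) ((isFormal_lieOperator μ deg).sub
      ((isFormal_lieOperator _ deg).add (isFormal_lieOperator _ deg))) ?_ F hF
  intro s x t y hx hy
  change (lieOperator μ deg - (lieOperator (unitConst K u) deg +
    lieOperator (reducedConst u μ) deg)) (tens x y) ∈ lieRelations K deg Set.univ
  have dl : HasDeg deg 1 (letter K u) := by simpa [hu] using hasDeg_letter (K := K) (deg := deg) u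
  have dx := hx.hasDeg
  have e : ∀ f, vectorField μ deg f = bracket deg (letter K u) f +
      vectorField (unitConst K u) deg f + vectorField (reducedConst u μ) deg f := fun f =>
    funext fun w => vectorField_eq_split hu h w f
  have r := bracket_rel_mem hx.mem (IsLetterMonomial.letter (K := K) (deg := deg) u
    (Set.mem_univ u)).mem hy.mem
  have hr := Submodule.smul_mem _ (-ksign K (contentDeg deg s)) r
  have hk := ksign_mul_self (K := K) (contentDeg deg s)
  convert hr using 1
  rw [LinearMap.sub_apply, LinearMap.add_apply, lieOperator_tens_of_hasDeg _ dx,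
    lieOperator_tens_of_hasDeg _ dx, lieOperator_tens_of_hasDeg _ dx, e x, e y,
    bracket_of_hasDeg dl dx, bracket_of_hasDeg dx dl]
  funext p
  simp only [tens, Pi.add_apply, Pi.sub_apply, Pi.smul_apply, smul_eq_mul, mul_one, one_mul]
  linear_combination -(seriesMul (letter K u) x p.1 * y p.2) * hk

/-- The differential replaces one letter `c` by two letters `i`, `j` such that `x c` occurs in
`x i * x j`. -/
theorem vectorField_support {μ : ι → ι → ι →₀ K} (w : List ι) : ∀ {f : List ι → K},
    vectorField μ deg f w ≠ 0 → ∃ v, f v ≠ 0 ∧ ∃ i j c s, μ i j c ≠ 0 ∧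
      (v : Multiset ι) = c ::ₘ s ∧ (w : Multiset ι) = i ::ₘ j ::ₘ s := by
  induction w with
  | nil => intro f h; exact absurd rfl h
  | cons b w ih =>
    intro f h
    rw [vectorField_cons] at h
    by_cases h1 : headMerge μ deg b f w = 0
    · rw [h1, zero_add] at h
      obtain ⟨v, hv, i, j, c, s, hc, e, e'⟩ := ih (right_ne_zero_of_mul h)
      refine ⟨b :: v, hv, i, j, c, b ::ₘ s, hc, ?_, ?_⟩
      · rw [← Multiset.cons_coe, e, Multiset.cons_swap]
      · rw [← Multiset.cons_coe, e', Multiset.cons_swap b i, Multiset.cons_swap b j]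
    · rcases w with _ | ⟨j, w⟩
      · exact absurd rfl h1
      obtain ⟨c, hc, hne⟩ := Finset.exists_ne_zero_of_sum_ne_zero (right_ne_zero_of_mul h1)
      exact ⟨c :: w, right_ne_zero_of_mul hne, b, j, c, w, left_ne_zero_of_mul hne, rfl, rfl⟩

theorem lieOperator_support {μ : ι → ι → ι →₀ K} {F : List ι × List ι → K}
    {p : List ι × List ι} (h : lieOperator μ deg F p ≠ 0) :
    ∃ p', F p' ≠ 0 ∧ ∃ i j c s, μ i j c ≠ 0 ∧ (p'.1 + p'.2 : Multiset ι) = c ::ₘ s ∧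
      (p.1 + p.2 : Multiset ι) = i ::ₘ j ::ₘ s := by
  by_cases h1 : vectorField μ deg (fun u => F (u, p.2)) p.1 = 0
  · have h2 : vectorField μ deg (fun v => F (p.1, v)) p.2 ≠ 0 := fun h2 => h (by
      change _ + _ = (0 : K)
      rw [h1, h2, mul_zero, add_zero])
    obtain ⟨v, hv, i, j, c, s, hc, e, e'⟩ := vectorField_support _ h2
    refine ⟨(p.1, v), hv, i, j, c, p.1 + s, hc, ?_, ?_⟩
    · rw [e, Multiset.add_cons]
    · rw [e', Multiset.add_cons, Multiset.add_cons]
  · obtain ⟨v, hv, i, j, c, s, hc, e, e'⟩ := vectorField_support _ h1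
    refine ⟨(v, p.2), hv, i, j, c, s + p.2, hc, ?_, ?_⟩
    · rw [e, Multiset.cons_add]
    · rw [e', Multiset.cons_add, Multiset.cons_add]

theorem eq_of_unitConst_ne_zero {i j c : ι} (h : unitConst K u i j c ≠ 0) :
    i = u ∧ j = u ∧ c = u := by
  by_cases hi : i = u
  · by_cases hj : j = u
    · refine ⟨hi, hj, ?_⟩
      rw [hi, hj, unitConst_self] at h
      by_contra hc
      exact h (by simp [Ne.symm hc])
    · exact absurd (by rw [unitConst_right hj]; rfl) h
  · exact absurd (by rw [unitConst_left hi]; rfl) h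

theorem ne_of_reducedConst_ne_zero {μ : ι → ι → ι →₀ K} {i j c : ι}
    (h : reducedConst u μ i j c ≠ 0) : i ≠ u ∧ j ≠ u ∧ μ i j c ≠ 0 := by
  by_cases hi : i = u
  · exact absurd (by rw [hi, reducedConst_left]; rfl) h
  · by_cases hj : j = u
    · exact absurd (by rw [hj, reducedConst_right]; rfl) h
    · rw [reducedConst_of_ne hi hj] at h
      exact ⟨hi, hj, h⟩

theorem isGradedCommStructure_reducedConst {μ : ι → ι → ι →₀ K}
    (hμ : IsGradedCommStructure μ deg) : IsGradedCommStructure (reducedConst u μ) deg where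
  deg_eq i j c h := hμ.deg_eq i j c (ne_of_reducedConst_ne_zero h).2.2
  comm i j c := by
    by_cases hi : i = u
    · subst hi; simp [reducedConst_left, reducedConst_right]
    · by_cases hj : j = u
      · subst hj; simp [reducedConst_left, reducedConst_right]
      · rw [reducedConst_of_ne hi hj, reducedConst_of_ne hj hi, hμ.comm]

/-- The leading part of the differential adds one letter `u`. -/
theorem restrictContent_lieOperator_unitConst (A : Multiset ι → Prop) (F : List ι × List ι → K) :
    restrictContent K A (lieOperator (unitConst K u) deg F) =
      lieOperator (unitConst K u) deg (restrictContent K (fun s => A (u ::ₘ s)) F) := by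
  classical
  funext p
  have key : ∀ G : List ι × List ι → K, (∀ p' : List ι × List ι,
      u ::ₘ (p'.1 + p'.2 : Multiset ι) = (p.1 + p.2 : Multiset ι) → G p' = 0) →
      lieOperator (unitConst K u) deg G p = 0 := by
    intro G hG
    by_contra h
    obtain ⟨p', hp', i, j, c, s, hc, e, e'⟩ := lieOperator_support h
    obtain ⟨rfl, rfl, rfl⟩ := eq_of_unitConst_ne_zero hc
    exact hp' (hG p' (by rw [e, e']))
  rw [restrictContent_apply]
  split_ifs with h
  · rw [← sub_eq_zero, ← Pi.sub_apply, ← map_sub]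
    refine key _ fun p' hp' => ?_
    rw [Pi.sub_apply, restrictContent_apply, if_pos (by rw [hp']; exact h), sub_self]
  · refine (key _ fun p' hp' => ?_).symm
    rw [restrictContent_apply, if_neg (by rw [hp']; exact h)]

end Splitting

/-! ### Exactness of the leading part of the differential -/

section Exactness

variable {K : Type*} [CommRing K] {ι : Type*} {deg : ι → ℕ} {u : ι}

open Classical in
/-- The weight counting the letters different from `u`. -/
noncomputable def neWeight (K : Type*) [CommRing K] (u a : ι) : K := if a = u then 0 else 1

open Classical in
/-- The number of letters different from `u`. -/
noncomputable def neCount (u : ι) (s : Multiset ι) : ℕ := s.countP (· ≠ u)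

theorem neCount_cons_self (s : Multiset ι) : neCount u (u ::ₘ s) = neCount u s := by
  classical
  simp [neCount]

theorem neCount_cons_of_ne {a : ι} (ha : a ≠ u) (s : Multiset ι) :
    neCount u (a ::ₘ s) = neCount u s + 1 := by
  classical
  simp [neCount, ha]

theorem neCount_zero : neCount u (0 : Multiset ι) = 0 := by simp [neCount]

theorem contentWeight_neWeight (s : Multiset ι) :
    contentWeight (neWeight K u) s = (neCount u s : K) := by
  induction s using Multiset.induction_on with
  | empty => simp [contentWeight, neCount_zero]
  | cons a s ih =>
    have : contentWeight (neWeight K u) (a ::ₘ s) =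
        neWeight K u a + contentWeight (neWeight K u) s := by simp [contentWeight]
    rw [this, ih]
    by_cases ha : a = u
    · subst ha; simp [neCount_cons_self, neWeight]
    · simp [neCount_cons_of_ne ha, neWeight, ha, add_comm]

theorem eq_replicate_of_neCount_eq_zero {w : List ι} (h : neCount u (w : Multiset ι) = 0) :
    w = List.replicate w.length u := by
  classical
  rw [neCount, Multiset.countP_eq_zero] at h
  exact List.eq_replicate_of_mem fun b hb => by
    by_contra hne
    exact h b hb hne

theorem lieTensor_apply_nil {S : Set ι} {F : List ι × List ι → K} (hF : F ∈ lieTensor K deg S)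
    (w : List ι) : F ([], w) = 0 ∧ F (w, []) = 0 := by
  have key : ∀ p : List ι × List ι, p.1 = [] ∨ p.2 = [] → F p = 0 := by
    intro p hp
    let T : (List ι × List ι → K) →ₗ[K] (Unit → K) :=
      { toFun := fun F _ => F p, map_add' := fun _ _ => rfl, map_smul' := fun _ _ => rfl }
    have hT : IsFormal T := fun _ => FormalAt.eval p
    refine congrFun (eq_zero_of_mem_formalClosure_bot (lieTensor_induction (T := T) hT (N := ⊥)
      (fun s x t y hx hy => ?_) F hF)) ()
    have : T (tens x y) = 0 := by
      funext _
      change x p.1 * y p.2 = 0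
      rcases hp with hp | hp
      · rw [hp, hx.apply_nil, zero_mul]
      · rw [hp, hy.apply_nil, mul_zero]
    rw [this]
    exact Submodule.zero_mem _
  exact ⟨key _ (Or.inl rfl), key _ (Or.inr rfl)⟩

theorem exists_of_cyclicForm_ne_zero {F : List ι × List ι → K} {w : List ι}
    (h : cyclicForm K deg F w ≠ 0) :
    ∃ p : List ι × List ι, F p ≠ 0 ∧ (p.1 + p.2 : Multiset ι) = w := by
  by_contra hc
  push Not at hc
  exact h (cyclicForm_vanish fun p hp => by
    by_contra hne
    exact hc p hne hp)

/-- The cyclic form of a cocycle for the leading part of the differential is a cocycle. -/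
theorem vectorField_cyclicForm_cons_eq_zero (hu : deg u = 0) {F : List ι × List ι → K}
    (hd : lieOperator (unitConst K u) deg F ∈ lieRelations K deg Set.univ) {a : ι} (ha : a ≠ u) :
    vectorField (unitConst K u) deg (fun r => cyclicForm K deg F (a :: r)) = 0 := by
  funext r
  have h := cyclicForm_lieOperator hu ha F r
  rw [cyclicForm_eq_zero hd, vectorField_unitConst_cons_of_ne ha] at h
  have h2 := congrArg (fun x => ksign K (1 - deg a) * x) h
  simp only [← mul_assoc, ksign_mul_self, one_mul, Pi.zero_apply, mul_zero] at h2
  exact h2.symm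

/-- Lie `0`-forms in the letter `u` alone vanish outside order three: `t u ⊗ t u` is zero by
symmetry, and a form of higher order is determined by a Lie series in `u` of order one less, which
vanishes from order three on. -/
theorem mem_lieRelations_of_neCount_zero [Algebra ℚ K] (hu : deg u = 0) {F : List ι × List ι → K}
    (hF : F ∈ lieTensor K deg Set.univ)
    (hs : ∀ p, F p ≠ 0 → neCount u (p.1 + p.2 : Multiset ι) = 0) {n : ℕ}
    (hn : ∀ p, F p ≠ 0 → p.1.length + p.2.length = n)
    (h3 : cyclicForm K deg F [u, u, u] = 0) : F ∈ lieRelations K deg Set.univ := by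
  by_cases h0 : F = 0
  · rw [h0]; exact Submodule.zero_mem _
  have hn0 : n ≠ 0 := by
    rintro rfl
    refine h0 (funext fun p => ?_)
    by_contra hp
    have := hn p hp
    obtain ⟨w, v⟩ := p
    have hw : w = [] := List.length_eq_zero_iff.1 (by simp only at this; omega)
    subst hw
    exact hp (lieTensor_apply_nil hF v).1
  have key := markFirst_cyclicForm_of_weight (c := fun _ => (1 : K)) (q := (n : K)) hF
    fun p hp => by
      rw [contentWeight, Multiset.map_const', Multiset.sum_replicate, ← hn p hp]
      simp
  have hz : markFirst (fun _ => (1 : K)) (cyclicForm K deg F) = 0 := by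
    funext ⟨w, r⟩
    rcases w with _ | ⟨a, _ | ⟨b, w⟩⟩
    · rfl
    swap
    · rfl
    rw [markFirst_singleton, one_mul]
    by_contra hne
    obtain ⟨p, hp, hpc⟩ := exists_of_cyclicForm_ne_zero hne
    have hq := hs p hp
    rw [hpc] at hq
    have hr := eq_replicate_of_neCount_eq_zero hq
    rw [List.length_cons, List.replicate_succ, List.cons.injEq] at hr
    obtain ⟨rfl, hr⟩ := hr
    rw [hr] at hne
    obtain ⟨m, hm⟩ : ∃ m, r.length = m := ⟨_, rfl⟩
    rw [hm] at hne
    rcases m with _ | _ | _ | m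
    · refine hne ?_
      simp [cyclicForm_apply, rotateFirst_cons, splitSum_nil, swapTensor, lieTensor_apply_nil hF]
    · refine hne ?_
      simp [cyclicForm_apply, rotateFirst_cons, splitSum_nil, splitSum_cons, swapTensor,
        lieTensor_apply_nil hF, wordDeg, hu, ksign_zero, ksign_one]
    · exact hne h3
    · exact hne (apply_replicate_eq_zero hu (cyclicForm_cons_mem hF a) m)
  rw [hz, zero_sub] at key
  exact mem_of_smul_mem hn0 ((Submodule.neg_mem_iff _).1 key)

/-- A form with exactly one letter `a` different from `u` is a combination of the `a ⊗ y_a`, where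
`y_a` is a Lie series in `u` alone. Such a series is a multiple of `t u`, which is no cocycle for
the leading part of the differential, or of `t u * t u`, which is a coboundary. -/
theorem exists_primitive_of_neCount_one [Algebra ℚ K] (hu : deg u = 0) {F : List ι × List ι → K}
    (hF : F ∈ lieTensor K deg Set.univ)
    (hs : ∀ p, F p ≠ 0 → neCount u (p.1 + p.2 : Multiset ι) = 1 ∧ u ∈ (p.1 + p.2 : Multiset ι))
    (hd : lieOperator (unitConst K u) deg F ∈ lieRelations K deg Set.univ) :
    ∃ G ∈ lieTensor K deg Set.univ,
      F - lieOperator (unitConst K u) deg G ∈ lieRelations K deg Set.univ := by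
  classical
  set g := cyclicForm K deg F with hg
  let κ : ι → K := fun a => -(ksign K (1 - deg a) * (neWeight K u a * g [a, u, u]))
  let G : List ι × List ι → K := fun p => match p.1 with
    | [a] => κ a * letter K u p.2
    | _ => 0
  have hκ : κ u = 0 := by simp [κ, neWeight]
  have hG1 : ∀ p, G p ≠ 0 → ∃ a, a ≠ u ∧ p.1 = [a] := by
    rintro ⟨_ | ⟨a, _ | ⟨b, w⟩⟩, v⟩ hp
    · exact absurd rfl hp
    · refine ⟨a, fun h => hp ?_, rfl⟩
      change κ a * _ = 0
      rw [h, hκ, zero_mul]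
    · exact absurd rfl hp
  refine ⟨G, mem_lieTensor_of_singletons (fun p hp => (hG1 p hp).imp fun _ h => h.2) fun a =>
    Submodule.smul_mem _ (κ a)
      (IsLetterMonomial.letter (K := K) (deg := deg) u (Set.mem_univ u)).mem, ?_⟩
  have key := markFirst_cyclicForm_of_weight (c := neWeight K u) (q := 1) hF fun p hp => by
    rw [contentWeight_neWeight, (hs p hp).1, Nat.cast_one]
  rw [one_smul, ← hg] at key
  have e : markFirst (neWeight K u) g = lieOperator (unitConst K u) deg G := by
    funext ⟨w, v⟩
    rw [lieOperator_unitConst_of_singletons hG1]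
    rcases w with _ | ⟨a, _ | ⟨b, w⟩⟩
    · change 0 = _ * vectorField _ deg 0 v
      rw [map_zero, Pi.zero_apply, mul_zero]
    swap
    · change 0 = _ * vectorField _ deg 0 v
      rw [map_zero, Pi.zero_apply, mul_zero]
    rw [markFirst_singleton]
    have e1 : (fun v => G ([a], v)) = κ a • letter K u := rfl
    rw [e1, map_smul, vectorField_unitConst_letter hu, Pi.smul_apply, Pi.neg_apply, smul_eq_mul,
      seriesMul_letter, wordDeg_cons, show wordDeg deg ([] : List ι) = 0 from rfl, add_zero]
    have hk := ksign_mul_self (K := K) (1 - (deg a : ℤ))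
    by_cases ha : a = u
    · rw [ha, hκ]; simp [neWeight]
    by_cases hv : v = [u, u]
    · subst hv
      simp only [κ, if_true]
      linear_combination (-neWeight K u a * g [a, u, u]) * hk
    · rw [if_neg hv, neg_zero, mul_zero, mul_zero]
      suffices g (a :: v) = 0 by rw [this, mul_zero]
      by_contra hne
      obtain ⟨p, hp, hpc⟩ := exists_of_cyclicForm_ne_zero hne
      have hq := hs p hp
      rw [hpc, ← Multiset.cons_coe, neCount_cons_of_ne ha] at hq
      have hr := eq_replicate_of_neCount_eq_zero (Nat.succ_injective hq.1)
      have hmem : u ∈ v := by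
        have := hq.2
        rw [Multiset.mem_cons] at this
        exact Multiset.mem_coe.1 (this.resolve_left fun h => ha h.symm)
      obtain ⟨m, hm⟩ : ∃ m, v.length = m := ⟨_, rfl⟩
      rw [hm] at hr
      rcases m with _ | _ | _ | m
      · rw [hr] at hmem; simp at hmem
      · have h2 := congrFun (vectorField_cyclicForm_cons_eq_zero hu hd ha) [u, u]
        rw [vectorField_unitConst_cons_cons hu, vectorField_singleton, sub_zero, Pi.zero_apply,
          neg_eq_zero] at h2
        rw [hr] at hne
        exact hne h2
      · exact hv hr
      · rw [hr] at hne
        exact hne (apply_replicate_eq_zero hu (cyclicForm_cons_mem hF a) m)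
  rw [← e]
  have := Submodule.neg_mem _ key
  rwa [neg_sub] at this

/-- For a form with at least two letters different from `u`, marking two such letters reduces the
exactness to that of the tensor algebra, where it is witnessed by `blockHomotopy`. -/
theorem exists_primitive_of_two_le [Algebra ℚ K] (hu : deg u = 0) {F : List ι × List ι → K}
    (hF : F ∈ lieTensor K deg Set.univ) {n : ℕ} (hn : 2 ≤ n)
    (hs : ∀ p, F p ≠ 0 → neCount u (p.1 + p.2 : Multiset ι) = n ∧ u ∈ (p.1 + p.2 : Multiset ι))
    (hd : lieOperator (unitConst K u) deg F ∈ lieRelations K deg Set.univ) :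
    ∃ G ∈ lieTensor K deg Set.univ,
      F - lieOperator (unitConst K u) deg G ∈ lieRelations K deg Set.univ := by
  classical
  obtain ⟨n, rfl⟩ : ∃ k, n = k + 2 := ⟨n - 2, by omega⟩
  set g := cyclicForm K deg F with hg
  have hc : neWeight K u u = 0 := by simp [neWeight]
  let g' : List ι → K := fun w => match w with
    | [] => 0
    | a :: r => ksign K (1 - deg a) * blockHomotopy deg u r (fun v => g (a :: v))
  have key := markFirst_cyclicForm_of_weight (c := neWeight K u) (q := ((n + 2 : ℕ) : K)) hF
    fun p hp => by rw [contentWeight_neWeight, (hs p hp).1]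
  rw [← hg] at key
  have h1 : markBoth deg (neWeight K u) g = ((n + 1 : ℕ) : K) • markFirst (neWeight K u) g := by
    funext ⟨w, r⟩
    rcases w with _ | ⟨a, _ | ⟨b, w⟩⟩
    · exact (mul_zero _).symm
    swap
    · exact (mul_zero _).symm
    rw [Pi.smul_apply, smul_eq_mul, markFirst_singleton]
    change neWeight K u a * dynkin deg (neWeight K u) (fun r => g (a :: r)) r = _
    rw [dynkin_of_mem _ (cyclicForm_cons_mem hF a), contentWeight_neWeight]
    by_cases ha : a = u
    · rw [ha, hc]; ring
    by_cases hz : g (a :: r) = 0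
    · have hz' : cyclicForm K deg F (a :: r) = 0 := hz
      simp [hg, hz']
    obtain ⟨p, hp, hpc⟩ := exists_of_cyclicForm_ne_zero hz
    have hq := (hs p hp).1
    rw [hpc, ← Multiset.cons_coe, neCount_cons_of_ne ha] at hq
    rw [Nat.succ_injective hq]
    ring
  have h2 : markBoth deg (neWeight K u) g =
      lieOperator (unitConst K u) deg (markBoth deg (neWeight K u) g') := by
    rw [lieOperator_markBoth hc hu]
    funext ⟨w, r⟩
    rcases w with _ | ⟨a, _ | ⟨b, w⟩⟩
    · rfl
    swap
    · rfl
    change neWeight K u a * dynkin deg (neWeight K u) _ r =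
      neWeight K u a * dynkin deg (neWeight K u) _ r
    by_cases ha : a = u
    · rw [ha, hc, zero_mul, zero_mul]
    refine congrArg (fun f => neWeight K u a * dynkin deg (neWeight K u) f r) (funext fun v => ?_)
    rw [vectorField_unitConst_cons_of_ne ha]
    have e : (fun v => g' (a :: v)) =
        ksign K (1 - deg a) • fun v => blockHomotopy deg u v (fun v => g (a :: v)) := rfl
    rw [e, map_smul, Pi.smul_apply, smul_eq_mul, ← mul_assoc, ksign_mul_self, one_mul]
    by_cases hv : u ∈ v
    · have hz := blockHomotopy_identity hu v (fun v => g (a :: v)) hv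
      rw [vectorField_cyclicForm_cons_eq_zero hu hd ha] at hz
      have : blockHomotopy deg u v (0 : List ι → K) = 0 := by
        have := blockHomotopy_smul (deg := deg) (u := u) v (0 : K) 0
        simp only [zero_mul] at this
        exact this
      rw [this, add_zero] at hz
      exact hz.symm
    · have hz : g (a :: v) = 0 := by
        by_contra hne
        obtain ⟨p, hp, hpc⟩ := exists_of_cyclicForm_ne_zero hne
        have hq := (hs p hp).2
        rw [hpc, ← Multiset.cons_coe, Multiset.mem_cons] at hq
        exact hq.elim (fun h => ha h.symm) fun h => hv (Multiset.mem_coe.1 h)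
      rw [hz]
      symm
      by_contra hne
      obtain ⟨w, hw, i, j, c, s, hc, -, ev⟩ := vectorField_support _ hne
      obtain ⟨rfl, -, -⟩ := eq_of_unitConst_ne_zero hc
      exact hv (Multiset.mem_coe.1 (by rw [ev]; exact Multiset.mem_cons_self _ _))
  let N : ℕ := (n + 1) * (n + 2)
  have hN : ∃ b : K, b * (N : K) = 1 := by
    refine ⟨algebraMap ℚ K (1 / N), ?_⟩
    rw [← map_natCast (algebraMap ℚ K) N, ← map_mul,
      one_div_mul_cancel (Nat.cast_ne_zero.2 (Nat.mul_ne_zero (by omega) (by omega))), map_one]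
  obtain ⟨b, hb⟩ := hN
  refine ⟨b • markBoth deg (neWeight K u) g', Submodule.smul_mem _ _ (markBoth_mem _ _), ?_⟩
  rw [map_smul, ← h2, h1]
  have := Submodule.smul_mem _ (-(b * ((n + 1 : ℕ) : K))) key
  convert this using 1
  funext p
  simp only [Pi.sub_apply, Pi.smul_apply, smul_eq_mul]
  simp only [N, Nat.cast_mul] at hb
  linear_combination (-F p) * hb

end Exactness

/-! ### Reduction to normalised forms -/

section Reduction

variable {K : Type*} [CommRing K] {ι : Type*} {deg : ι → ℕ} {u : ι}

theorem mem_homogeneousPart_iff {i j : ℤ} {F : List ι × List ι → K} :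
    F ∈ homogeneousPart K deg i j ↔ ∀ p, F p ≠ 0 →
      ((p.1 + p.2 : Multiset ι).card : ℤ) = i ∧ contentDeg deg (p.1 + p.2 : Multiset ι) = j + 1 := by
  refine forall_congr' fun p => imp_congr_right fun _ => ?_
  rw [contentDeg_add, contentDeg_coe, contentDeg_coe, Multiset.card_add, Multiset.coe_card,
    Multiset.coe_card]

theorem contentDeg_cons (a : ι) (s : Multiset ι) :
    contentDeg deg (a ::ₘ s) = (1 - (deg a : ℤ)) + contentDeg deg s := by simp [contentDeg]

theorem lieOperator_homogeneous {μ : ι → ι → ι →₀ K} (hμ : IsGradedCommStructure μ deg) {i j : ℤ}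
    {F : List ι × List ι → K} (hF : F ∈ homogeneousPart K deg (i - 1) (j - 1)) :
    lieOperator μ deg F ∈ homogeneousPart K deg i j := by
  rw [mem_homogeneousPart_iff] at hF ⊢
  intro p hp
  obtain ⟨p', hp', a, b, c, s, hc, e, e'⟩ := lieOperator_support hp
  have h := hF p' hp'
  rw [e, contentDeg_cons, Multiset.card_cons, hμ.deg_eq a b c hc] at h
  rw [e', contentDeg_cons, contentDeg_cons, Multiset.card_cons, Multiset.card_cons]
  push_cast at h ⊢
  omega

theorem restrictContent_homogeneous (A : Multiset ι → Prop) {i j : ℤ} {F : List ι × List ι → K}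
    (hF : F ∈ homogeneousPart K deg i j) :
    restrictContent K A F ∈ homogeneousPart K deg i j := fun p hp => hF p fun h => hp (by
  rw [restrictContent_apply, h, ite_self])

theorem restrictContent_eq_self {A : Multiset ι → Prop} {F : List ι × List ι → K}
    (h : ∀ p, F p ≠ 0 → A (p.1 + p.2 : Multiset ι)) : restrictContent K A F = F := by
  classical
  funext p
  rw [restrictContent_apply]
  by_cases hp : F p = 0
  · rw [hp, ite_self]
  · rw [if_pos (h p hp)]

theorem restrictContent_eq_zero {A : Multiset ι → Prop} {F : List ι × List ι → K}
    (h : ∀ p, F p ≠ 0 → ¬A (p.1 + p.2 : Multiset ι)) : restrictContent K A F = 0 := by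
  classical
  funext p
  rw [restrictContent_apply]
  by_cases hp : F p = 0
  · rw [hp, ite_self]; rfl
  · rw [if_neg (h p hp)]; rfl

theorem support_restrictContent {A : Multiset ι → Prop} {F : List ι × List ι → K}
    {p : List ι × List ι} (h : restrictContent K A F p ≠ 0) :
    F p ≠ 0 ∧ A (p.1 + p.2 : Multiset ι) := by
  classical
  rw [restrictContent_apply] at h
  split_ifs at h with hA
  · exact ⟨h, hA⟩
  · exact absurd rfl h

/-- A Lie `0`-form which is a cocycle up to normalised forms is normalised up to a coboundary. The
part of lowest weight `n` (with respect to the letters different from `u`) containing `u` is a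
cocycle for the leading part of the differential, hence it can be removed by a coboundary, at the
expense of terms of higher weight. -/
theorem exists_normalised [Algebra ℚ K] {μ : ι → ι → ι →₀ K} (hu : deg u = 0)
    (hμ : IsGradedCommStructure μ deg) (ha : IsAssocStructure μ) (h1 : IsUnitIndex μ u) {i j : ℤ}
    (N : List ι × List ι → K) (hN : ∀ p, N p ≠ 0 → u ∉ (p.1 + p.2 : Multiset ι)) (d : ℕ) :
    ∀ n : ℕ, i < n + d → ∀ F ∈ lieTensor K deg Set.univ, F ∈ homogeneousPart K deg i j →
      (∀ p, F p ≠ 0 → n ≤ neCount u (p.1 + p.2 : Multiset ι) ∨ u ∉ (p.1 + p.2 : Multiset ι)) →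
      lieOperator μ deg F - N ∈ lieRelations K deg Set.univ →
      (n = 0 → (i, j) ≠ (3, 2) ∨ cyclicForm K deg F [u, u, u] = 0) →
      ∃ F' ∈ lieTensor K deg Set.univ, F' ∈ homogeneousPart K deg i j ∧
        (∀ p, F' p ≠ 0 → u ∉ (p.1 + p.2 : Multiset ι)) ∧
        ∃ G ∈ lieTensor K deg Set.univ, G ∈ homogeneousPart K deg (i - 1) (j - 1) ∧
          F - F' - lieOperator μ deg G ∈ lieRelations K deg Set.univ := by
  classical
  induction d with
  | zero =>
    -- The order `i` bounds the number of letters different from `u`, so `F` is normalised.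
    intro n hn F hF hFh hs _ _
    refine ⟨F, hF, hFh, fun p hp => (hs p hp).resolve_left fun hle => ?_, 0,
      Submodule.zero_mem _, Submodule.zero_mem _, ?_⟩
    · have := (mem_homogeneousPart_iff.1 hFh p hp).1
      have h2 : neCount u (p.1 + p.2 : Multiset ι) ≤ (p.1 + p.2 : Multiset ι).card :=
        Multiset.countP_le_card _ _
      push_cast at hn
      omega
    · rw [map_zero, sub_self, sub_zero]; exact Submodule.zero_mem _
  | succ d ih =>
    intro n hn F hF hFh hs hd hb
    set L₀ := lieOperator (unitConst K u) deg with hL₀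
    set L₁ := lieOperator (reducedConst u μ) deg with hL₁
    set Fn := restrictContent K (fun s => neCount u s = n ∧ u ∈ s) F with hFn
    have hFnT : Fn ∈ lieTensor K deg Set.univ :=
      restrictContent_mem_lieTensor (fun _ _ _ i _ => Set.mem_univ i) hF
    have hFnh : Fn ∈ homogeneousPart K deg i j := restrictContent_homogeneous _ hFh
    have hFns : ∀ p, Fn p ≠ 0 →
        neCount u (p.1 + p.2 : Multiset ι) = n ∧ u ∈ (p.1 + p.2 : Multiset ι) :=
      fun p hp => (support_restrictContent hp).2
    -- A reduced product adds a letter different from `u` and creates no letter `u`.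
    have hL₁s : ∀ (G : List ι × List ι → K) (m : ℕ), (∀ p, G p ≠ 0 →
        m ≤ neCount u (p.1 + p.2 : Multiset ι) ∨ u ∉ (p.1 + p.2 : Multiset ι)) → ∀ p, L₁ G p ≠ 0 →
        m + 1 ≤ neCount u (p.1 + p.2 : Multiset ι) ∨ u ∉ (p.1 + p.2 : Multiset ι) := by
      intro G m hG p hp
      obtain ⟨p', hp', a, b, c, s, hc, e, e'⟩ := lieOperator_support hp
      obtain ⟨hau, hbu, -⟩ := ne_of_reducedConst_ne_zero hc
      rw [e', neCount_cons_of_ne hau, neCount_cons_of_ne hbu]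
      rcases hG p' hp' with h | h
      · left
        rw [e] at h
        by_cases hcu : c = u
        · rw [hcu, neCount_cons_self] at h; omega
        · rw [neCount_cons_of_ne hcu] at h; omega
      · right
        rw [e] at h
        simp only [Multiset.mem_cons, not_or] at h ⊢
        exact ⟨fun h => hau h.symm, fun h => hbu h.symm, h.2⟩
    have hL₀F : restrictContent K (fun s => neCount u s = n ∧ u ∈ s) (L₀ F) = L₀ Fn := by
      rw [hL₀, restrictContent_lieOperator_unitConst, ← sub_eq_zero, ← map_sub]
      funext p
      by_contra hp
      obtain ⟨p', hp', a, b, c, s, hc, e, e'⟩ := lieOperator_support hp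
      obtain ⟨rfl, rfl, rfl⟩ := eq_of_unitConst_ne_zero hc
      refine hp' ?_
      rw [Pi.sub_apply, hFn, restrictContent_apply, restrictContent_apply, e]
      simp [neCount_cons_self]
    -- Only `L₀ Fn` contributes to the part of `L F - N` of weight `n` containing `u`.
    have hdn : L₀ Fn ∈ lieRelations K deg Set.univ := by
      have e1 := restrictContent_mem_lieRelations (fun s => neCount u s = n ∧ u ∈ s)
        (Submodule.sub_mem _ hd (lieOperator_sub_mem hu h1 hF))
      have z1 : restrictContent K (fun s => neCount u s = n ∧ u ∈ s) N = 0 :=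
        restrictContent_eq_zero fun p hp h => hN p hp h.2
      have z2 : restrictContent K (fun s => neCount u s = n ∧ u ∈ s) (L₁ F) = 0 :=
        restrictContent_eq_zero fun p hp h => by
          rcases hL₁s F n hs p hp with h' | h'
          · omega
          · exact h' h.2
      rw [show lieOperator μ deg F - N - (lieOperator μ deg F - (L₀ F + L₁ F)) =
        L₀ F + L₁ F - N by abel, map_sub, map_add, z1, z2, hL₀F, add_zero, sub_zero] at e1
      exact e1
    obtain ⟨G₀, hG₀, hG₀'⟩ : ∃ G ∈ lieTensor K deg Set.univ,
        Fn - L₀ G ∈ lieRelations K deg Set.univ := by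
      rcases n with _ | _ | n
      · refine ⟨0, Submodule.zero_mem _, ?_⟩
        rw [map_zero, sub_zero]
        refine mem_lieRelations_of_neCount_zero hu hFnT (fun p hp => (hFns p hp).1) (n := i.toNat)
          (fun p hp => ?_) ?_
        · have := (hFnh p hp).1
          omega
        · rcases hb rfl with hij | hz
          · by_contra hne
            obtain ⟨p, hp, hpc⟩ := exists_of_cyclicForm_ne_zero hne
            have := mem_homogeneousPart_iff.1 hFnh p hp
            rw [hpc] at this
            refine hij (Prod.ext ?_ ?_)
            · simpa using this.1.symm
            · have h2 := this.2
              rw [contentDeg_coe] at h2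
              simp only [wordDeg_cons, hu, show wordDeg deg ([] : List ι) = 0 from rfl] at h2
              simp only
              push_cast at h2
              omega
          · have hz' : cyclicForm K deg (F - Fn) [u, u, u] = 0 := by
              refine cyclicForm_vanish fun p hp => ?_
              rw [Pi.sub_apply, hFn, restrictContent_apply, if_pos, sub_self]
              rw [hp]
              refine ⟨?_, List.mem_cons_self⟩
              rw [← Multiset.cons_coe, ← Multiset.cons_coe, ← Multiset.cons_coe,
                neCount_cons_self, neCount_cons_self, neCount_cons_self]
              exact neCount_zero
            rw [map_sub, Pi.sub_apply, hz, zero_sub, neg_eq_zero] at hz'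
            exact hz'
      · exact exists_primitive_of_neCount_one hu hFnT hFns hdn
      · exact exists_primitive_of_two_le hu hFnT (by omega) hFns hdn
    -- The primitive is replaced by its homogeneous part, in which one letter `u` is missing.
    let B : Multiset ι → Prop := fun s =>
      neCount u s = n ∧ (s.card : ℤ) = i ∧ contentDeg deg s = j + 1
    set G₁ := restrictContent K (fun s => B (u ::ₘ s)) G₀ with hG₁
    have hG₁T : G₁ ∈ lieTensor K deg Set.univ :=
      restrictContent_mem_lieTensor (fun _ _ _ i _ => Set.mem_univ i) hG₀
    have hG₁h : G₁ ∈ homogeneousPart K deg (i - 1) (j - 1) := by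
      rw [mem_homogeneousPart_iff]
      intro p hp
      have := (support_restrictContent hp).2.2
      rw [Multiset.card_cons, contentDeg_cons, hu] at this
      push_cast at this
      omega
    have hG₁s : ∀ p, G₁ p ≠ 0 → n ≤ neCount u (p.1 + p.2 : Multiset ι) ∨
        u ∉ (p.1 + p.2 : Multiset ι) := fun p hp => by
      have := (support_restrictContent hp).2.1
      rw [neCount_cons_self] at this
      exact Or.inl this.ge
    have hG₁' : Fn - L₀ G₁ ∈ lieRelations K deg Set.univ := by
      have := restrictContent_mem_lieRelations B hG₀'
      rwa [map_sub, restrictContent_eq_self (fun p hp => ⟨(hFns p hp).1,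
        mem_homogeneousPart_iff.1 hFnh p hp⟩), hL₀, restrictContent_lieOperator_unitConst] at this
    have hr := Submodule.sub_mem _ hG₁' (lieOperator_sub_mem hu h1 hG₁T)
    have hF₁T : F - Fn - L₁ G₁ ∈ lieTensor K deg Set.univ :=
      Submodule.sub_mem _ (Submodule.sub_mem _ hF hFnT)
        (lieOperator_mem (isGradedCommStructure_reducedConst hμ) _ hG₁T)
    obtain ⟨F', hF', hF'h, hF's, G₂, hG₂, hG₂h, hfin⟩ := ih (n + 1) (by push_cast at hn ⊢; omega)
      (F - Fn - L₁ G₁) hF₁T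
      (Submodule.sub_mem _ (Submodule.sub_mem _ hFh hFnh)
        (lieOperator_homogeneous (isGradedCommStructure_reducedConst hμ) hG₁h))
      (fun p hp => by
        by_cases hp1 : L₁ G₁ p = 0
        · have hp2 : F p ≠ 0 := fun h => hp (by
            have : Fn p = 0 := by rw [hFn, restrictContent_apply, h, ite_self]
            simp [h, this, hp1])
          by_contra hc
          push Not at hc
          have h3 := (hs p hp2).resolve_right fun h => h hc.2
          refine hp ?_
          have : Fn p = F p := by
            rw [hFn, restrictContent_apply, if_pos ⟨by omega, hc.2⟩]
          simp [this, hp1]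
        · exact hL₁s G₁ n hG₁s p hp1)
      (by
        have e : F - Fn - L₁ G₁ = F - lieOperator μ deg G₁ -
            (Fn - L₀ G₁ - (lieOperator μ deg G₁ - (L₀ G₁ + L₁ G₁))) := by abel
        rw [e, map_sub, map_sub, lieOperator_lieOperator hμ ha hG₁T, sub_zero, sub_right_comm]
        exact Submodule.sub_mem _ hd (lieOperator_rel_mem hμ _ hr))
      (fun h => absurd h (Nat.succ_ne_zero n))
    refine ⟨F', hF', hF'h, hF's, G₁ + G₂, Submodule.add_mem _ hG₁T hG₂,
      Submodule.add_mem _ hG₁h hG₂h, ?_⟩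
    have e : F - F' - lieOperator μ deg (G₁ + G₂) =
        (F - Fn - L₁ G₁ - F' - lieOperator μ deg G₂) +
          (Fn - L₀ G₁ - (lieOperator μ deg G₁ - (L₀ G₁ + L₁ G₁))) := by
      rw [map_add]; abel
    rw [e]
    exact Submodule.add_mem _ hfin hr

/-- The words that occur in Lie `0`-forms on the letters in `S` have their letters in `S`. -/
theorem mem_of_mem_lieTensor {S : Set ι} {F : List ι × List ι → K} (hF : F ∈ lieTensor K deg S)
    {p : List ι × List ι} (hp : F p ≠ 0) : ∀ i ∈ (p.1 + p.2 : Multiset ι), i ∈ S := by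
  have key : restrictContent K (fun s => ∀ i ∈ s, i ∈ S) F - F = 0 := by
    refine eq_zero_of_mem_formalClosure_bot (lieTensor_induction
      (T := restrictContent K (fun s => ∀ i ∈ s, i ∈ S) - LinearMap.id)
      ((isFormal_restrictContent _).sub isFormal_id) (fun s x t y hx hy => ?_) F hF)
    rw [LinearMap.sub_apply, restrictContent_eq_self, LinearMap.id_apply, sub_self]
    · exact Submodule.zero_mem _
    · intro p hp i hi
      rw [tens_support hx hy p hp] at hi
      exact (Multiset.mem_add.1 hi).elim (hx.letter_mem i) (hy.letter_mem i)
  rw [sub_eq_zero] at key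
  rw [← key] at hp
  exact (support_restrictContent hp).2

end Reduction

/-! ### The bidegree `(3, 2)` class dual to the unit -/

section Naturality

variable {K : Type*} [CommRing K] {ι κ : Type*} {deg : ι → ℕ} {deg' : κ → ℕ} {φ : κ → ι}

theorem splitSum_map (w : List κ) : ∀ g : List ι → List ι → K,
    splitSum (w.map φ) g = splitSum w fun u v => g (u.map φ) (v.map φ) := by
  induction w with
  | nil => intro g; simp [splitSum_nil]
  | cons a w ih => intro g; simp [splitSum_cons, ih]

theorem rotateFirst_map (h : ∀ k, deg (φ k) = deg' k) (F : List ι × List ι → K) (w : List κ) :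
    rotateFirst K deg F (w.map φ) = rotateFirst K deg' (pullbackTensor K φ F) w := by
  cases w with
  | nil => rfl
  | cons a r =>
    rw [List.map_cons, rotateFirst_cons, rotateFirst_cons, splitSum_map]
    refine splitSum_congr fun q u _ => ?_
    rw [← List.map_cons, wordDeg_map h, wordDeg_map h, splitSum_map]
    refine congrArg _ (splitSum_congr fun v s _ => ?_)
    change _ = F ((u ++ a :: v).map φ, s.map φ)
    rw [List.map_append, List.map_cons]

theorem cyclicForm_map (h : ∀ k, deg (φ k) = deg' k) (F : List ι × List ι → K) (w : List κ) :
    cyclicForm K deg F (w.map φ) = cyclicForm K deg' (pullbackTensor K φ F) w := by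
  rw [cyclicForm_apply, cyclicForm_apply, Pi.add_apply, Pi.add_apply, rotateFirst_map h,
    rotateFirst_map h]
  have e : pullbackTensor K φ (swapTensor deg F) = swapTensor deg' (pullbackTensor K φ F) := by
    funext p
    change swapTensor deg F (p.1.map φ, p.2.map φ) = _
    simp only [swapTensor, wordDeg_map h]; rfl
  rw [e]

end Naturality

section UnitClass

variable {K A ι : Type*} [CommRing K] [Ring A] [Algebra K A] {𝒜 : ℕ → Submodule K A}

theorem UnitalBasis.structConst_sum (β : UnitalBasis 𝒜 ι) (a b : ι) (g : A →ₗ[K] K) :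
    ((β.structConst a b).sum fun e r => r * g (β.basis e)) = g (β.basis a * β.basis b) := by
  conv_rhs => rw [← β.basis.linearCombination_repr (β.basis a * β.basis b)]
  rw [Finsupp.linearCombination_apply, map_finsuppSum]
  simp only [map_smul, smul_eq_mul]
  rfl

theorem UnitalBasis.isAssocStructure (β : UnitalBasis 𝒜 ι) : IsAssocStructure β.structConst := by
  intro i j k c
  have h1 := β.structConst_sum i j (β.basis.coord c ∘ₗ LinearMap.mulRight K (β.basis k))
  have h2 := β.structConst_sum j k (β.basis.coord c ∘ₗ LinearMap.mulLeft K (β.basis i))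
  simp only [LinearMap.comp_apply, LinearMap.mulRight_apply, LinearMap.mulLeft_apply] at h1 h2
  rw [mul_assoc] at h1
  exact h1.trans h2.symm

theorem UnitalBasis.isUnitIndex (β : UnitalBasis 𝒜 ι) : IsUnitIndex β.structConst β.unit where
  left j := by rw [UnitalBasis.structConst, β.basis_unit, one_mul, Module.Basis.repr_self]
  right i := by rw [UnitalBasis.structConst, β.basis_unit, mul_one, Module.Basis.repr_self]

/-- The linear form `ε` on `V` dual to the unit. -/
noncomputable def UnitalBasis.counit (β : UnitalBasis 𝒜 ι) : A →ₗ[K] K := β.basis.coord β.unit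

/-- The series `∑ e, ε (x a * x e) • t e`. -/
noncomputable def UnitalBasis.unitPairing (β : UnitalBasis 𝒜 ι) (a : ι) : List ι → K
  | [e] => β.counit (β.basis a * β.basis e)
  | _ => 0

/-- The Lie `0`-form `∑ a, t a ⊗ m (unitPairing a)`, that is,
`∑ a b c, (-1) ^ (deg b) ε (x a * x b * x c) • t a ⊗ t b t c`, of bidegree `(3, 2)`. -/
noncomputable def UnitalBasis.unitForm (β : UnitalBasis 𝒜 ι) (p : List ι × List ι) : K :=
  match p.1 with
  | [a] => vectorField β.structConst β.deg (β.unitPairing a) p.2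
  | _ => 0

theorem UnitalBasis.exists_of_unitPairing_ne_zero (β : UnitalBasis 𝒜 ι) {a : ι} {w : List ι}
    (h : β.unitPairing a w ≠ 0) : ∃ e, w = [e] := by
  match w, h with
  | [e], _ => exact ⟨e, rfl⟩
  | [], h => exact absurd rfl h
  | _ :: _ :: _, h => exact absurd rfl h

theorem UnitalBasis.unitForm_singleton (β : UnitalBasis 𝒜 ι) (a : ι) (w : List ι) :
    β.unitForm ([a], w) = vectorField β.structConst β.deg (β.unitPairing a) w := rfl

theorem UnitalBasis.exists_of_unitForm_ne_zero (β : UnitalBasis 𝒜 ι) {p : List ι × List ι}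
    (h : β.unitForm p ≠ 0) : ∃ a b c, p = ([a], [b, c]) := by
  obtain ⟨w, v⟩ := p
  match w, h with
  | [], h => exact absurd rfl h
  | _ :: _ :: _, h => exact absurd rfl h
  | [a], h =>
    obtain ⟨w', hw', i, j, c, s, -, e, e'⟩ := vectorField_support _ h
    obtain ⟨e₀, rfl⟩ := β.exists_of_unitPairing_ne_zero hw'
    have h1 := congrArg Multiset.card e
    have h2 := congrArg Multiset.card e'
    simp only [Multiset.coe_card, Multiset.card_cons, List.length_singleton] at h1 h2
    obtain ⟨b, c, rfl⟩ := List.length_eq_two.1 (h2.trans (by omega : s.card + 1 + 1 = 2))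
    exact ⟨a, b, c, rfl⟩

theorem UnitalBasis.unitForm_apply (β : UnitalBasis 𝒜 ι) (a b c : ι) :
    β.unitForm ([a], [b, c]) =
      ksign K (β.deg b) * β.counit (β.basis a * (β.basis b * β.basis c)) := by
  rw [β.unitForm_singleton, vectorField_cons, vectorField_cons, vectorField_nil]
  have h := β.structConst_sum b c (β.counit ∘ₗ LinearMap.mulLeft K (β.basis a))
  simp only [LinearMap.comp_apply, LinearMap.mulLeft_apply] at h
  rw [← h]
  simp [headMerge, unitPairing]

theorem UnitalBasis.deg_eq_zero_of_unitForm_ne_zero [GradedAlgebra 𝒜] (β : UnitalBasis 𝒜 ι)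
    {a b c : ι} (h : β.unitForm ([a], [b, c]) ≠ 0) : β.deg a = 0 ∧ β.deg b = 0 ∧ β.deg c = 0 := by
  rw [β.unitForm_apply] at h
  have := β.deg_eq_of_mem (SetLike.mul_mem_graded (β.basis_mem a)
    (SetLike.mul_mem_graded (β.basis_mem b) (β.basis_mem c))) (right_ne_zero_of_mul h)
  rw [β.deg_unit] at this
  omega

theorem UnitalBasis.unitForm_homogeneous [GradedAlgebra 𝒜] (β : UnitalBasis 𝒜 ι) :
    β.unitForm ∈ homogeneousPart K β.deg 3 2 := by
  intro p hp
  obtain ⟨a, b, c, rfl⟩ := β.exists_of_unitForm_ne_zero hp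
  obtain ⟨ha, hb, hc⟩ := β.deg_eq_zero_of_unitForm_ne_zero hp
  simp [wordDeg, ha, hb, hc]

theorem UnitalBasis.cyclicForm_unitForm (β : UnitalBasis 𝒜 ι) :
    cyclicForm K β.deg β.unitForm [β.unit, β.unit, β.unit] = 3 := by
  have h : β.unitForm ([β.unit], [β.unit, β.unit]) = 1 := by
    rw [β.unitForm_apply, β.deg_unit, β.basis_unit, mul_one, mul_one, ← β.basis_unit]
    simp [counit, ksign_zero]
  have h1 : ∀ a b u v, β.unitForm (a :: b :: u, v) = 0 := fun _ _ _ _ => rfl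
  have h2 : ∀ v, β.unitForm ([], v) = 0 := fun _ => rfl
  have k2 : ksign K 2 = 1 := ksign_even (by decide)
  rw [cyclicForm_apply, Pi.add_apply, rotateFirst_cons, rotateFirst_cons]
  simp [splitSum_cons, splitSum_nil, swapTensor, h, h1, h2, wordDeg, β.deg_unit,
    ksign_zero, k2]
  norm_num

theorem UnitalBasis.unitForm_mem [Algebra ℚ K] [GradedAlgebra 𝒜] [IsGradedCommutative 𝒜]
    (β : UnitalBasis 𝒜 ι) : β.unitForm ∈ lieTensor K β.deg Set.univ := by
  refine mem_lieTensor_of_singletons (fun p hp => ?_) fun a => ?_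
  · obtain ⟨a, b, c, rfl⟩ := β.exists_of_unitForm_ne_zero hp
    exact ⟨a, rfl⟩
  · exact vectorField_of_mem β.isGradedCommStructure _ fun w hw =>
      β.exists_of_unitPairing_ne_zero hw

/-- Elements of degree zero are central, so `ε` of a product of them is cyclically symmetric. -/
theorem UnitalBasis.counit_mul_rotate [GradedAlgebra 𝒜] [IsGradedCommutative 𝒜]
    (β : UnitalBasis 𝒜 ι) {a b c d : ι} (ha : β.deg a = 0) (hb : β.deg b = 0)
    (hc : β.deg c = 0) (hd : β.deg d = 0) :
    β.counit (β.basis a * β.basis b * (β.basis c * β.basis d)) =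
      β.counit (β.basis d * β.basis a * (β.basis b * β.basis c)) := by
  have h := IsGradedCommutative.mul_comm' (SetLike.mul_mem_graded (SetLike.mul_mem_graded
    (β.basis_mem a) (β.basis_mem b)) (β.basis_mem c)) (β.basis_mem d)
  simp only [ha, hb, hc, hd, add_zero, mul_zero, pow_zero, one_mul] at h
  rw [← mul_assoc, h]
  simp only [mul_assoc]

theorem UnitalBasis.exists_of_lieOperator_unitForm_ne_zero [GradedAlgebra 𝒜]
    [IsGradedCommutative 𝒜] (β : UnitalBasis 𝒜 ι) {p : List ι × List ι}
    (h : lieOperator β.structConst β.deg β.unitForm p ≠ 0) :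
    ∃ a b c d, p = ([a, b], [c, d]) := by
  obtain ⟨w, v⟩ := p
  -- The second summand of the Lie operator vanishes by `m² = 0`.
  have h2 : vectorField β.structConst β.deg (fun v => β.unitForm (w, v)) v = 0 := by
    match w with
    | [] => exact congrFun (map_zero (vectorField β.structConst β.deg)) v
    | _ :: _ :: _ => exact congrFun (map_zero (vectorField β.structConst β.deg)) v
    | [a] => exact vectorField_vectorField β.isGradedCommStructure β.isAssocStructure v _
  have h1 : vectorField β.structConst β.deg (fun u => β.unitForm (u, v)) w ≠ 0 := fun h1 => h (by
    change _ + _ * vectorField β.structConst β.deg (fun v => β.unitForm (w, v)) v = (0 : K)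
    rw [h2, mul_zero, add_zero]
    exact h1)
  obtain ⟨w', hw', i, j, k, s, -, e, e'⟩ := vectorField_support _ h1
  obtain ⟨a, c, d, hp⟩ := β.exists_of_unitForm_ne_zero hw'
  obtain ⟨rfl, rfl⟩ := Prod.ext_iff.1 hp
  have h1 := congrArg Multiset.card e
  have h2 := congrArg Multiset.card e'
  simp only [Multiset.coe_card, Multiset.card_cons, List.length_singleton] at h1 h2
  obtain ⟨x, y, rfl⟩ := List.length_eq_two.1 (h2.trans (by omega : s.card + 1 + 1 = 2))
  exact ⟨x, y, c, d, rfl⟩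

theorem UnitalBasis.lieOperator_unitForm_apply (β : UnitalBasis 𝒜 ι) {a b c d : ι} (ha : β.deg a = 0)
    (hc : β.deg c = 0) : lieOperator β.structConst β.deg β.unitForm ([a, b], [c, d]) =
      β.counit (β.basis a * β.basis b * (β.basis c * β.basis d)) := by
  change vectorField β.structConst β.deg (fun u => β.unitForm (u, [c, d])) [a, b] +
    _ * vectorField β.structConst β.deg (fun v => (0 : K)) [c, d] = _
  rw [show (fun _ => (0 : K) : List ι → K) = 0 from rfl, map_zero, Pi.zero_apply, mul_zero, add_zero,
    vectorField_cons, vectorField_cons, vectorField_nil]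
  have h := β.structConst_sum a b (β.counit ∘ₗ LinearMap.mulRight K (β.basis c * β.basis d))
  simp only [LinearMap.comp_apply, LinearMap.mulRight_apply] at h
  rw [← h]
  simp [headMerge, β.unitForm_apply, ha, hc, ksign_zero]

/-- The cyclic form of `L_m unitForm` is the alternating sum of the rotations of the cyclically
symmetric expression `ε (x a * x b * x c * x d)`, so it vanishes. -/
theorem UnitalBasis.lieOperator_unitForm_mem [Algebra ℚ K] [GradedAlgebra 𝒜]
    [IsGradedCommutative 𝒜] (β : UnitalBasis 𝒜 ι) :
    lieOperator β.structConst β.deg β.unitForm ∈ lieRelations K β.deg Set.univ := by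
  set F := lieOperator β.structConst β.deg β.unitForm with hF
  have hFT : F ∈ lieTensor K β.deg Set.univ :=
    lieOperator_mem β.isGradedCommStructure _ β.unitForm_mem
  have hFh : F ∈ homogeneousPart K β.deg 4 3 :=
    lieOperator_homogeneous β.isGradedCommStructure β.unitForm_homogeneous
  have hz : ∀ a b u v, (∀ c d, (u, v) ≠ ([], [c, d])) → F (a :: b :: u, v) = 0 := by
    intro a b u v h
    by_contra hne
    obtain ⟨a, b, c, d, e⟩ := β.exists_of_lieOperator_unitForm_ne_zero hne
    simp only [Prod.mk.injEq, List.cons.injEq] at e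
    exact h c d (Prod.ext e.1.2.2 e.2)
  have hz1 : ∀ a v, F ([a], v) = 0 := by
    intro a v
    by_contra hne
    obtain ⟨a, b, c, d, e⟩ := β.exists_of_lieOperator_unitForm_ne_zero hne
    simp at e
  have hz0 : ∀ v, F ([], v) = 0 := by
    intro v
    by_contra hne
    obtain ⟨a, b, c, d, e⟩ := β.exists_of_lieOperator_unitForm_ne_zero hne
    simp at e
  have hc : cyclicForm K β.deg F = 0 := by
    funext w
    by_contra hne
    obtain ⟨p, hp, hpw⟩ := exists_of_cyclicForm_ne_zero hne
    have hdeg := (mem_homogeneousPart_iff.1 hFh p hp).2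
    obtain ⟨a, b, c, d, rfl⟩ := β.exists_of_lieOperator_unitForm_ne_zero hp
    have hl := congrArg Multiset.card hpw
    rw [hpw, contentDeg_coe] at hdeg
    simp only [Multiset.card_add, Multiset.coe_card, List.length_cons, List.length_nil] at hl
    match w, hl with
    | [a, b, c, d], _ =>
      simp only [wordDeg, List.map_cons, List.map_nil, List.sum_cons, List.sum_nil] at hdeg
      have ha : β.deg a = 0 := by omega
      have hb : β.deg b = 0 := by omega
      have hc : β.deg c = 0 := by omega
      have hd : β.deg d = 0 := by omega
      refine hne ?_
      rw [cyclicForm_apply, Pi.add_apply, rotateFirst_cons, rotateFirst_cons]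
      have k4 : ksign K 4 = 1 := ksign_even (by decide)
      have k3 : ksign K 3 = -1 := ksign_odd (by decide)
      simp [splitSum_cons, splitSum_nil, swapTensor, hz, hz1, hz0, wordDeg, ha, hb, hc, hd,
        ksign_zero, k4, k3]
      rw [hF, β.lieOperator_unitForm_apply ha hc, β.lieOperator_unitForm_apply hb hd,
        β.lieOperator_unitForm_apply hc ha, β.lieOperator_unitForm_apply hd hb,
        β.counit_mul_rotate ha hb hc hd, β.counit_mul_rotate hc hd ha hb]
      ring
  have h := markFirst_cyclicForm_of_weight (c := fun _ => (1 : K)) (q := (4 : ℕ)) hFT fun p hp => by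
    obtain ⟨a, b, c, d, rfl⟩ := β.exists_of_lieOperator_unitForm_ne_zero hp
    simp [contentWeight]
    norm_num
  rw [hc, map_zero, zero_sub] at h
  exact mem_of_smul_mem (by norm_num) ((Submodule.neg_mem_iff _).1 h)

end UnitClass

/-! ### Comparison of normalised and unnormalised cohomology -/

section Comparison

variable {K A ι : Type*} [CommRing K] [Ring A] [Algebra K A] {𝒜 : ℕ → Submodule K A}

theorem UnitalBasis.mem_cyclicHarr {β : UnitalBasis 𝒜 ι} {i j : ℤ} {x : β.Forms} :
    x ∈ β.cyclicHarr i j ↔ ∃ F, ∃ hF : F ∈ lieTensor K β.deg Set.univ,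
      F ∈ homogeneousPart K β.deg i j ∧ Submodule.Quotient.mk ⟨F, hF⟩ = x :=
  ⟨fun ⟨F, h, e⟩ => ⟨F.1, F.2, h, e⟩, fun ⟨F, hF, h, e⟩ => ⟨⟨F, hF⟩, h, e⟩⟩

theorem UnitalBasis.mem_normCyclicHarr {β : UnitalBasis 𝒜 ι} {i j : ℤ} {x : β.Forms} :
    x ∈ β.normCyclicHarr i j ↔ ∃ F, ∃ hF : F ∈ lieTensor K β.deg {a | a ≠ β.unit},
      F ∈ homogeneousPart K β.deg i j ∧
        Submodule.Quotient.mk ⟨F, lieTensor_mono β.deg (Set.subset_univ _) hF⟩ = x :=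
  ⟨fun ⟨_, ⟨F, h, e⟩, e'⟩ => ⟨F.1, F.2, h, by rw [← e', ← e]; rfl⟩,
    fun ⟨F, hF, h, e⟩ => ⟨_, ⟨⟨F, hF⟩, h, rfl⟩, by rw [← e]; rfl⟩⟩

theorem mk_eq_mk_iff {deg : ι → ℕ} {S : Set ι} {F G : List ι × List ι → K}
    (hF : F ∈ lieTensor K deg S) (hG : G ∈ lieTensor K deg S) :
    (Submodule.Quotient.mk ⟨F, hF⟩ : ZeroForms K deg S) = Submodule.Quotient.mk ⟨G, hG⟩ ↔
      F - G ∈ lieRelations K deg S :=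
  Submodule.Quotient.eq _

/-- The coefficient of the word `t u t u t u` in the cyclic form, where `t u` is the letter dual to
the unit. It detects the cohomology of the ground ring. -/
def UnitalBasis.unitCoeff (β : UnitalBasis 𝒜 ι) : β.Forms →ₗ[K] K :=
  Submodule.liftQ _
    ((LinearMap.proj [β.unit, β.unit, β.unit] ∘ₗ cyclicForm K β.deg) ∘ₗ
      (lieTensor K β.deg Set.univ).subtype)
    fun F hF => by
      change cyclicForm K β.deg F.1 [β.unit, β.unit, β.unit] = 0
      rw [cyclicForm_eq_zero (F := F.1) hF, Pi.zero_apply]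

theorem UnitalBasis.unitCoeff_formsToGround (β : UnitalBasis 𝒜 ι) (x : β.Forms) :
    (groundBasis K).unitCoeff (β.formsToGround x) = β.unitCoeff x := by
  obtain ⟨F, rfl⟩ := Submodule.mkQ_surjective _ x
  exact (cyclicForm_map (φ := fun _ : Unit => β.unit) (deg' := (groundBasis K).deg)
    (fun _ => β.deg_unit) F.1 [(), (), ()]).symm

/-- A word in letters different from the unit contributes nothing over the ground ring. -/
theorem UnitalBasis.formsToGround_eq_zero (β : UnitalBasis 𝒜 ι) {i j : ℤ} {x : β.Forms}
    (hx : x ∈ β.normCyclicHarr i j) : β.formsToGround x = 0 := by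
  obtain ⟨F, hF, -, rfl⟩ := UnitalBasis.mem_normCyclicHarr.1 hx
  have : pullbackTensor K (fun _ : Unit => β.unit) F = 0 := by
    funext ⟨w, v⟩
    change F (w.map fun _ => β.unit, v.map fun _ => β.unit) = 0
    rcases w with _ | ⟨a, w⟩
    · exact (lieTensor_apply_nil hF _).1
    · by_contra hne
      exact mem_of_mem_lieTensor hF hne β.unit (by simp) rfl
  refine (Submodule.Quotient.mk_eq_zero _).2 ?_
  change pullbackTensor K (fun _ : Unit => β.unit) F ∈
    lieRelations K (groundBasis K).deg Set.univ
  rw [this]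
  exact Submodule.zero_mem _

/-- The letter of the ground ring has degree one and is the only one, so the forms of the ground ring
are detected by `unitCoeff`. -/
theorem groundForms_eq_zero [Algebra ℚ K] {i j : ℤ} {x : (groundBasis K).Forms}
    (hx : x ∈ (groundBasis K).cyclicHarr i j) (h : i ≠ 3 ∨ (groundBasis K).unitCoeff x = 0) :
    x = 0 := by
  obtain ⟨F, hF, hh, rfl⟩ := UnitalBasis.mem_cyclicHarr.1 hx
  refine (Submodule.Quotient.mk_eq_zero _).2 ?_
  refine mem_lieRelations_of_neCount_zero (u := ()) (n := i.toNat) rfl hF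
    (fun p _ => by simp [neCount]) (fun p hp => ?_) ?_
  · have := (hh p hp).1
    omega
  · rcases h with h | h
    · by_contra hne
      obtain ⟨p, hp, e⟩ := exists_of_cyclicForm_ne_zero hne
      have := (mem_homogeneousPart_iff.1 hh p hp).1
      rw [e] at this
      exact h (by simpa using this.symm)
    · exact h

variable [Algebra ℚ K] [GradedAlgebra 𝒜] [IsGradedCommutative 𝒜] (β : UnitalBasis 𝒜 ι)

theorem UnitalBasis.d_mk {F : List ι × List ι → K} (hF : F ∈ lieTensor K β.deg Set.univ) :
    β.d (Submodule.Quotient.mk ⟨F, hF⟩) = Submodule.Quotient.mk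
      ⟨lieOperator β.structConst β.deg F, lieOperator_mem β.isGradedCommStructure F hF⟩ := rfl

theorem UnitalBasis.d_d (x : β.Forms) : β.d (β.d x) = 0 := by
  obtain ⟨F, rfl⟩ := Submodule.mkQ_surjective _ x
  refine congrArg Submodule.Quotient.mk (Subtype.ext ?_)
  exact lieOperator_lieOperator β.isGradedCommStructure β.isAssocStructure F.2

/-- Up to a coboundary, a form with normalised differential is normalised. The form over the ground
ring is the only obstruction, and it occurs in bidegree `(3, 2)` only. -/
theorem UnitalBasis.exists_sub_d_mem_normCyclicHarr {i j i' j' : ℤ} {x : β.Forms}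
    (hx : x ∈ β.cyclicHarr i j) (hd : β.d x ∈ β.normCyclicHarr i' j')
    (h : (i, j) ≠ (3, 2) ∨ β.unitCoeff x = 0) :
    ∃ y ∈ β.cyclicHarr (i - 1) (j - 1), x - β.d y ∈ β.normCyclicHarr i j := by
  obtain ⟨F, hF, hh, rfl⟩ := UnitalBasis.mem_cyclicHarr.1 hx
  obtain ⟨N, hN, -, e⟩ := UnitalBasis.mem_normCyclicHarr.1 hd
  rw [β.d_mk, eq_comm, mk_eq_mk_iff] at e
  obtain ⟨F', hF', hh', hs, G, hG, hGh, hR⟩ := exists_normalised β.deg_unit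
    β.isGradedCommStructure β.isAssocStructure β.isUnitIndex N
    (fun p hp hu => mem_of_mem_lieTensor hN hp _ hu rfl) (i.toNat + 1) 0 (by omega) F hF hh
    (fun p _ => Or.inl (Nat.zero_le _)) e fun _ => h
  have hF'n : F' ∈ lieTensor K β.deg {a | a ≠ β.unit} := by
    rw [← restrictContent_eq_self (A := fun s => β.unit ∉ s) hs]
    refine restrictContent_mem_lieTensor (fun s hs _ a ha => ?_) hF'
    rintro rfl
    exact hs ha
  refine ⟨_, UnitalBasis.mem_cyclicHarr.2 ⟨G, hG, hGh, rfl⟩,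
    UnitalBasis.mem_normCyclicHarr.2 ⟨F', hF'n, hh', ?_⟩⟩
  rw [β.d_mk, eq_sub_iff_add_eq, eq_comm, ← Submodule.Quotient.mk_add]
  refine (mk_eq_mk_iff hF _).2 ?_
  rw [show F - (F' + lieOperator β.structConst β.deg G) =
    F - F' - lieOperator β.structConst β.deg G by abel]
  exact hR

/-- The class of `unitForm`. -/
noncomputable def UnitalBasis.unitClass : β.Forms :=
  Submodule.Quotient.mk ⟨β.unitForm, β.unitForm_mem⟩

theorem UnitalBasis.unitClass_mem : β.unitClass ∈ β.cyclicHarr 3 2 :=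
  UnitalBasis.mem_cyclicHarr.2 ⟨_, β.unitForm_mem, β.unitForm_homogeneous, rfl⟩

theorem UnitalBasis.d_unitClass : β.d β.unitClass = 0 :=
  (Submodule.Quotient.mk_eq_zero _).2 β.lieOperator_unitForm_mem

theorem UnitalBasis.unitCoeff_unitClass : β.unitCoeff β.unitClass = 3 := β.cyclicForm_unitForm

/-- A cocycle of bidegree `(3, 2)` with prescribed `unitCoeff`. -/
theorem UnitalBasis.exists_cocycle (r : K) :
    ∃ x ∈ β.cyclicHarr 3 2, β.d x = 0 ∧ β.unitCoeff x = r := by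
  refine ⟨(algebraMap ℚ K (1 / 3) * r) • β.unitClass, Submodule.smul_mem _ _ β.unitClass_mem,
    by rw [map_smul, β.d_unitClass, smul_zero], ?_⟩
  rw [map_smul, β.unitCoeff_unitClass, smul_eq_mul, mul_right_comm,
    ← map_ofNat (algebraMap ℚ K) 3, ← map_mul]
  norm_num

theorem UnitalBasis.normInclusion_injective (i j : ℤ) :
    Function.Injective (β.normInclusion i j) := by
  rw [← LinearMap.ker_eq_bot, LinearMap.ker_eq_bot']
  intro c hc
  obtain ⟨f, rfl⟩ := Submodule.Quotient.mk_surjective _ c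
  obtain ⟨g, hg, hgf⟩ : ∃ g ∈ β.cyclicHarr (i - 1) (j - 1), β.d g = f.1 :=
    (Submodule.Quotient.mk_eq_zero _).1 hc
  -- A cocycle may be subtracted from `g` to remove its component over the ground ring.
  obtain ⟨g', hg', hgf', h⟩ : ∃ g ∈ β.cyclicHarr (i - 1) (j - 1), β.d g = f.1 ∧
      ((i - 1, j - 1) ≠ (3, 2) ∨ β.unitCoeff g = 0) := by
    by_cases hij : ((i - 1, j - 1) : ℤ × ℤ) = (3, 2)
    · obtain ⟨z, hz, hdz, hzc⟩ := β.exists_cocycle (β.unitCoeff g)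
      obtain ⟨e1, e2⟩ := Prod.ext_iff.1 hij
      simp only at e1 e2
      rw [e1, e2] at hg ⊢
      exact ⟨g - z, Submodule.sub_mem _ hg hz, by rw [map_sub, hdz, sub_zero, hgf],
        Or.inr (by rw [map_sub, hzc, sub_self])⟩
    · exact ⟨g, hg, hgf, Or.inl hij⟩
  obtain ⟨y, -, hy⟩ := β.exists_sub_d_mem_normCyclicHarr hg' (hgf' ▸ f.2.1) h
  refine (Submodule.Quotient.mk_eq_zero _).2 ⟨_, hy, ?_⟩
  rw [map_sub, β.d_d, sub_zero, hgf']
  rfl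

/-- A cocycle which is cohomologous to a normalised form is in the image of `normInclusion`. -/
theorem UnitalBasis.mk_mem_range_normInclusion {i j : ℤ}
    (f : ↥(β.cyclicHarr i j ⊓ LinearMap.ker β.d)) (h : (i, j) ≠ (3, 2) ∨ β.unitCoeff f.1 = 0) :
    ∃ c, β.normInclusion i j c = Submodule.Quotient.mk f := by
  have hf : β.d f.1 = 0 := f.2.2
  obtain ⟨y, hy, hfy⟩ := β.exists_sub_d_mem_normCyclicHarr (i' := 0) (j' := 0) f.2.1
    (hf ▸ Submodule.zero_mem _) h
  refine ⟨Submodule.Quotient.mk ⟨f.1 - β.d y, hfy, ?_⟩, ?_⟩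
  · change β.d (f.1 - β.d y) = 0
    rw [map_sub, β.d_d, sub_zero, hf]
  · refine (Submodule.Quotient.eq _).2 ⟨-y, Submodule.neg_mem _ hy, ?_⟩
    rw [map_neg]
    change _ = f.1 - β.d y - f.1
    abel

theorem UnitalBasis.normInclusion_bijective {i j : ℤ} (h : (i, j) ≠ (3, 2)) :
    Function.Bijective (β.normInclusion i j) := by
  refine ⟨β.normInclusion_injective i j, fun c => ?_⟩
  obtain ⟨f, rfl⟩ := Submodule.Quotient.mk_surjective _ c
  exact β.mk_mem_range_normInclusion f (Or.inl h)

theorem groundForms_coboundary_eq_zero {x : (groundBasis K).Forms}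
    (hx : x ∈ ((groundBasis K).cyclicHarr (3 - 1) (2 - 1)).map (groundBasis K).d) : x = 0 := by
  obtain ⟨z, hz, rfl⟩ := hx
  rw [groundForms_eq_zero hz (Or.inl (by norm_num)), map_zero]

theorem UnitalBasis.toGround_mk_eq_zero_iff {i j : ℤ}
    {f : ↥(β.cyclicHarr i j ⊓ LinearMap.ker β.d)} :
    β.toGround i j (Submodule.Quotient.mk f) = 0 ↔ β.formsToGround f.1 ∈
      ((groundBasis K).cyclicHarr (i - 1) (j - 1)).map (groundBasis K).d :=
  Submodule.Quotient.mk_eq_zero (p := (((groundBasis K).cyclicHarr (i - 1) (j - 1)).map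
    (groundBasis K).d).comap
      ((groundBasis K).cyclicHarr i j ⊓ LinearMap.ker (groundBasis K).d).subtype)

theorem UnitalBasis.exact_normInclusion_toGround :
    Function.Exact (β.normInclusion 3 2) (β.toGround 3 2) := by
  intro c
  constructor
  · obtain ⟨f, rfl⟩ := Submodule.Quotient.mk_surjective _ c
    intro hc
    have h : β.formsToGround f.1 = 0 :=
      groundForms_coboundary_eq_zero (β.toGround_mk_eq_zero_iff.1 hc)
    refine β.mk_mem_range_normInclusion f (Or.inr ?_)
    rw [← β.unitCoeff_formsToGround, h, map_zero]
  · rintro ⟨c, rfl⟩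
    obtain ⟨f, rfl⟩ := Submodule.Quotient.mk_surjective _ c
    have h : β.formsToGround f.1 = 0 := β.formsToGround_eq_zero f.2.1
    refine β.toGround_mk_eq_zero_iff.2 ?_
    change β.formsToGround f.1 ∈ _
    rw [h]
    exact Submodule.zero_mem _

theorem UnitalBasis.toGround_surjective : Function.Surjective (β.toGround 3 2) := by
  intro c
  obtain ⟨f, rfl⟩ := Submodule.Quotient.mk_surjective _ c
  obtain ⟨x, hx, hdx, hxc⟩ := β.exists_cocycle ((groundBasis K).unitCoeff f.1)
  refine ⟨Submodule.Quotient.mk ⟨x, hx, hdx⟩, congrArg Submodule.Quotient.mk (Subtype.ext ?_)⟩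
  change β.formsToGround x = f.1
  refine sub_eq_zero.1 (groundForms_eq_zero
    (Submodule.sub_mem _ (β.formsToGround_mem 3 2 x hx) f.2.1) (Or.inr ?_))
  rw [map_sub, β.unitCoeff_formsToGround, hxc, sub_self]

theorem groundHCHarr_equiv (K : Type*) [CommRing K] [Algebra ℚ K] :
    Nonempty ((groundBasis K).HCHarr 3 2 ≃ₗ[K] K) := by
  let T : (groundBasis K).HCHarr 3 2 →ₗ[K] K := Submodule.liftQ _
    ((groundBasis K).unitCoeff ∘ₗ Submodule.subtype _) fun f hf => by
      change (groundBasis K).unitCoeff f.1 = 0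
      rw [groundForms_coboundary_eq_zero (x := f.1) hf, map_zero]
  refine ⟨LinearEquiv.ofBijective T ⟨?_, fun r => ?_⟩⟩
  · rw [← LinearMap.ker_eq_bot, LinearMap.ker_eq_bot']
    intro c hc
    obtain ⟨f, rfl⟩ := Submodule.Quotient.mk_surjective _ c
    rw [show f = 0 from Subtype.ext (groundForms_eq_zero f.2.1 (Or.inr hc))]
    rfl
  · obtain ⟨x, hx, hdx, hxc⟩ := (groundBasis K).exists_cocycle r
    exact ⟨Submodule.Quotient.mk ⟨x, hx, hdx⟩, hxc⟩

end Comparison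

end CyclicHarrison

theorem mainTheorem12 {K A ι : Type*} [CommRing K] [Algebra ℚ K] [Ring A] [Algebra K A]
    (𝒜 : ℕ → Submodule K A) [GradedAlgebra 𝒜] [CyclicHarrison.IsGradedCommutative 𝒜]
    (β : CyclicHarrison.UnitalBasis 𝒜 ι) :
    (∀ i j : ℤ, (i, j) ≠ (3, 2) → Function.Bijective (β.normInclusion i j)) ∧
      Function.Injective (β.normInclusion 3 2) ∧
      Function.Exact (β.normInclusion 3 2) (β.toGround 3 2) ∧
      Function.Surjective (β.toGround 3 2) ∧
      Nonempty ((CyclicHarrison.groundBasis K).HCHarr 3 2 ≃ₗ[K] K) :=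
  ⟨fun _ _ h => β.normInclusion_bijective h, β.normInclusion_injective 3 2,
    β.exact_normInclusion_toGround, β.toGround_surjective,
    CyclicHarrison.groundHCHarr_equiv K⟩
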